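/- Let $0<K<L<s_0$, $r\ge 0$, $\sigma>0$, $T>0$. In the Black–Scholes model $S_t=s_0\exp\big((r-\tfrac{\sigma^2}{2})t+\sigma B_t\big)$, where $B$ is a standard Brownian motion under the risk-neutral measure, and with $S_{\inf}=\inf_{t\in[0,T]}S_t$, the down-and-out digital call has payoff $\mathbf 1_{S_T\ge K}\mathbf 1_{S_{\inf}>L}$ and the down-and-in digital call has payoff $\mathbf 1_{S_T\ge K}\mathbf 1_{S_{\inf}\le L}$; $\mathrm{price}_{BS}$ is $e^{-rT}$ times the expected payoff. In the $n$-step CRR tree put $\Delta\tau=T/n$, $u=e^{\sigma\sqrt{\Delta\tau}}=d^{-1}$, $p=\frac{e^{r\Delta\tau}-d}{u-d}$. The price starts at $s_0$ and is multiplied at each step, independently, by $u$ with probability $p$ or by $d$ with probability $1-p$, so that the nodes are $S_{i,j}=s_0u^jd^{i-j}$. Then $\mathrm{price}_{CRR}(n)$ is $e^{-rT}$ times the expected payoff on the tree, where $S_T$ is replaced by the terminal price and $S_{\inf}$ by the minimum of the price over the steps $0,\dots,n$. Let $\mathrm{Err}(n)=\mathrm{price}_{CRR}(n)-\mathrm{price}_{BS}$.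 With $\mathrm{frac}(x)=x-\lfloor x\rfloor$ let $$\Delta^K_n=1-2\,\mathrm{frac}\Big(\frac{\log(s_0/K)}{2\sigma\sqrt{\Delta\tau}}-\frac n2\Big),\qquad l_L=\frac{\log(L/s_0)}{2\sigma\sqrt{\Delta\tau}}+\frac n2,\qquad \Delta^L_n=\mathrm{frac}(2l_L),$$ and let $\epsilon_n=1$ if the effective barrier $\tilde L=s_0u^{j_L}d^{\,n-j_L}$, $j_L=\frac12\lfloor 2l_L\rfloor$, is one of the terminal prices $S_{n,0},\dots,S_{n,n}$, and $\epsilon_n=0$ otherwise. Then, as $n\to\infty$, for the down-and-out digital call $$\mathrm{Err}(n)=e^{-rT}\Big[\frac{\tilde E_1+\tilde E_2\Delta^L_n}{\sqrt n}+\frac{\tilde F_1+\tilde F_2\Delta^L_n+\tilde F_3(\Delta^L_n)^2}{n}\Big]+O(n^{-3/2}),$$ and for the down-and-in digital call $$\mathrm{Err}(n)=e^{-rT}\Big[\frac{\tilde G_1+\tilde G_2\Delta^K_n+\tilde G_3\Delta^L_n}{\sqrt n}+\frac{\tilde H_1+\tilde H_2(\Delta^K_n)^2+\tilde H_3\Delta^L_n+\tilde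 H_4(\Delta^L_n)^2}{n}\Big]+O(n^{-3/2}).$$ The coefficients are as follows. Let $\Phi$ and $\varphi$ be the standard normal distribution function and density, $R=(s_0/L)^{1-2r/\sigma^2}$, $$d_{11}=\frac{\log\frac{s_0}{K}+(r+\frac{\sigma^2}2)T}{\sigma\sqrt T},\quad d_{31}=\frac{\log\frac{s_0}{L}+(r+\frac{\sigma^2}2)T}{\sigma\sqrt T},\quad d_{41}=\frac{\log\frac{L}{s_0}+(r+\frac{\sigma^2}2)T}{\sigma\sqrt T},\quad d_{i2}=d_{i1}-\sigma\sqrt T,$$ $$\alpha=\frac{r-\frac{\sigma^2}{2}}{2\sigma},\qquad \beta=\frac{\sigma^4-4\sigma^2r+12r^2}{48\sigma},\qquad I=\frac{4\beta+\frac{16}{3}\alpha^3}{\sigma}\,T\log\frac{s_0}{L},$$ $$g_i=2T(\alpha^2d_{i2}+\beta\sqrt T)+\Big(\frac{2\alpha\sqrt T}{3}-\frac{d_{i2}}{12}\Big)(1-d_{i2}^2)\quad(i=3,4),$$ $$\tilde c=\frac{d_{11}^3+d_{11}d_{12}^2+2d_{12}-4d_{11}}{24}+\frac{(2-d_{11}d_{12}-d_{11}^2)\sqrt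 T}{6\sigma}r+\frac{Td_{11}}{2\sigma^2}r^2,$$ $$c_1=\varphi(d_{12}),\qquad c_2=-\frac{d_{12}}2\varphi(d_{12}),\qquad c_3=\tilde c\,\varphi(d_{12}).$$ Then $$\tilde E_1=-\epsilon_n\varphi(d_{32})+R\,\epsilon_n\varphi(d_{42}),\qquad \tilde E_2=\varphi(d_{32})+R\big(\varphi(d_{42})+4\alpha\sqrt T\,\Phi(d_{42})\big),$$ $$\tilde F_1=\varphi(d_{32})\Big(g_3-\frac{d_{32}}2\epsilon_n^2\Big)+R\,\varphi(d_{42})\Big(\frac{d_{42}}2\epsilon_n^2-g_4\Big)+R\,I\,\Phi(d_{42}),$$ $$\tilde F_2=\varphi(d_{32})d_{32}\epsilon_n+R\,\varphi(d_{42})\big(\epsilon_nd_{42}-4\epsilon_n\alpha\sqrt T\big),$$ $$\tilde F_3=-\frac{d_{32}}2\varphi(d_{32})+R\,\varphi(d_{42})\Big(\frac{d_{42}}2-4\alpha\sqrt T\Big)-8\alpha^2T\,R\,\Phi(d_{42}),$$ $$\tilde G_1=-\tilde E_1,\quad \tilde G_2=c_1,\quad \tilde G_3=-\tilde E_2,\quad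 \tilde H_1=c_3-\tilde F_1,\quad \tilde H_2=c_2,\quad \tilde H_3=-\tilde F_2,\quad \tilde H_4=-\tilde F_3.$$ -/

import Mathlib

open Real Filter Asymptotics MeasureTheory ProbabilityTheory
open scoped NNReal

noncomputable section

/-- The data of a digital call with a lower barrier in the Black-Scholes market: initial price `s0`,
strike `K`, lower barrier `L`, interest rate `r`, volatility `σ`, maturity `T`. -/
structure BarrierModel where
  s0 : ℝ
  K : ℝ
  L : ℝ
  r : ℝ
  σ : ℝ
  T : ℝ

namespace BarrierModel

variable (M : BarrierModel)

/-! ### Payoffs, as functions of the terminal price and of the running minimum -/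

/-- Down-and-out digital call: pays `1` if the terminal price is at least `K` and the minimum
stays above `L`. -/
def payoffOut (sT sInf : ℝ) : ℝ := if M.K ≤ sT ∧ M.L < sInf then 1 else 0

/-- Down-and-in digital call: pays `1` if the terminal price is at least `K` and the barrier `L`
has been touched or crossed. -/
def payoffIn (sT sInf : ℝ) : ℝ := if M.K ≤ sT ∧ sInf ≤ M.L then 1 else 0

/-! ### Black-Scholes prices -/

section BlackScholes

variable {Ω : Type*} [MeasurableSpace Ω]

/-- The solution of `dS = r S dt + σ S dB`, `S 0 = s0`. -/
def stock (B : ℝ≥0 → Ω → ℝ) (t : ℝ≥0) (ω : Ω) : ℝ :=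
  M.s0 * exp ((M.r - M.σ ^ 2 / 2) * (t : ℝ) + M.σ * B t ω)

/-- The infimum of the stock price over `[0, T]`. -/
def stockInf (B : ℝ≥0 → Ω → ℝ) (ω : Ω) : ℝ :=
  ⨅ t : Set.Icc (0 : ℝ≥0) M.T.toNNReal, M.stock B t ω

def priceBSOut (P : Measure Ω) (B : ℝ≥0 → Ω → ℝ) : ℝ :=
  exp (-M.r * M.T) * ∫ ω, M.payoffOut (M.stock B M.T.toNNReal ω) (M.stockInf B ω) ∂P

def priceBSIn (P : Measure Ω) (B : ℝ≥0 → Ω → ℝ) : ℝ :=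
  exp (-M.r * M.T) * ∫ ω, M.payoffIn (M.stock B M.T.toNNReal ω) (M.stockInf B ω) ∂P

end BlackScholes

/-! ### The CRR tree with `n` steps -/

/-- The time step `Δτ = T / n`. -/
def dt (n : ℕ) : ℝ := M.T / n

def up (n : ℕ) : ℝ := exp (M.σ * √(M.dt n))

def down (n : ℕ) : ℝ := (M.up n)⁻¹

/-- The risk-neutral probability of an up move. -/
def prob (n : ℕ) : ℝ := (exp (M.r * M.dt n) - M.down n) / (M.up n - M.down n)

/-- The price at the node `(i, j)`: `i` steps, `j` of them up. -/
def node (n i j : ℕ) : ℝ := M.s0 * exp ((2 * (j : ℝ) - i) * (M.σ * √(M.dt n)))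

/-- The number of up moves among the first `i` steps of a path (`true` is an up move). -/
def numUp {n : ℕ} (path : Fin n → Bool) (i : ℕ) : ℕ :=
  (Finset.univ.filter fun k : Fin n => (k : ℕ) < i ∧ path k = true).card

/-- The price after `i` steps along a path. -/
def treePrice {n : ℕ} (path : Fin n → Bool) (i : ℕ) : ℝ := M.node n i (numUp path i)

/-- The minimum of the price along a path. -/
def treeMin {n : ℕ} (path : Fin n → Bool) : ℝ :=
  ⨅ i : Fin (n + 1), M.treePrice path (i : ℕ)

/-- The probability of a path. -/
def pathWeight {n : ℕ} (path : Fin n → Bool) : ℝ :=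
  ∏ k : Fin n, if path k = true then M.prob n else 1 - M.prob n

def priceCRROut (n : ℕ) : ℝ :=
  exp (-M.r * M.T) * ∑ path : Fin n → Bool,
    M.pathWeight path * M.payoffOut (M.treePrice path n) (M.treeMin path)

def priceCRRIn (n : ℕ) : ℝ :=
  exp (-M.r * M.T) * ∑ path : Fin n → Bool,
    M.pathWeight path * M.payoffIn (M.treePrice path n) (M.treeMin path)

/-! ### The position of the strike and of the barrier relative to the nodes -/

/-- `Δ^K_n`. -/
def ΔK (n : ℕ) : ℝ :=
  1 - 2 * Int.fract (log (M.s0 / M.K) / (2 * M.σ * √(M.dt n)) - (n : ℝ) / 2)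

def lL (n : ℕ) : ℝ := log (M.L / M.s0) / (2 * M.σ * √(M.dt n)) + (n : ℝ) / 2

/-- `Δ^L_n`. -/
def ΔL (n : ℕ) : ℝ := Int.fract (2 * M.lL n)

/-- The effective barrier: the largest price `s0 * u ^ m`, with `m` an integer, that is at
most `L`. With `j = ⌊2 * l_L⌋ / 2` it is `s0 * u ^ j * d ^ (n - j)`. -/
def effectiveBarrier (n : ℕ) : ℝ :=
  M.s0 * exp (((⌊2 * M.lL n⌋ : ℝ) - n) * (M.σ * √(M.dt n)))

open Classical in
/-- `ε_n`: `1` if the effective barrier is a terminal price of the tree, `0` otherwise. -/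
def ε (n : ℕ) : ℝ := if ∃ j ≤ n, M.node n n j = M.effectiveBarrier n then 1 else 0

/-! ### The coefficients -/

/-- The standard normal distribution function. -/
def Φ (x : ℝ) : ℝ := cdf (gaussianReal 0 1) x

/-- The standard normal density. -/
def φ (x : ℝ) : ℝ := exp (-x ^ 2 / 2) / √(2 * π)

def d11 : ℝ := (log (M.s0 / M.K) + (M.r + M.σ ^ 2 / 2) * M.T) / (M.σ * √M.T)

def d12 : ℝ := M.d11 - M.σ * √M.T

def d31 : ℝ := (log (M.s0 / M.L) + (M.r + M.σ ^ 2 / 2) * M.T) / (M.σ * √M.T)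

def d32 : ℝ := M.d31 - M.σ * √M.T

def d41 : ℝ := (log (M.L / M.s0) + (M.r + M.σ ^ 2 / 2) * M.T) / (M.σ * √M.T)

def d42 : ℝ := M.d41 - M.σ * √M.T

def α : ℝ := (M.r - M.σ ^ 2 / 2) / (2 * M.σ)

def β : ℝ := (M.σ ^ 4 - 4 * M.σ ^ 2 * M.r + 12 * M.r ^ 2) / (48 * M.σ)

/-- `g_i` is `g` at `d_{i2}`. -/
def g (d : ℝ) : ℝ :=
  2 * M.T * (M.α ^ 2 * d + M.β * √M.T) + (2 * M.α * √M.T / 3 - d / 12) * (1 - d ^ 2)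

/-- The constant `I`. -/
def I : ℝ := (4 * M.β + 16 / 3 * M.α ^ 3) / M.σ * log (M.s0 / M.L) * M.T

/-- The factor `(s0 / L) ^ (1 - 2 r / σ²)`. -/
def R : ℝ := (M.s0 / M.L) ^ (1 - 2 * M.r / M.σ ^ 2)

def c1 : ℝ := φ M.d12

def c2 : ℝ := -(M.d12 / 2) * φ M.d12

def cTilde : ℝ :=
  (M.d11 ^ 3 + M.d11 * M.d12 ^ 2 + 2 * M.d12 - 4 * M.d11) / 24
    + (2 - M.d11 * M.d12 - M.d11 ^ 2) * √M.T / (6 * M.σ) * M.r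
    + M.T * M.d11 / (2 * M.σ ^ 2) * M.r ^ 2

def c3 : ℝ := M.cTilde * φ M.d12

def E1 (n : ℕ) : ℝ := -M.ε n * φ M.d32 + M.R * (M.ε n * φ M.d42)

def E2 : ℝ := φ M.d32 + M.R * (φ M.d42 + 4 * M.α * √M.T * Φ M.d42)

def F1 (n : ℕ) : ℝ :=
  φ M.d32 * (M.g M.d32 - M.d32 / 2 * M.ε n ^ 2)
    + M.R * φ M.d42 * (M.d42 / 2 * M.ε n ^ 2 - M.g M.d42)
    + Φ M.d42 * M.I * M.R

def F2 (n : ℕ) : ℝ :=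
  φ M.d32 * M.d32 * M.ε n
    + M.R * φ M.d42 * (M.ε n * M.d42 - 4 * M.ε n * M.α * √M.T)

def F3 : ℝ :=
  -(M.d32 / 2) * φ M.d32 + M.R * φ M.d42 * (M.d42 / 2 - 4 * M.α * √M.T)
    - M.R * Φ M.d42 * (8 * M.α ^ 2 * M.T)

def G1 (n : ℕ) : ℝ := -M.E1 n

def G2 : ℝ := M.c1

def G3 : ℝ := -M.E2

def H1 (n : ℕ) : ℝ := M.c3 - M.F1 n

def H2 : ℝ := M.c2

def H3 (n : ℕ) : ℝ := -M.F2 n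

def H4 : ℝ := -M.F3

end BarrierModel

end

open scoped Topology

noncomputable section

namespace BarrierModel

/-! ### The standard normal distribution -/

/-! Both prices have a closed form given by a reflection principle, and the closed form on the tree
is expanded in powers of `1/√n` around the continuous one.

Continuous side. Because `K < L`, a path that stays above `L` also ends above `K`. The knock-out
value is therefore the probability that Brownian motion with drift `ν = 2α`, started at `b = log
(s0/L) / σ`, stays positive on `[0, T]`; the knock-in value is the plain digital minus it. The
survival probability is found without the strong Markov property. The function `h` equal to `1` on
`(0, A)` and to `-exp (-2νy)` on `(-A, 0)` has mean zero for the motion started at the origin.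
Splitting `E h(X_T)` at the first grid time where the path is nonpositive, the crossing part tends
to zero with the mesh, since the path has then just passed the origin. What remains is the survival
probability (`tendsto_measure_survival_grid`, `measure_stay`).

Tree side. With `m = ⌊2 l_L⌋`, the discrete reflection principle `walkStay_eq` writes the
undiscounted knock-out price as one minus a binomial distribution function at `p`, minus
`(p/(1-p))^(m-n)` times a binomial distribution function at `1 - p`.

Expansion. A binomial distribution function is a normalised incomplete beta integral. With `p = (1 -
y/√n)/2` and `δ√n = n - 1 - 2k`, the rescaled beta kernel is a Gaussian times `1 + polynomial/n`,
with an error of order `n⁻²` under a Gaussian envelope. Dividing by the total mass avoids Stirling's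
formula and gives `Φ(y-δ) + φ(y-δ) betaPoly(δ,y)/n + O(n⁻²)`, uniformly for bounded `y` and `δ`
(`exists_binomCdf_bound`). Lattice effects enter only through `δ = δ₀ + s_n/√n` with `s_n` bounded:
`s_n` is `ΔL - ε`, `ΔL + ε` or `ΔK`. The calculus of `HasExpansion` inserts this, together with the
expansions of the risk-neutral probability (`hasExpansion_probPos`) and of the likelihood ratio
(`hasExpansion_ratio`). The stated coefficients then follow by algebra. -/

lemma φ_eq_gaussianPDFReal (x : ℝ) : φ x = gaussianPDFReal 0 1 x := by
  simp only [φ, gaussianPDFReal, NNReal.coe_one, mul_one, sub_zero]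
  rw [div_eq_inv_mul]

lemma continuous_φ : Continuous φ := by
  unfold φ; fun_prop

lemma φ_pos (x : ℝ) : 0 < φ x := by unfold φ; positivity

lemma φ_le_one (x : ℝ) : φ x ≤ 1 := by
  have h2 : 1 ≤ √(2 * π) := by
    rw [Real.one_le_sqrt]; linarith [pi_gt_three]
  have h1 : exp (-x ^ 2 / 2) ≤ 1 := exp_le_one_iff.2 (by nlinarith [sq_nonneg x])
  unfold φ
  rw [div_le_one (by positivity)]
  exact h1.trans h2

lemma φ_neg (x : ℝ) : φ (-x) = φ x := by simp [φ]

lemma hasDerivAt_φ (x : ℝ) : HasDerivAt φ (-x * φ x) x := by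
  have h1 : HasDerivAt (fun x : ℝ => -x ^ 2 / 2) (-x) x := by
    have := ((hasDerivAt_pow 2 x).neg).div_const 2
    refine this.congr_deriv ?_
    simp; ring
  have := (h1.exp).div_const √(2 * π)
  refine this.congr_deriv ?_
  unfold φ; ring

lemma integrable_φ : Integrable φ := by
  have : φ = gaussianPDFReal 0 1 := funext φ_eq_gaussianPDFReal
  rw [this]; exact integrable_gaussianPDFReal 0 1

lemma Φ_eq_integral (x : ℝ) : Φ x = ∫ y in Set.Iic x, φ y := by
  unfold Φ
  rw [cdf_eq_real, Measure.real, gaussianReal_apply_eq_integral 0 one_ne_zero, ENNReal.toReal_ofReal]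
  · simp_rw [φ_eq_gaussianPDFReal]
  · exact integral_nonneg fun _ => gaussianPDFReal_nonneg _ _ _

lemma hasDerivAt_Φ (x : ℝ) : HasDerivAt Φ (φ x) x := by
  have h : Φ = fun y => Φ x + ∫ t in x..y, φ t := by
    funext y
    rw [← intervalIntegral.integral_Iic_sub_Iic integrable_φ.integrableOn integrable_φ.integrableOn,
      Φ_eq_integral, Φ_eq_integral]
    ring
  rw [h]
  refine HasDerivAt.const_add _ ?_
  exact intervalIntegral.integral_hasDerivAt_right (continuous_φ.intervalIntegrable _ _)
    continuous_φ.stronglyMeasurable.stronglyMeasurableAtFilter continuous_φ.continuousAt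

lemma continuous_Φ : Continuous Φ :=
  continuous_iff_continuousAt.2 fun x => (hasDerivAt_Φ x).continuousAt

lemma Φ_nonneg (x : ℝ) : 0 ≤ Φ x := cdf_nonneg _ x

lemma Φ_le_one (x : ℝ) : Φ x ≤ 1 := cdf_le_one _ x

lemma tendsto_Φ_atTop : Tendsto Φ atTop (𝓝 1) := tendsto_cdf_atTop _

lemma tendsto_Φ_atBot : Tendsto Φ atBot (𝓝 0) := tendsto_cdf_atBot _

lemma Φ_neg (x : ℝ) : Φ (-x) = 1 - Φ x := by
  have hd : ∀ y : ℝ, HasDerivAt (fun y => Φ y + Φ (-y)) 0 y := by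
    intro y
    have h := (hasDerivAt_Φ y).add ((hasDerivAt_Φ (-y)).comp y (hasDerivAt_neg y))
    rw [φ_neg] at h
    refine h.congr_deriv ?_
    ring
  have hconst : ∀ y, Φ y + Φ (-y) = Φ x + Φ (-x) := fun y =>
    is_const_of_deriv_eq_zero (fun y => (hd y).differentiableAt) (fun y => (hd y).deriv) y x
  have h1 : Tendsto (fun y => Φ y + Φ (-y)) atTop (𝓝 (1 + 0)) :=
    tendsto_Φ_atTop.add (tendsto_Φ_atBot.comp tendsto_neg_atTop_atBot)
  have h2 : Tendsto (fun y => Φ y + Φ (-y)) atTop (𝓝 (Φ x + Φ (-x))) := by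
    simp_rw [hconst]; exact tendsto_const_nhds
  linarith [tendsto_nhds_unique h1 h2]

/-- Exponential moments of the standard normal distribution over an interval. -/
lemma setIntegral_exp_mul_gaussianReal (c : ℝ) {a b : ℝ} (hab : a ≤ b) :
    ∫ z in Set.Ioo a b, exp (c * z) ∂(gaussianReal 0 1)
      = exp (c ^ 2 / 2) * (Φ (b - c) - Φ (a - c)) := by
  have hd : ∀ z : ℝ, HasDerivAt (fun z => exp (c ^ 2 / 2) * Φ (z - c)) (exp (c * z) * φ z) z := by
    intro z
    have h := ((hasDerivAt_Φ (z - c)).comp z ((hasDerivAt_id z).sub_const c)).const_mul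
      (exp (c ^ 2 / 2))
    refine h.congr_deriv ?_
    unfold φ
    rw [mul_one, ← mul_div_assoc, ← mul_div_assoc, ← exp_add, ← exp_add]
    congr 2; ring
  rw [← integral_indicator measurableSet_Ioo,
    integral_gaussianReal_eq_integral_smul one_ne_zero]
  have : (fun x => gaussianPDFReal 0 1 x • (Set.Ioo a b).indicator (fun z => exp (c * z)) x)
      = (Set.Ioo a b).indicator (fun z => exp (c * z) * φ z) := by
    funext x
    by_cases hx : x ∈ Set.Ioo a b
    · simp [hx, φ_eq_gaussianPDFReal, mul_comm]
    · simp [hx]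
  rw [this, integral_indicator measurableSet_Ioo, ← integral_Ioc_eq_integral_Ioo,
    ← intervalIntegral.integral_of_le hab,
    intervalIntegral.integral_eq_sub_of_hasDerivAt (fun z _ => hd z)]
  · ring
  · exact (Continuous.mul (by fun_prop) continuous_φ).intervalIntegrable _ _

end BarrierModel

namespace BarrierModel

/-! ### Brownian motion with drift: the probability of staying positive -/

/-- A function that is mapped to zero at the origin by the semigroup of Brownian motion with
drift `ν`, and that is `1` on `(0, A)`. -/
def mirrorPayoff (ν A y : ℝ) : ℝ :=
  (Set.Ioo 0 A).indicator (fun _ => 1) y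
    - (Set.Ioo (-A) 0).indicator (fun y => exp (-2 * ν * y)) y

/-- The image of `mirrorPayoff` under the semigroup of Brownian motion with drift `ν`. -/
def mirrorValue (ν A s y : ℝ) : ℝ :=
  Φ ((y + ν * s) / √s) - Φ ((y + ν * s - A) / √s)
    - exp (-2 * ν * y) * (Φ ((-y + ν * s) / √s) - Φ ((-y + ν * s - A) / √s))

/-- The probabilistic content is that the density `p` of `N(νs, s)` satisfies `exp (-2νx) p(x) =
p(-x)`, so the two halves of the payoff have equal means when the motion starts at the origin. -/
lemma mirrorValue_zero (ν A s : ℝ) : mirrorValue ν A s 0 = 0 := by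
  simp [mirrorValue]

lemma continuousOn_mirrorValue (ν A : ℝ) :
    ContinuousOn (fun x : ℝ × ℝ => mirrorValue ν A x.1 x.2) {x | 0 < x.1} := by
  have h1 : ContinuousOn (fun x : ℝ × ℝ => (√x.1)⁻¹) {x | 0 < x.1} :=
    ContinuousOn.inv₀ (by fun_prop) fun x hx => (sqrt_pos.2 hx).ne'
  unfold mirrorValue
  simp only [div_eq_mul_inv]
  refine ContinuousOn.sub (ContinuousOn.sub ?_ ?_) (ContinuousOn.mul (by fun_prop)
    (ContinuousOn.sub ?_ ?_)) <;>
  exact continuous_Φ.comp_continuousOn (ContinuousOn.mul (by fun_prop) h1)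

lemma measurable_mirrorPayoff (ν A : ℝ) : Measurable (mirrorPayoff ν A) := by
  unfold mirrorPayoff
  exact (measurable_const.indicator measurableSet_Ioo).sub
    (Measurable.indicator (by fun_prop) measurableSet_Ioo)

lemma abs_mirrorPayoff_le (ν A y : ℝ) : |mirrorPayoff ν A y| ≤ 1 + exp (2 * |ν| * A) := by
  have h1 : |(Set.Ioo 0 A).indicator (fun _ => (1 : ℝ)) y| ≤ 1 := by
    by_cases h : y ∈ Set.Ioo 0 A <;> simp [h]
  have h2 : |(Set.Ioo (-A) 0).indicator (fun y => exp (-2 * ν * y)) y| ≤ exp (2 * |ν| * A) := by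
    by_cases h : y ∈ Set.Ioo (-A) 0
    · rw [Set.indicator_of_mem h, abs_exp, exp_le_exp]
      have hy : |y| ≤ A := abs_le.2 ⟨h.1.le, by linarith [h.1, h.2]⟩
      have : -(ν * y) ≤ |ν| * A :=
        (neg_le_abs _).trans (by rw [abs_mul]; exact mul_le_mul_of_nonneg_left hy (abs_nonneg _))
      linarith
    · simp [h]; positivity
  exact (abs_sub _ _).trans (add_le_add h1 h2)

/-- Weighting by `exp (-2νx)` tilts the normal law from mean `y + νs` to mean `y - νs`; completing
the square leaves the prefactor `exp (-2νy)`. Reflection of `Φ` then puts the result in the form of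
`mirrorValue`. -/
lemma integral_mirrorPayoff {ν A : ℝ} (hA : 0 ≤ A) {s : ℝ≥0} (hs : s ≠ 0) (y : ℝ) :
    ∫ z, mirrorPayoff ν A (y + ν * s + z) ∂(gaussianReal 0 s) = mirrorValue ν A s y := by
  have hs' : (0 : ℝ) < s := by positivity
  have hq : 0 < √(s : ℝ) := sqrt_pos.2 hs'
  have hqq : √(s : ℝ) * √(s : ℝ) = s := mul_self_sqrt hs'.le
  have hmap : gaussianReal 0 s = (gaussianReal 0 1).map (√(s : ℝ) * ·) := by
    rw [gaussianReal_map_const_mul]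
    congr 1
    · simp
    · ext; simp [sq_sqrt hs'.le]
  have hmeas : Measurable fun z => mirrorPayoff ν A (y + ν * s + z) :=
    (measurable_mirrorPayoff ν A).comp (by fun_prop)
  rw [hmap, integral_map (by fun_prop) hmeas.aestronglyMeasurable]
  set q := √(s : ℝ) with hqdef
  have e1 : ∀ z, (Set.Ioo 0 A).indicator (fun _ => (1 : ℝ)) (y + ν * s + q * z)
      = (Set.Ioo (-(y + ν * s) / q) ((A - (y + ν * s)) / q)).indicator (fun z => exp (0 * z)) z := by
    intro z
    have : y + ν * s + q * z ∈ Set.Ioo 0 A ↔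
        z ∈ Set.Ioo (-(y + ν * s) / q) ((A - (y + ν * s)) / q) := by
      simp only [Set.mem_Ioo, div_lt_iff₀ hq, lt_div_iff₀ hq]
      constructor <;> rintro ⟨h1, h2⟩ <;> constructor <;> linarith
    by_cases h : y + ν * s + q * z ∈ Set.Ioo 0 A
    · rw [Set.indicator_of_mem h, Set.indicator_of_mem (this.1 h)]; simp
    · rw [Set.indicator_of_notMem h, Set.indicator_of_notMem (fun h' => h (this.2 h'))]
  have e2 : ∀ z, (Set.Ioo (-A) 0).indicator (fun y => exp (-2 * ν * y)) (y + ν * s + q * z)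
      = exp (-2 * ν * (y + ν * s)) * (Set.Ioo ((-A - (y + ν * s)) / q)
        (-(y + ν * s) / q)).indicator (fun z => exp ((-2 * ν * q) * z)) z := by
    intro z
    have : y + ν * s + q * z ∈ Set.Ioo (-A) 0 ↔
        z ∈ Set.Ioo ((-A - (y + ν * s)) / q) (-(y + ν * s) / q) := by
      simp only [Set.mem_Ioo, div_lt_iff₀ hq, lt_div_iff₀ hq]
      constructor <;> rintro ⟨h1, h2⟩ <;> constructor <;> linarith
    by_cases h : y + ν * s + q * z ∈ Set.Ioo (-A) 0
    · rw [Set.indicator_of_mem h, Set.indicator_of_mem (this.1 h), ← exp_add]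
      congr 1; ring
    · rw [Set.indicator_of_notMem h, Set.indicator_of_notMem (fun h' => h (this.2 h')), mul_zero]
  simp only [mirrorPayoff, e1, e2]
  rw [integral_sub, integral_const_mul, integral_indicator measurableSet_Ioo,
    integral_indicator measurableSet_Ioo, setIntegral_exp_mul_gaussianReal _ (by gcongr; linarith),
    setIntegral_exp_mul_gaussianReal _ (by gcongr; linarith)]
  · have f1 : (A - (y + ν * s)) / q - 0 = -((y + ν * s - A) / q) := by ring
    have f2 : -(y + ν * s) / q - 0 = -((y + ν * s) / q) := by ring
    have f3 : -(y + ν * s) / q - -2 * ν * q = (-y + ν * s) / q := by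
      field_simp; rw [← hqq]; ring
    have f4 : (-A - (y + ν * s)) / q - -2 * ν * q = (-y + ν * s - A) / q := by
      field_simp; rw [← hqq]; ring
    rw [f1, f2, f3, f4, Φ_neg, Φ_neg, ← mul_assoc, ← exp_add]
    have f5 : -2 * ν * (y + ν * s) + (-2 * ν * q) ^ 2 / 2 = -2 * ν * y := by
      rw [← hqq]; ring
    rw [f5]
    simp [mirrorValue, ← hqdef]
  · exact Integrable.indicator (integrable_exp_mul_gaussianReal 0) measurableSet_Ioo
  · exact Integrable.const_mul (Integrable.indicator (integrable_exp_mul_gaussianReal _)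
      measurableSet_Ioo) _

variable {Ω : Type*} [MeasurableSpace Ω] {P : Measure Ω} {B : ℝ≥0 → Ω → ℝ}

/-- Weak Markov property: the increment over `[t₀, t₀ + s]` may be integrated out. -/
lemma integral_past_increment [IsProbabilityMeasure P] (hB : IsPreBrownianReal B P) (t₀ s : ℝ≥0)
    {ι : Type*} [Fintype ι] (t : ι → ℝ≥0) (ht : ∀ i, t i ≤ t₀) {G : (ι → ℝ) × ℝ → ℝ}
    (hG : Measurable G) {C : ℝ} (hC : ∀ x, |G x| ≤ C) :
    ∫ ω, G (fun i => B (t i) ω, B (t₀ + s) ω - B t₀ ω) ∂P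
      = ∫ ω, ∫ z, G (fun i => B (t i) ω, z) ∂(gaussianReal 0 s) ∂P := by
  have hV : AEMeasurable (fun ω i => B (t i) ω) P :=
    aemeasurable_pi_lambda _ fun i => hB.aemeasurable _
  have hW : HasLaw (fun ω => B (t₀ + s) ω - B t₀ ω) (gaussianReal 0 s) P :=
    (hB.shift t₀).hasLaw_eval s
  have hind : IndepFun (fun ω i => B (t i) ω) (fun ω => B (t₀ + s) ω - B t₀ ω) P := by
    have h := (hB.indepFun_shift t₀).symm
    have m1 : Measurable fun (x : Set.Iic t₀ → ℝ) (i : ι) => x ⟨t i, ht i⟩ := by fun_prop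
    have m2 : Measurable fun x : ℝ≥0 → ℝ => x s := by fun_prop
    exact h.comp m1 m2
  have hprod := (indepFun_iff_map_prod_eq_prod_map_map hV hW.aemeasurable).1 hind
  have hint : Integrable G ((P.map fun ω i => B (t i) ω).prod (gaussianReal 0 s)) := by
    have := Measure.isProbabilityMeasure_map hV
    exact Integrable.of_bound hG.aestronglyMeasurable C (ae_of_all _ hC)
  have := Measure.isProbabilityMeasure_map hV
  rw [← integral_map (φ := fun ω => ((fun i => B (t i) ω), B (t₀ + s) ω - B t₀ ω))
    (hV.prodMk hW.aemeasurable) hG.aestronglyMeasurable, hprod, hW.map_eq, integral_prod _ hint,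
    integral_map hV]
  exact (hG.stronglyMeasurable.integral_prod_right' (ν := gaussianReal 0 s)).aestronglyMeasurable

end BarrierModel

/-! ### First passage along a grid, for a single path -/

namespace BarrierModel

/-- Decomposition of a sum along the first time at which a sequence is nonpositive. -/
lemma sum_firstPassage (y F : ℕ → ℝ) (N : ℕ) :
    ((∀ i ≤ N, 0 < y i) ∧
      ∑ k ∈ Finset.range (N + 1), (if y k ≤ 0 ∧ ∀ i < k, 0 < y i then F k else 0) = 0) ∨
    ∃ κ ≤ N, y κ ≤ 0 ∧ (∀ i < κ, 0 < y i) ∧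
      ∑ k ∈ Finset.range (N + 1), (if y k ≤ 0 ∧ ∀ i < k, 0 < y i then F k else 0) = F κ := by
  classical
  by_cases h : ∃ k, k ≤ N ∧ y k ≤ 0
  · right
    obtain ⟨hκN, hκ⟩ := Nat.find_spec h
    have hlt : ∀ i < Nat.find h, 0 < y i := by
      intro i hi
      have := Nat.find_min h hi
      push Not at this
      exact this (hi.le.trans hκN)
    refine ⟨Nat.find h, hκN, hκ, hlt, ?_⟩
    rw [Finset.sum_eq_single (Nat.find h)]
    · rw [if_pos ⟨hκ, hlt⟩]
    · intro k _ hk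
      rw [if_neg]
      rintro ⟨h1, h2⟩
      rcases lt_or_gt_of_ne hk with h3 | h3
      · exact absurd h1 (not_le.2 (hlt k h3))
      · exact absurd hκ (not_le.2 (h2 _ h3))
    · intro h'
      exact absurd (Finset.mem_range.2 (Nat.lt_succ_of_le hκN)) h'
  · left
    push Not at h
    refine ⟨h, Finset.sum_eq_zero fun k hk => if_neg fun h' => ?_⟩
    exact absurd h'.1 (not_le.2 (h k (Nat.lt_succ_iff.1 (Finset.mem_range.1 hk))))

/-- The value at the first grid time at which a continuous path is nonpositive, for a value
function that vanishes at the origin, tends to zero with the mesh. -/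
lemma tendsto_firstPassage {Y : ℝ≥0 → ℝ} (hY : Continuous Y) (h0 : 0 < Y 0) {T : ℝ≥0}
    (hT : 0 < T) (hYT : Y T ≠ 0) {v : ℝ → ℝ → ℝ} (hv0 : ∀ s, v s 0 = 0)
    (hv : ContinuousOn (fun x : ℝ × ℝ => v x.1 x.2) {x | 0 < x.1}) {u : ℝ≥0 → ℝ → ℝ}
    (huv : ∀ s : ℝ≥0, s ≠ 0 → ∀ y, u s y = v s y) :
    Tendsto (fun N : ℕ => ∑ k ∈ Finset.range (N + 1),
      (if Y (k * (T / N)) ≤ 0 ∧ ∀ i < k, 0 < Y ((i : ℕ) * (T / N)) then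
        u ((N - k : ℕ) * (T / N)) (Y (k * (T / N))) else 0)) atTop (𝓝 0) := by
  rw [Metric.tendsto_atTop]
  intro ε hε
  -- `v` is controlled only for strictly positive remaining time. Since `Y T ≠ 0`, the path keeps
  -- away from zero during the last `η` units of time, so a crossing with small overshoot cannot
  -- occur there.
  obtain ⟨η, hη, hηY⟩ := Metric.continuousAt_iff.1 hY.continuousAt (|Y T| / 2)
    (half_pos (abs_pos.2 hYT))
  have hK : IsCompact (Set.Icc η T ×ˢ Set.Icc (-1 : ℝ) 1) := isCompact_Icc.prod isCompact_Icc
  have huc := hK.uniformContinuousOn_of_continuous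
    (hv.mono fun x hx => lt_of_lt_of_le hη hx.1.1)
  obtain ⟨ρ, hρ, hρv⟩ := Metric.uniformContinuousOn_iff.1 huc ε hε
  -- The three bounds on the oscillation serve in turn: closeness of `v` to its value at the origin,
  -- membership in the compact set, and exclusion of times near `T`.
  obtain ⟨τ, hτ, hτY⟩ := Metric.uniformContinuousOn_iff.1
    ((isCompact_Icc (a := (0 : ℝ≥0)) (b := T)).uniformContinuousOn_of_continuous hY.continuousOn)
    (min ρ (min 1 (|Y T| / 2))) (by have := abs_pos.2 hYT; positivity)
  obtain ⟨N₀, hN₀⟩ := exists_nat_gt ((T : ℝ) / τ)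
  refine ⟨N₀ + 1, fun N hN => ?_⟩
  have hNpos : (0 : ℝ) < N := by exact_mod_cast (by omega : 0 < N)
  have hN0 : (N : ℝ≥0) ≠ 0 := by exact_mod_cast (by omega : N ≠ 0)
  have hmesh : (T : ℝ) / N < τ := by
    rw [div_lt_iff₀ hNpos]
    rw [div_lt_iff₀ hτ] at hN₀
    have : (N₀ : ℝ) ≤ N := by exact_mod_cast (by omega : N₀ ≤ N)
    nlinarith
  rcases sum_firstPassage (fun k => Y (k * (T / N)))
    (fun k => u ((N - k : ℕ) * (T / N)) (Y (k * (T / N)))) N with ⟨_, h⟩ | ⟨κ, hκN, hκ, hlt, h⟩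
  · rw [h, dist_self]; exact hε
  rw [h]
  have hgrid : ∀ k : ℕ, k ≤ N → (k : ℝ≥0) * (T / N) ∈ Set.Icc 0 T := by
    intro k hk
    refine ⟨zero_le, ?_⟩
    calc (k : ℝ≥0) * (T / N) ≤ N * (T / N) := by gcongr
      _ = T := by field_simp
  -- The path starts positive, so a preceding grid time exists; the path is positive there, which
  -- bounds the overshoot by the oscillation over one mesh.
  have hκ0 : κ ≠ 0 := by
    rintro rfl
    simp only [Nat.cast_zero, zero_mul] at hκ
    linarith
  obtain ⟨j, rfl⟩ := Nat.exists_eq_succ_of_ne_zero hκ0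
  have hj := hlt j (Nat.lt_succ_self j)
  have hdist := hτY _ (hgrid (j + 1) hκN) _ (hgrid j (by omega)) (by
    rw [NNReal.dist_eq]
    push_cast
    rw [show ((j : ℝ) + 1) * (T / N) - j * (T / N) = T / N by ring, abs_of_nonneg (by positivity)]
    exact hmesh)
  simp only [Nat.succ_eq_add_one] at *
  set y := Y (((j + 1 : ℕ) : ℝ≥0) * (T / N)) with hy
  rw [Real.dist_eq, abs_of_nonpos (by linarith)] at hdist
  have hylt : -y < min ρ (min 1 (|Y T| / 2)) := by linarith
  simp only [lt_min_iff] at hylt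
  -- Otherwise the crossing value would lie within `|Y T| / 2` of both `0` and `Y T`.
  have hs : η ≤ (((N - (j + 1) : ℕ) : ℝ≥0) * (T / N) : ℝ≥0) := by
    by_contra! hcon
    have := hηY (x := ((j + 1 : ℕ) : ℝ≥0) * (T / N)) (by
      rw [NNReal.dist_eq]
      rw [NNReal.coe_mul, NNReal.coe_natCast, Nat.cast_sub hκN, NNReal.coe_div,
        NNReal.coe_natCast] at hcon
      push_cast at hcon ⊢
      have e : ((j : ℝ) + 1) * (T / N) - T = -((N - (j + 1)) * (T / N)) := by
        field_simp; ring
      rw [e, abs_neg, abs_of_nonneg]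
      · exact hcon
      · have : ((j + 1 : ℕ) : ℝ) ≤ N := by exact_mod_cast hκN
        push_cast at this
        exact mul_nonneg (by linarith) (by positivity))
    rw [← hy, Real.dist_eq] at this
    have h1 : |Y T| ≤ |y| + |y - Y T| := by
      have := abs_sub_abs_le_abs_sub (Y T) y
      rw [abs_sub_comm] at this; linarith
    rw [abs_of_nonpos hκ] at h1
    linarith [hylt.2.2]
  have hs0 : ((N - (j + 1) : ℕ) : ℝ≥0) * (T / N) ≠ 0 := by
    intro h'
    rw [h'] at hs
    simp at hs; linarith
  have hsT : ((((N - (j + 1) : ℕ) : ℝ≥0) * (T / N) : ℝ≥0) : ℝ) ≤ T := by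
    exact_mod_cast (hgrid (N - (j + 1)) (Nat.sub_le _ _)).2
  rw [huv _ hs0]
  have := hρv (((((N - (j + 1) : ℕ) : ℝ≥0) * (T / N) : ℝ≥0) : ℝ), y)
    ⟨⟨hs, hsT⟩, by constructor <;> linarith [hylt.2.1]⟩
    (((((N - (j + 1) : ℕ) : ℝ≥0) * (T / N) : ℝ≥0) : ℝ), 0) ⟨⟨hs, hsT⟩, by norm_num⟩ (by
      rw [Prod.dist_eq, dist_self, Real.dist_eq, sub_zero, abs_of_nonpos hκ]
      exact max_lt hρ hylt.1)
  simpa only [hv0] using this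

end BarrierModel

/-! ### Survival of drifted Brownian motion on a grid -/

namespace BarrierModel

variable {Ω : Type*} [MeasurableSpace Ω] {P : Measure Ω} {B : ℝ≥0 → Ω → ℝ}

/-- Brownian motion with drift `ν`, started at `b`. -/
def driftPath (B : ℝ≥0 → Ω → ℝ) (ν b : ℝ) (t : ℝ≥0) (ω : Ω) : ℝ := b + ν * t + B t ω

lemma aemeasurable_driftPath (hB : IsPreBrownianReal B P) (ν b : ℝ) (t : ℝ≥0) :
    AEMeasurable (driftPath B ν b t) P :=
  (hB.aemeasurable t).const_add _

lemma nullMeasurableSet_driftPath_pos (hB : IsPreBrownianReal B P) (ν b : ℝ) (t : ℝ≥0) :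
    NullMeasurableSet {ω | 0 < driftPath B ν b t ω} P :=
  nullMeasurableSet_lt aemeasurable_const (aemeasurable_driftPath hB ν b t)

lemma nullMeasurableSet_survival_grid (hB : IsPreBrownianReal B P) (ν b : ℝ) (τ : ℝ≥0) (N : ℕ) :
    NullMeasurableSet {ω | ∀ i ≤ N, 0 < driftPath B ν b ((i : ℕ) * τ) ω} P := by
  simp only [Set.ofPred_forall]
  exact NullMeasurableSet.iInter fun i => NullMeasurableSet.iInter fun _ =>
    nullMeasurableSet_driftPath_pos hB ν b _

lemma integral_ite_one {p : Ω → Prop} [DecidablePred p] (hp : NullMeasurableSet {ω | p ω} P) :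
    ∫ ω, (if p ω then (1 : ℝ) else 0) ∂P = P.real {ω | p ω} := by
  have : (fun ω => if p ω then (1 : ℝ) else 0) = {ω | p ω}.indicator fun _ => 1 := by
    funext ω
    simp only [Set.indicator_apply, Set.mem_ofPred_eq]
  rw [this, integral_indicator₀ hp]
  simp

/-- On a finite grid, the part of an expectation carried by the paths that stay positive. -/
lemma integral_survival_grid [IsProbabilityMeasure P] (hB : IsPreBrownianReal B P) (ν b : ℝ)
    {h : ℝ → ℝ} (hh : Measurable h) {C : ℝ} (hC : ∀ y, |h y| ≤ C) (τ : ℝ≥0) (N : ℕ) :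
    ∫ ω, (if ∀ i ≤ N, 0 < driftPath B ν b ((i : ℕ) * τ) ω then
        h (driftPath B ν b (N * τ) ω) else 0) ∂P
      = ∫ ω, h (driftPath B ν b (N * τ) ω) ∂P
        - ∫ ω, ∑ k ∈ Finset.range (N + 1),
          (if driftPath B ν b (k * τ) ω ≤ 0 ∧ ∀ i < k, 0 < driftPath B ν b ((i : ℕ) * τ) ω then
            ∫ z, h (driftPath B ν b (k * τ) ω + ν * ((N - k : ℕ) * τ : ℝ≥0) + z)
              ∂(gaussianReal 0 ((N - k : ℕ) * τ)) else 0) ∂P := by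
  classical
  have hC0 : 0 ≤ C := (abs_nonneg _).trans (hC 0)
  have key : ∀ k ≤ N,
      Integrable (fun ω => if driftPath B ν b (k * τ) ω ≤ 0 ∧
        ∀ i < k, 0 < driftPath B ν b ((i : ℕ) * τ) ω then h (driftPath B ν b (N * τ) ω) else 0) P ∧
      Integrable (fun ω => if driftPath B ν b (k * τ) ω ≤ 0 ∧
        ∀ i < k, 0 < driftPath B ν b ((i : ℕ) * τ) ω then
          ∫ z, h (driftPath B ν b (k * τ) ω + ν * ((N - k : ℕ) * τ : ℝ≥0) + z)
              ∂(gaussianReal 0 ((N - k : ℕ) * τ)) else 0) P ∧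
      ∫ ω, (if driftPath B ν b (k * τ) ω ≤ 0 ∧
        ∀ i < k, 0 < driftPath B ν b ((i : ℕ) * τ) ω then h (driftPath B ν b (N * τ) ω) else 0) ∂P
      = ∫ ω, (if driftPath B ν b (k * τ) ω ≤ 0 ∧
        ∀ i < k, 0 < driftPath B ν b ((i : ℕ) * τ) ω then
          ∫ z, h (driftPath B ν b (k * τ) ω + ν * ((N - k : ℕ) * τ : ℝ≥0) + z)
              ∂(gaussianReal 0 ((N - k : ℕ) * τ)) else 0) ∂P := by
    intro k hk
    obtain ⟨j, rfl⟩ := Nat.exists_eq_add_of_le hk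
    simp only [Nat.add_sub_cancel_left]
    let S : Set (Fin (k + 1) → ℝ) := {x | b + ν * (k * τ : ℝ≥0) + x (Fin.last k) ≤ 0 ∧
      ∀ i : Fin (k + 1), (i : ℕ) < k → 0 < b + ν * ((i : ℕ) * τ : ℝ≥0) + x i}
    have hS : MeasurableSet S := by
      simp only [S, Set.ofPred_and, Set.ofPred_forall]
      refine MeasurableSet.inter (measurableSet_le (by fun_prop) (by fun_prop)) ?_
      exact MeasurableSet.iInter fun i => MeasurableSet.iInter fun _ =>
        measurableSet_lt (by fun_prop) (by fun_prop)
    let G : (Fin (k + 1) → ℝ) × ℝ → ℝ := fun x =>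
      if x.1 ∈ S then h (b + ν * ((k + j : ℕ) * τ : ℝ≥0) + x.1 (Fin.last k) + x.2) else 0
    have hG : Measurable G :=
      Measurable.ite (measurable_fst hS) (hh.comp (by fun_prop)) measurable_const
    have hGC : ∀ x, |G x| ≤ C := by
      intro x
      by_cases hx : x.1 ∈ S
      · simp only [G, if_pos hx]; exact hC _
      · simp only [G, if_neg hx, abs_zero]; exact hC0
    have hmem : ∀ ω, (fun i : Fin (k + 1) => B ((i : ℕ) * τ) ω) ∈ S ↔
        driftPath B ν b (k * τ) ω ≤ 0 ∧ ∀ i < k, 0 < driftPath B ν b ((i : ℕ) * τ) ω := by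
      intro ω
      simp only [S, Set.mem_ofPred_eq, driftPath, Fin.val_last]
      refine and_congr Iff.rfl ⟨fun H i hi => H ⟨i, by omega⟩ hi, fun H i hi => H i hi⟩
    -- The terminal value is the value at time `kτ` plus the drift over the remaining `j` steps plus
    -- an increment independent of the past; the event of first passage at `k` depends on the past
    -- only.
    have e1 : ∀ ω, (if driftPath B ν b (k * τ) ω ≤ 0 ∧
        ∀ i < k, 0 < driftPath B ν b ((i : ℕ) * τ) ω then
          h (driftPath B ν b ((k + j : ℕ) * τ) ω) else 0)
        = G (fun i : Fin (k + 1) => B ((i : ℕ) * τ) ω,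
          B (k * τ + j * τ) ω - B (k * τ) ω) := by
      intro ω
      simp only [G, hmem]
      congr 2
      simp only [driftPath, Fin.val_last, Nat.cast_add, add_mul]
      ring
    have e2 : ∀ ω, (if driftPath B ν b (k * τ) ω ≤ 0 ∧
        ∀ i < k, 0 < driftPath B ν b ((i : ℕ) * τ) ω then
          ∫ z, h (driftPath B ν b (k * τ) ω + ν * (j * τ : ℝ≥0) + z)
            ∂(gaussianReal 0 (j * τ)) else 0)
        = ∫ z, G (fun i : Fin (k + 1) => B ((i : ℕ) * τ) ω, z) ∂(gaussianReal 0 (j * τ)) := by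
      intro ω
      by_cases hω : (fun i : Fin (k + 1) => B ((i : ℕ) * τ) ω) ∈ S
      · rw [if_pos ((hmem ω).1 hω)]
        simp only [G, if_pos hω]
        congr 1
        funext z
        congr 1
        simp only [driftPath, Fin.val_last]
        push_cast
        ring
      · rw [if_neg (fun h' => hω ((hmem ω).2 h'))]
        simp only [G, if_neg hω, integral_zero]
    have hV : AEMeasurable (fun ω (i : Fin (k + 1)) => B ((i : ℕ) * τ) ω) P :=
      aemeasurable_pi_lambda _ fun i => hB.aemeasurable _
    simp only [e1, e2]
    refine ⟨?_, ?_, ?_⟩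
    · refine Integrable.of_bound (C := C) ?_ (ae_of_all _ fun ω => hGC _)
      exact (hG.comp_aemeasurable (hV.prodMk
        ((hB.aemeasurable _).sub (hB.aemeasurable _)))).aestronglyMeasurable
    · refine Integrable.of_bound (C := C) ?_ (ae_of_all _ fun ω => ?_)
      · exact ((hG.stronglyMeasurable.integral_prod_right'
          (ν := gaussianReal 0 (j * τ))).measurable.comp_aemeasurable hV).aestronglyMeasurable
      · refine (norm_integral_le_of_norm_le_const (ae_of_all _ fun z => hGC _)).trans ?_
        simp
    · exact integral_past_increment hB (k * τ) (j * τ) (fun i : Fin (k + 1) => (i : ℕ) * τ)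
        (fun i => by gcongr; exact Nat.lt_succ_iff.1 i.2) hG hGC
  have hint : Integrable (fun ω => h (driftPath B ν b (N * τ) ω)) P :=
    Integrable.of_bound (hh.comp_aemeasurable
      (aemeasurable_driftPath hB ν b _)).aestronglyMeasurable C (ae_of_all _ fun ω => hC _)
  have hle : ∀ k ∈ Finset.range (N + 1), k ≤ N := fun k hk =>
    Nat.lt_succ_iff.1 (Finset.mem_range.1 hk)
  -- A path either survives or has exactly one first passage index, so the first-passage terms sum
  -- to the non-surviving part.
  have hpt : ∀ ω, (if ∀ i ≤ N, 0 < driftPath B ν b ((i : ℕ) * τ) ω then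
        h (driftPath B ν b (N * τ) ω) else 0)
      = h (driftPath B ν b (N * τ) ω) - ∑ k ∈ Finset.range (N + 1),
        (if driftPath B ν b (k * τ) ω ≤ 0 ∧ ∀ i < k, 0 < driftPath B ν b ((i : ℕ) * τ) ω then
          h (driftPath B ν b (N * τ) ω) else 0) := by
    intro ω
    rcases sum_firstPassage (fun k => driftPath B ν b (k * τ) ω)
      (fun _ => h (driftPath B ν b (N * τ) ω)) N with ⟨h1, h2⟩ | ⟨κ, hκN, hκ, _, h2⟩
    · rw [if_pos h1, h2, sub_zero]
    · rw [h2, sub_self, if_neg]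
      exact fun H => absurd hκ (not_le.2 (H κ hκN))
  simp only [hpt]
  rw [integral_sub hint (integrable_finsetSum _ fun k hk => (key k (hle k hk)).1),
    integral_finsetSum _ fun k hk => (key k (hle k hk)).1,
    integral_finsetSum _ fun k hk => (key k (hle k hk)).2.1,
    Finset.sum_congr rfl fun k hk => (key k (hle k hk)).2.2]

/-- The probability that Brownian motion with drift stays positive on a grid, the last value being
below `A`, converges as the mesh tends to zero. -/
lemma tendsto_measure_survival_grid [IsProbabilityMeasure P] (hB : IsBrownianReal B P) (ν : ℝ)
    {b A : ℝ} (hb : 0 < b) (hA : 0 ≤ A) {T : ℝ≥0} (hT : 0 < T) :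
    Tendsto (fun N : ℕ => P.real {ω | (∀ i ≤ N, 0 < driftPath B ν b ((i : ℕ) * (T / N)) ω) ∧
      driftPath B ν b T ω < A}) atTop (𝓝 (mirrorValue ν A T b)) := by
  have hpre := hB.toIsPreBrownianReal
  have hh := measurable_mirrorPayoff ν A
  have hC := abs_mirrorPayoff_le ν A
  set C := 1 + exp (2 * |ν| * A)
  have hC0 : 0 ≤ C := (abs_nonneg _).trans (hC 0)
  set u : ℝ≥0 → ℝ → ℝ := fun s y => ∫ z, mirrorPayoff ν A (y + ν * s + z) ∂(gaussianReal 0 s)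
    with hu
  -- The terminal law has no atom at zero, as the pathwise limit requires.
  have hT0 : ∀ᵐ ω ∂P, driftPath B ν b T ω ≠ 0 := by
    have hlaw : HasLaw (driftPath B ν b T) (gaussianReal (0 + (b + ν * T)) T) P :=
      gaussianReal_const_add (hpre.hasLaw_eval T) _
    have := nullSingletonClass_gaussianReal (μ := 0 + (b + ν * T)) hT.ne'
    have h0 : gaussianReal (0 + (b + ν * T)) T {0} = 0 := measure_singleton 0
    rw [← hlaw.map_eq, Measure.map_apply_of_aemeasurable hlaw.aemeasurable
      (measurableSet_singleton _)] at h0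
    exact compl_mem_ae_iff.2 h0
  have hhb : Measurable fun z => mirrorPayoff ν A (b + ν * T + z) := hh.comp (by fun_prop)
  have hEh : ∫ ω, mirrorPayoff ν A (driftPath B ν b T ω) ∂P = mirrorValue ν A T b := by
    rw [← integral_mirrorPayoff hA hT.ne', ← (hpre.hasLaw_eval T).map_eq, integral_map
      (hpre.aemeasurable T) hhb.aestronglyMeasurable]
    rfl
  -- The crossing contribution vanishes by dominated convergence: at most one summand is nonzero,
  -- and it is bounded by the supremum `C` of the payoff. This boundedness is what the cutoff `A`
  -- provides.
  have hlim : Tendsto (fun N : ℕ => ∫ ω, ∑ k ∈ Finset.range (N + 1),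
      (if driftPath B ν b (k * (T / N)) ω ≤ 0 ∧
          ∀ i < k, 0 < driftPath B ν b ((i : ℕ) * (T / N)) ω then
        u ((N - k : ℕ) * (T / N)) (driftPath B ν b (k * (T / N)) ω) else 0) ∂P)
      atTop (𝓝 (∫ _, (0 : ℝ) ∂P)) := by
    refine tendsto_integral_of_dominated_convergence (fun _ => C) ?_ (integrable_const _) ?_ ?_
    · intro N
      refine Finset.aestronglyMeasurable_fun_sum _ fun k _ => ?_
      have hum : Measurable (u ((N - k : ℕ) * (T / N))) := by
        have : Measurable fun x : ℝ × ℝ =>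
            mirrorPayoff ν A (x.1 + ν * ((N - k : ℕ) * (T / N) : ℝ≥0) + x.2) :=
          hh.comp (by fun_prop)
        exact this.stronglyMeasurable.integral_prod_right'.measurable
      have hset : NullMeasurableSet {ω | driftPath B ν b (k * (T / N)) ω ≤ 0 ∧
          ∀ i < k, 0 < driftPath B ν b ((i : ℕ) * (T / N)) ω} P := by
        simp only [Set.ofPred_and, Set.ofPred_forall]
        exact NullMeasurableSet.inter
          (nullMeasurableSet_le (aemeasurable_driftPath hpre ν b _) aemeasurable_const)
          (NullMeasurableSet.iInter fun i => NullMeasurableSet.iInter fun _ =>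
            nullMeasurableSet_driftPath_pos hpre ν b _)
      have := (hum.comp_aemeasurable
        (aemeasurable_driftPath hpre ν b (k * (T / N)))).indicator₀ hset
      refine this.aestronglyMeasurable.congr (ae_of_all _ fun ω => ?_)
      simp only [Set.indicator_apply, Set.mem_ofPred_eq, Function.comp_apply]
    · intro N
      refine ae_of_all _ fun ω => ?_
      rcases sum_firstPassage (fun k => driftPath B ν b (k * (T / N)) ω)
        (fun k => u ((N - k : ℕ) * (T / N)) (driftPath B ν b (k * (T / N)) ω)) N with
        ⟨_, h2⟩ | ⟨κ, _, _, _, h2⟩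
      · rw [h2, norm_zero]; exact hC0
      · rw [h2]
        refine (norm_integral_le_of_norm_le_const (ae_of_all _ fun z => hC _)).trans ?_
        simp
    · filter_upwards [hB.cont, hpre.eval_zero_ae_eq_zero, hT0] with ω hc h0 hTω
      refine tendsto_firstPassage (Y := fun t => driftPath B ν b t ω) ?_ ?_ hT hTω
        (mirrorValue_zero ν A) (continuousOn_mirrorValue ν A)
        (fun s hs y => integral_mirrorPayoff hA hs y)
      · unfold driftPath; fun_prop
      · simp [driftPath, h0, hb]
  rw [integral_zero] at hlim
  have hlim' := (tendsto_const_nhds (x := mirrorValue ν A T b)).sub hlim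
  rw [sub_zero] at hlim'
  refine hlim'.congr' ?_
  filter_upwards [eventually_ge_atTop 1] with N hN
  have hN0 : (N : ℝ≥0) ≠ 0 := by exact_mod_cast (by omega : N ≠ 0)
  have hNT : (N : ℝ≥0) * (T / N) = T := by field_simp
  have hgrid := integral_survival_grid hpre ν b hh hC (T / N) N
  rw [hNT, hEh] at hgrid
  rw [← hgrid]
  have hset : NullMeasurableSet {ω | (∀ i ≤ N, 0 < driftPath B ν b ((i : ℕ) * (T / N)) ω) ∧
      driftPath B ν b T ω < A} P := by
    rw [Set.ofPred_and]
    exact (nullMeasurableSet_survival_grid hpre ν b _ N).inter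
      (nullMeasurableSet_lt (aemeasurable_driftPath hpre ν b _) aemeasurable_const)
  rw [← integral_ite_one hset]
  congr 1
  funext ω
  -- On survival the terminal value is positive, so the mirror half of the payoff is absent and only
  -- the indicator of `(0, A)` is left.
  by_cases hs : ∀ i ≤ N, 0 < driftPath B ν b ((i : ℕ) * (T / N)) ω
  · have hpos := hs N le_rfl
    rw [hNT] at hpos
    rw [if_pos hs]
    have h2 : driftPath B ν b T ω ∉ Set.Ioo (-A) 0 := fun h => absurd h.2 (not_lt.2 hpos.le)
    rw [mirrorPayoff, Set.indicator_of_notMem h2, sub_zero]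
    by_cases hA' : driftPath B ν b T ω < A
    · rw [Set.indicator_of_mem (show _ ∈ Set.Ioo 0 A from ⟨hpos, hA'⟩), if_pos ⟨hs, hA'⟩]
    · rw [Set.indicator_of_notMem (fun h => hA' h.2), if_neg (fun h => hA' h.2)]
  · rw [if_neg hs, if_neg (fun h => hs h.1)]

end BarrierModel

/-! ### From grids to continuous time: the survival probability -/

namespace BarrierModel

section StayPositive

variable {Ω : Type*} [MeasurableSpace Ω] {P : Measure Ω} {B : ℝ≥0 → Ω → ℝ}

/-- The probability that Brownian motion with drift `ν`, started at `b`, stays positive on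
`[0, T]`. -/
def stayProb (ν b T : ℝ) : ℝ :=
  Φ ((b + ν * T) / √T) - exp (-2 * ν * b) * Φ ((-b + ν * T) / √T)

lemma continuous_stayProb (ν T : ℝ) : Continuous fun b => stayProb ν b T := by
  unfold stayProb
  have := continuous_Φ
  fun_prop

lemma tendsto_mirrorValue (ν b : ℝ) {T : ℝ} (hT : 0 < T) :
    Tendsto (fun A : ℝ => mirrorValue ν A T b) atTop (𝓝 (stayProb ν b T)) := by
  have h : ∀ x : ℝ, Tendsto (fun A : ℝ => Φ ((x - A) / √T)) atTop (𝓝 0) := by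
    intro x
    refine tendsto_Φ_atBot.comp (Tendsto.atBot_div_const (sqrt_pos.2 hT) ?_)
    exact tendsto_atBot_add_const_left _ x tendsto_neg_atTop_atBot
  have := ((tendsto_const_nhds (x := Φ ((b + ν * T) / √T))).sub (h (b + ν * T))).sub
    (((tendsto_const_nhds (x := Φ ((-b + ν * T) / √T))).sub (h (-b + ν * T))).const_mul
      (exp (-2 * ν * b)))
  simpa only [sub_zero, mirrorValue, stayProb] using this

/-- The paths that are positive at the dyadic times of `[0, T]`. -/
def dyadicStay (B : ℝ≥0 → Ω → ℝ) (ν b : ℝ) (T : ℝ≥0) : Set Ω :=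
  {ω | ∀ m : ℕ, ∀ i ≤ 2 ^ m, 0 < driftPath B ν b ((i : ℕ) * (T / (2 ^ m : ℕ))) ω}

lemma nullMeasurableSet_dyadicStay (hB : IsPreBrownianReal B P) (ν b : ℝ) (T : ℝ≥0) :
    NullMeasurableSet (dyadicStay B ν b T) P := by
  simp only [dyadicStay]
  rw [Set.ofPred_forall]
  exact NullMeasurableSet.iInter fun m => nullMeasurableSet_survival_grid hB ν b _ _

/-- Dyadic grids are nested, so the grid probabilities decrease to that of the dyadic event with
terminal value below `A`; letting `A` run through the naturals then removes the cutoff. -/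
lemma measure_dyadicStay [IsProbabilityMeasure P] (hB : IsBrownianReal B P) (ν : ℝ) {b : ℝ}
    (hb : 0 < b) {T : ℝ≥0} (hT : 0 < T) : P.real (dyadicStay B ν b T) = stayProb ν b T := by
  have hpre := hB.toIsPreBrownianReal
  have hlt : ∀ A, NullMeasurableSet {ω | driftPath B ν b T ω < A} P := fun A =>
    nullMeasurableSet_lt (aemeasurable_driftPath hpre ν b _) aemeasurable_const
  have h1 : ∀ A : ℝ, 0 ≤ A →
      P.real (dyadicStay B ν b T ∩ {ω | driftPath B ν b T ω < A}) = mirrorValue ν A T b := by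
    intro A hA
    let s : ℕ → Set Ω := fun m =>
      {ω | (∀ i ≤ 2 ^ m, 0 < driftPath B ν b ((i : ℕ) * (T / (2 ^ m : ℕ))) ω) ∧
        driftPath B ν b T ω < A}
    have hs : ∀ m, NullMeasurableSet (s m) P := by
      intro m
      simp only [s, Set.ofPred_and]
      exact (nullMeasurableSet_survival_grid hpre ν b _ _).inter (hlt A)
    -- Point `i` of level `m` is point `2 * i` of level `m + 1`.
    have hanti : Antitone s := by
      refine antitone_nat_of_succ_le fun m ω hω => ⟨fun i hi => ?_, hω.2⟩
      have := hω.1 (2 * i) (by rw [pow_succ]; omega)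
      convert this using 2
      push_cast
      rw [pow_succ]
      field_simp
    have hint : (⋂ m, s m) = dyadicStay B ν b T ∩ {ω | driftPath B ν b T ω < A} := by
      ext ω
      simp only [Set.mem_iInter, s, dyadicStay, Set.mem_inter_iff, Set.mem_ofPred_eq]
      exact ⟨fun H => ⟨fun m => (H m).1, (H 0).2⟩, fun H m => ⟨H.1 m, H.2⟩⟩
    have hlim := tendsto_measure_iInter_atTop hs hanti ⟨0, measure_ne_top P _⟩
    rw [hint] at hlim
    have hlim' := (ENNReal.tendsto_toReal (measure_ne_top P _)).comp hlim
    have hg := (tendsto_measure_survival_grid hB ν hb hA hT).comp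
      (tendsto_pow_atTop_atTop_of_one_lt (by norm_num : 1 < 2))
    exact tendsto_nhds_unique hlim' hg
  have hmono : Monotone fun j : ℕ => dyadicStay B ν b T ∩ {ω | driftPath B ν b T ω < j} := by
    intro j k hjk ω hω
    have h2 : driftPath B ν b T ω < j := hω.2
    refine ⟨hω.1, show driftPath B ν b T ω < k from lt_of_lt_of_le h2 ?_⟩
    exact_mod_cast hjk
  have hlim := tendsto_measure_iUnion_atTop (μ := P) hmono
  have hun : (⋃ j : ℕ, dyadicStay B ν b T ∩ {ω | driftPath B ν b T ω < j})
      = dyadicStay B ν b T := by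
    ext ω
    simp only [Set.mem_iUnion, Set.mem_inter_iff, Set.mem_ofPred_eq]
    exact ⟨fun ⟨_, h, _⟩ => h, fun h => (exists_nat_gt (driftPath B ν b T ω)).imp fun j hj => ⟨h, hj⟩⟩
  rw [hun] at hlim
  have hlim' := (ENNReal.tendsto_toReal (measure_ne_top P _)).comp hlim
  refine tendsto_nhds_unique hlim' ?_
  refine ((tendsto_mirrorValue ν b (NNReal.coe_pos.2 hT)).comp
    tendsto_natCast_atTop_atTop).congr fun j => ?_
  exact (h1 j j.cast_nonneg).symm

/-- A continuous function that is positive at the dyadic times of `[0, T]` is nonnegative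
there. -/
lemma nonneg_of_dyadic {Y : ℝ≥0 → ℝ} (hY : Continuous Y) {T : ℝ≥0} (hT : 0 < T)
    (h : ∀ m : ℕ, ∀ i ≤ 2 ^ m, 0 < Y ((i : ℕ) * (T / (2 ^ m : ℕ)))) {t : ℝ≥0} (ht : t ≤ T) :
    0 ≤ Y t := by
  have hT' : (0 : ℝ) < T := NNReal.coe_pos.2 hT
  -- The dyadic floors of `t / T` converge to `t / T` and never leave the grid, so continuity
  -- carries the inequality to `t`, at the price of strictness.
  have h1 : Tendsto (fun m : ℕ => ((⌊(t / T : ℝ) * ((2 ^ m : ℕ) : ℝ)⌋₊ : ℝ) / ((2 ^ m : ℕ) : ℝ)))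
      atTop (𝓝 (t / T : ℝ)) := by
    have hp : Tendsto (fun m : ℕ => ((2 ^ m : ℕ) : ℝ)) atTop atTop :=
      tendsto_natCast_atTop_atTop.comp (tendsto_pow_atTop_atTop_of_one_lt (by norm_num : 1 < 2))
    exact (tendsto_nat_floor_mul_div_atTop (R := ℝ) (by positivity)).comp hp
  have h2 : Tendsto (fun m : ℕ =>
      (⌊(t / T : ℝ) * ((2 ^ m : ℕ) : ℝ)⌋₊ : ℝ≥0) * (T / ((2 ^ m : ℕ) : ℝ≥0))) atTop (𝓝 t) := by
    rw [← NNReal.tendsto_coe]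
    have := h1.mul_const (T : ℝ)
    rw [div_mul_cancel₀ _ hT'.ne'] at this
    refine this.congr fun m => ?_
    rw [NNReal.coe_mul, NNReal.coe_div, NNReal.coe_natCast, NNReal.coe_natCast]
    ring
  refine ge_of_tendsto' ((hY.tendsto t).comp h2) fun m => (h m _ ?_).le
  have h3 : (t / T : ℝ) * ((2 ^ m : ℕ) : ℝ) ≤ ((2 ^ m : ℕ) : ℝ) :=
    mul_le_of_le_one_left (by positivity) ((div_le_one hT').2 (NNReal.coe_le_coe.2 ht))
  exact_mod_cast (Nat.floor_le (by positivity)).trans h3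

/-- Positivity at dyadic times only yields nonnegativity of a continuous path. Lowering the starting
point by `b / (j + 2)` restores strictness; conversely, a path positive on a compact interval has a
positive minimum, which exceeds some `b / (j + 2)`. The `2` keeps the lowered starting point
positive. -/
lemma ae_stay_iff (hB : IsBrownianReal B P) (ν : ℝ) {b : ℝ} (hb : 0 < b) {T : ℝ≥0} (hT : 0 < T) :
    ∀ᵐ ω ∂P, (∀ t ≤ T, 0 < driftPath B ν b t ω) ↔
      ω ∈ ⋃ j : ℕ, dyadicStay B ν (b - b / (j + 2)) T := by
  filter_upwards [hB.cont] with ω hω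
  have hc : ∀ c, Continuous fun t => driftPath B ν c t ω := fun c => by
    unfold driftPath; fun_prop
  simp only [Set.mem_iUnion]
  constructor
  · intro h
    obtain ⟨t₀, ht₀, hmin⟩ := (isCompact_Icc (a := (0 : ℝ≥0)) (b := T)).exists_isMinOn
      ⟨0, by simp⟩ (hc b).continuousOn
    have hpos := h t₀ ht₀.2
    obtain ⟨j, hj⟩ := exists_nat_gt (b / driftPath B ν b t₀ ω)
    refine ⟨j, fun m i hi => ?_⟩
    have hle : (i : ℝ≥0) * (T / (2 ^ m : ℕ)) ≤ T := by
      calc (i : ℝ≥0) * (T / (2 ^ m : ℕ)) ≤ (2 ^ m : ℕ) * (T / (2 ^ m : ℕ)) := by gcongr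
        _ = T := by field_simp
    have h1 := hmin ⟨zero_le, hle⟩
    have h2 : b / (j + 2) < driftPath B ν b t₀ ω := by
      rw [div_lt_iff₀ hpos] at hj
      rw [div_lt_iff₀ (by positivity)]
      nlinarith
    have h3 : driftPath B ν (b - b / (j + 2)) ((i : ℝ≥0) * (T / (2 ^ m : ℕ))) ω
        = driftPath B ν b ((i : ℝ≥0) * (T / (2 ^ m : ℕ))) ω - b / (j + 2) := by
      unfold driftPath; ring
    rw [h3]
    simp only [Set.mem_ofPred_eq] at h1
    linarith
  · rintro ⟨j, hj⟩ t ht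
    have h1 := nonneg_of_dyadic (hc _) hT hj ht
    have h2 : 0 < b / (j + 2) := by positivity
    have h3 : driftPath B ν (b - b / (j + 2)) t ω = driftPath B ν b t ω - b / (j + 2) := by
      unfold driftPath; ring
    rw [h3] at h1
    linarith

/-- The event involves uncountably many times; it is measurable up to a null set because it agrees
almost surely with a countable union of dyadic events. -/
lemma nullMeasurableSet_stay (hB : IsBrownianReal B P) (ν : ℝ) {b : ℝ} (hb : 0 < b) {T : ℝ≥0}
    (hT : 0 < T) : NullMeasurableSet {ω | ∀ t ≤ T, 0 < driftPath B ν b t ω} P := by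
  have h : NullMeasurableSet (⋃ j : ℕ, dyadicStay B ν (b - b / (j + 2)) T) P :=
    NullMeasurableSet.iUnion fun j => nullMeasurableSet_dyadicStay hB.toIsPreBrownianReal ν _ T
  refine h.congr ?_
  filter_upwards [ae_stay_iff hB ν hb hT] with ω hω
  exact propext hω.symm

/-- The law of the running minimum of Brownian motion with drift. -/
theorem measure_stay [IsProbabilityMeasure P] (hB : IsBrownianReal B P) (ν : ℝ) {b : ℝ}
    (hb : 0 < b) {T : ℝ≥0} (hT : 0 < T) :
    P.real {ω | ∀ t ≤ T, 0 < driftPath B ν b t ω} = stayProb ν b T := by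
  have hae : {ω | ∀ t ≤ T, 0 < driftPath B ν b t ω}
      =ᵐ[P] ⋃ j : ℕ, dyadicStay B ν (b - b / (j + 2)) T := by
    filter_upwards [ae_stay_iff hB ν hb hT] with ω hω
    exact propext hω
  rw [measureReal_congr hae]
  have hmono : Monotone fun j : ℕ => dyadicStay B ν (b - b / (j + 2)) T := by
    intro j k hjk ω hω m i hi
    refine lt_of_lt_of_le (hω m i hi) ?_
    unfold driftPath
    gcongr
  have hlim := (ENNReal.tendsto_toReal (measure_ne_top P _)).comp
    (tendsto_measure_iUnion_atTop (μ := P) hmono)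
  refine tendsto_nhds_unique hlim ?_
  have hbj : Tendsto (fun j : ℕ => b - b / ((j : ℝ) + 2)) atTop (𝓝 (b - 0)) := by
    refine tendsto_const_nhds.sub (Tendsto.div_atTop tendsto_const_nhds ?_)
    exact tendsto_atTop_add_const_right _ _ tendsto_natCast_atTop_atTop
  rw [sub_zero] at hbj
  -- The closed form is continuous in the starting point, so lowering that point costs nothing in
  -- the limit.
  refine (((continuous_stayProb ν T).tendsto b).comp hbj).congr fun j => ?_
  refine (measure_dyadicStay hB ν ?_ hT).symm
  have : b / (j + 2) < b := div_lt_self hb (by have := j.cast_nonneg (α := ℝ); linarith)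
  linarith

end StayPositive

end BarrierModel

namespace BarrierModel

/-! ### The Black-Scholes prices -/

section BlackScholesPrices

variable (M : BarrierModel) {Ω : Type*} {B : ℝ≥0 → Ω → ℝ}

lemma payoffIn_eq (sT sInf : ℝ) :
    M.payoffIn sT sInf = (if M.K ≤ sT then 1 else 0) - M.payoffOut sT sInf := by
  unfold payoffIn payoffOut
  by_cases h1 : M.K ≤ sT <;> by_cases h2 : M.L < sInf <;> simp [h1, h2, not_le, not_lt.1]

lemma driftPath_eq_log_stock (hσ : 0 < M.σ) (hs : 0 < M.s0) {c : ℝ} (hc : 0 < c) (t : ℝ≥0)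
    (ω : Ω) : driftPath B (2 * M.α) (log (M.s0 / c) / M.σ) t ω
      = (log (M.stock B t ω) - log c) / M.σ := by
  rw [stock, log_mul hs.ne' (exp_pos _).ne', log_exp, log_div hs.ne' hc.ne']
  unfold driftPath α
  field_simp
  ring

lemma stock_pos (hs : 0 < M.s0) (t : ℝ≥0) (ω : Ω) : 0 < M.stock B t ω := by
  unfold stock; positivity

lemma lt_stock_iff (hσ : 0 < M.σ) (hs : 0 < M.s0) {c : ℝ} (hc : 0 < c) (t : ℝ≥0) (ω : Ω) :
    c < M.stock B t ω ↔ 0 < driftPath B (2 * M.α) (log (M.s0 / c) / M.σ) t ω := by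
  rw [M.driftPath_eq_log_stock hσ hs hc, lt_div_iff₀ hσ, zero_mul, sub_pos,
    log_lt_log_iff hc (M.stock_pos hs t ω)]

lemma le_stock_iff (hσ : 0 < M.σ) (hs : 0 < M.s0) {c : ℝ} (hc : 0 < c) (t : ℝ≥0) (ω : Ω) :
    c ≤ M.stock B t ω ↔ 0 ≤ driftPath B (2 * M.α) (log (M.s0 / c) / M.σ) t ω := by
  rw [M.driftPath_eq_log_stock hσ hs hc, le_div_iff₀ hσ, zero_mul, sub_nonneg,
    log_le_log_iff hc (M.stock_pos hs t ω)]

variable [MeasurableSpace Ω] {P : Measure Ω}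

/-- By continuity the infimum over `[0, T]` is attained, so strict inequalities pass to it. -/
lemma ae_lt_stockInf_iff (hB : IsBrownianReal B P) :
    ∀ᵐ ω ∂P, ∀ c, c < M.stockInf B ω ↔ ∀ t ≤ M.T.toNNReal, c < M.stock B t ω := by
  filter_upwards [hB.cont] with ω hω c
  have hc : Continuous fun t => M.stock B t ω := by unfold stock; fun_prop
  obtain ⟨t₀, ht₀, hmin⟩ := (isCompact_Icc (a := (0 : ℝ≥0)) (b := M.T.toNNReal)).exists_isMinOn
    ⟨0, by simp⟩ hc.continuousOn
  have hbdd : BddBelow (Set.range fun t : Set.Icc (0 : ℝ≥0) M.T.toNNReal => M.stock B t ω) :=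
    ⟨M.stock B t₀ ω, by rintro _ ⟨t, rfl⟩; exact hmin t.2⟩
  have hne : Nonempty (Set.Icc (0 : ℝ≥0) M.T.toNNReal) := ⟨⟨t₀, ht₀⟩⟩
  constructor
  · intro h t ht
    exact h.trans_le (ciInf_le hbdd ⟨t, zero_le, ht⟩)
  · intro h
    refine (h t₀ ht₀.2).trans_le (le_ciInf fun t => hmin t.2)

lemma R_eq (hσ : 0 < M.σ) (hs : 0 < M.s0) (hL : 0 < M.L) :
    M.R = exp (-2 * (2 * M.α) * (log (M.s0 / M.L) / M.σ)) := by
  unfold R α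
  rw [rpow_def_of_pos (by positivity)]
  congr 1
  field_simp
  ring

lemma stayProb_eq (hσ : 0 < M.σ) (hs : 0 < M.s0) (hL : 0 < M.L) (hT : 0 < M.T) :
    stayProb (2 * M.α) (log (M.s0 / M.L) / M.σ) M.T = Φ M.d32 - M.R * Φ M.d42 := by
  have hq0 : 0 < √M.T := sqrt_pos.2 hT
  have h1 : (log (M.s0 / M.L) / M.σ + 2 * M.α * M.T) / √M.T = M.d32 := by
    unfold d32 d31 α
    field_simp
    rw [sq_sqrt hT.le]
    ring
  have h2 : (-(log (M.s0 / M.L) / M.σ) + 2 * M.α * M.T) / √M.T = M.d42 := by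
    unfold d42 d41 α
    rw [log_div hs.ne' hL.ne', log_div hL.ne' hs.ne']
    field_simp
    rw [sq_sqrt hT.le]
    ring
  rw [stayProb, h1, h2, ← R_eq M hσ hs hL]

lemma measure_terminal_ge (hB : IsBrownianReal B P) (hσ : 0 < M.σ) (hs : 0 < M.s0)
    (hK : 0 < M.K) (hT : 0 < M.T) :
    P.real {ω | M.K ≤ M.stock B M.T.toNNReal ω} = Φ M.d12 := by
  have hpre := hB.toIsPreBrownianReal
  have hq0 : 0 < √M.T := sqrt_pos.2 hT
  -- Division by `-√T` rather than `√T` turns the event into a lower half-line, to which the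
  -- distribution function applies directly.
  have hlaw : HasLaw (fun ω => B M.T.toNNReal ω / -√M.T) (gaussianReal 0 1) P := by
    have h := gaussianReal_div_const (hpre.hasLaw_eval M.T.toNNReal) (-√M.T)
    have e : M.T.toNNReal / NNReal.mk ((-√M.T) ^ 2) (sq_nonneg _) = 1 := by
      have : NNReal.mk ((-√M.T) ^ 2) (sq_nonneg _) = M.T.toNNReal := by
        ext
        rw [Real.coe_toNNReal _ hT.le]
        exact (neg_sq _).trans (sq_sqrt hT.le)
      rw [this]
      exact div_self (Real.toNNReal_pos.2 hT).ne'
    rw [e, zero_div] at h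
    exact h
  have hset : {ω | M.K ≤ M.stock B M.T.toNNReal ω}
      = (fun ω => B M.T.toNNReal ω / -√M.T) ⁻¹' Set.Iic M.d12 := by
    ext ω
    simp only [Set.mem_ofPred_eq, Set.mem_preimage, Set.mem_Iic]
    rw [le_stock_iff M hσ hs hK, driftPath, Real.coe_toNNReal _ hT.le]
    have h2 : M.d12 - B M.T.toNNReal ω / -√M.T
        = (log (M.s0 / M.K) / M.σ + 2 * M.α * M.T + B M.T.toNNReal ω) / √M.T := by
      unfold d12 d11 α
      field_simp
      rw [sq_sqrt hT.le]
      ring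
    rw [← sub_nonneg (a := M.d12), h2, le_div_iff₀ hq0, zero_mul]
  rw [hset, Measure.real, ← Measure.map_apply_of_aemeasurable hlaw.aemeasurable measurableSet_Iic,
    hlaw.map_eq]
  unfold Φ
  rw [cdf_eq_real, Measure.real]

/-- Since `K < L`, survival above `L` already forces the terminal price above `K`, so the strike
drops out. -/
lemma ae_payoffOut (hB : IsBrownianReal B P) (hKL : M.K < M.L) (hσ : 0 < M.σ) (hs : 0 < M.s0)
    (hL : 0 < M.L) :
    (fun ω => M.payoffOut (M.stock B M.T.toNNReal ω) (M.stockInf B ω)) =ᵐ[P] fun ω =>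
      open Classical in if ∀ t ≤ M.T.toNNReal,
        0 < driftPath B (2 * M.α) (log (M.s0 / M.L) / M.σ) t ω then 1 else 0 := by
  classical
  filter_upwards [M.ae_lt_stockInf_iff hB] with ω hω
  have h : (M.K ≤ M.stock B M.T.toNNReal ω ∧ M.L < M.stockInf B ω) ↔
      ∀ t ≤ M.T.toNNReal, 0 < driftPath B (2 * M.α) (log (M.s0 / M.L) / M.σ) t ω := by
    simp only [hω, M.lt_stock_iff hσ hs hL]
    refine ⟨fun h => h.2, fun h => ⟨?_, h⟩⟩
    exact (hKL.trans ((M.lt_stock_iff hσ hs hL _ _).2 (h _ le_rfl))).le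
  unfold payoffOut
  exact if_congr h rfl rfl

lemma integral_payoffOut [IsProbabilityMeasure P] (hB : IsBrownianReal B P) (hK : 0 < M.K)
    (hKL : M.K < M.L) (hL : M.L < M.s0) (hσ : 0 < M.σ) (hT : 0 < M.T) :
    ∫ ω, M.payoffOut (M.stock B M.T.toNNReal ω) (M.stockInf B ω) ∂P = Φ M.d32 - M.R * Φ M.d42 := by
  classical
  have hL0 : 0 < M.L := hK.trans hKL
  have hs : 0 < M.s0 := hL0.trans hL
  have hb : 0 < log (M.s0 / M.L) / M.σ := div_pos (log_pos ((one_lt_div hL0).2 hL)) hσ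
  have hT' : 0 < M.T.toNNReal := Real.toNNReal_pos.2 hT
  rw [integral_congr_ae (M.ae_payoffOut hB hKL hσ hs hL0),
    integral_ite_one (nullMeasurableSet_stay hB _ hb hT'), measure_stay hB _ hb hT',
    Real.coe_toNNReal _ hT.le, M.stayProb_eq hσ hs hL0 hT]

theorem priceBSOut_eq [IsProbabilityMeasure P] (hB : IsBrownianReal B P) (hK : 0 < M.K)
    (hKL : M.K < M.L) (hL : M.L < M.s0) (hσ : 0 < M.σ) (hT : 0 < M.T) :
    M.priceBSOut P B = exp (-M.r * M.T) * (Φ M.d32 - M.R * Φ M.d42) := by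
  rw [priceBSOut, M.integral_payoffOut hB hK hKL hL hσ hT]

theorem priceBSIn_eq [IsProbabilityMeasure P] (hB : IsBrownianReal B P) (hK : 0 < M.K)
    (hKL : M.K < M.L) (hL : M.L < M.s0) (hσ : 0 < M.σ) (hT : 0 < M.T) :
    M.priceBSIn P B = exp (-M.r * M.T) * (Φ M.d12 - (Φ M.d32 - M.R * Φ M.d42)) := by
  classical
  have hL0 : 0 < M.L := hK.trans hKL
  have hs : 0 < M.s0 := hL0.trans hL
  have hb : 0 < log (M.s0 / M.L) / M.σ := div_pos (log_pos ((one_lt_div hL0).2 hL)) hσ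
  have hT' : 0 < M.T.toNNReal := Real.toNNReal_pos.2 hT
  have hpre := hB.toIsPreBrownianReal
  have hstock : AEMeasurable (M.stock B M.T.toNNReal) P := by
    have := hpre.aemeasurable M.T.toNNReal
    unfold stock
    fun_prop
  have hset : NullMeasurableSet {ω | M.K ≤ M.stock B M.T.toNNReal ω} P :=
    nullMeasurableSet_le aemeasurable_const hstock
  have hone : Integrable (fun _ : Ω => (1 : ℝ)) P := integrable_const _
  have hi1 : Integrable (fun ω => if M.K ≤ M.stock B M.T.toNNReal ω then (1 : ℝ) else 0) P := by
    refine (hone.indicator₀ hset).congr (ae_of_all _ fun ω => ?_)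
    simp only [Set.indicator_apply, Set.mem_ofPred_eq]
  have hi2 : Integrable
      (fun ω => M.payoffOut (M.stock B M.T.toNNReal ω) (M.stockInf B ω)) P := by
    refine Integrable.congr ?_ (M.ae_payoffOut hB hKL hσ hs hL0).symm
    refine (hone.indicator₀ (nullMeasurableSet_stay hB (2 * M.α) hb hT')).congr
      (ae_of_all _ fun ω => ?_)
    simp only [Set.indicator_apply, Set.mem_ofPred_eq]
  simp only [priceBSIn, payoffIn_eq]
  rw [integral_sub hi1 hi2, integral_ite_one hset, M.measure_terminal_ge hB hσ hs hK hT,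
    M.integral_payoffOut hB hK hKL hL hσ hT]

end BlackScholesPrices

end BarrierModel

namespace BarrierModel

/-! ### Random walks and the binomial distribution -/

/-- The expectation of `f` under the binomial distribution. -/
def binomExp (n : ℕ) (p : ℝ) (f : ℕ → ℝ) : ℝ :=
  ∑ j ∈ Finset.range (n + 1), (n.choose j : ℝ) * p ^ j * (1 - p) ^ (n - j) * f j

/-- The distribution function of the binomial distribution. -/
def binomCdf (n k : ℕ) (p : ℝ) : ℝ := binomExp n p fun j => if j ≤ k then 1 else 0

lemma binomExp_zero (p : ℝ) (f : ℕ → ℝ) : binomExp 0 p f = f 0 := by simp [binomExp]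

lemma binomExp_succ (n : ℕ) (p : ℝ) (f : ℕ → ℝ) :
    binomExp (n + 1) p f = p * binomExp n p (fun j => f (j + 1)) + (1 - p) * binomExp n p f := by
  have h2 : (1 - p) * binomExp n p f = ∑ j ∈ Finset.range (n + 2),
      (n.choose j : ℝ) * p ^ j * (1 - p) ^ (n + 1 - j) * f j := by
    rw [Finset.sum_range_succ _ (n + 1), Nat.choose_succ_self]
    simp only [binomExp, Finset.mul_sum, Nat.cast_zero, zero_mul, add_zero]
    refine Finset.sum_congr rfl fun j hj => ?_
    rw [Nat.succ_sub (Nat.lt_succ_iff.1 (Finset.mem_range.1 hj)), pow_succ]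
    ring
  rw [h2, Finset.sum_range_succ']
  simp only [binomExp, Finset.mul_sum]
  rw [Finset.sum_range_succ', ← add_assoc, ← Finset.sum_add_distrib]
  congr 1
  · refine Finset.sum_congr rfl fun j _ => ?_
    rw [Nat.choose_succ_succ, Nat.add_sub_add_right]
    push_cast
    ring
  · simp

lemma binomExp_one (n : ℕ) (p : ℝ) : binomExp n p (fun _ => 1) = 1 := by
  induction n with
  | zero => simp [binomExp_zero]
  | succ n ih => rw [binomExp_succ, ih]; ring

lemma binomExp_reflect (n : ℕ) (p : ℝ) (f : ℕ → ℝ) :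
    binomExp n (1 - p) f = binomExp n p fun j => f (n - j) := by
  unfold binomExp
  rw [← Finset.sum_range_reflect]
  refine Finset.sum_congr rfl fun j hj => ?_
  have hj' : j ≤ n := Nat.lt_succ_iff.1 (Finset.mem_range.1 hj)
  have h1 : n + 1 - 1 - j = n - j := by omega
  rw [h1, Nat.choose_symm hj', Nat.sub_sub_self hj', sub_sub_cancel]
  ring

lemma binomExp_congr {n : ℕ} (p : ℝ) {f g : ℕ → ℝ} (h : ∀ j ≤ n, f j = g j) :
    binomExp n p f = binomExp n p g :=
  Finset.sum_congr rfl fun j hj => by rw [h j (Nat.lt_succ_iff.1 (Finset.mem_range.1 hj))]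

lemma binomExp_sub (n : ℕ) (p : ℝ) (f g : ℕ → ℝ) :
    binomExp n p (fun j => f j - g j) = binomExp n p f - binomExp n p g := by
  simp only [binomExp, ← Finset.sum_sub_distrib, mul_sub]

/-- The weight of a path of a random walk with up probability `p`. -/
def walkWeight (p : ℝ) {n : ℕ} (path : Fin n → Bool) : ℝ :=
  ∏ k : Fin n, if path k = true then p else 1 - p

lemma walkWeight_cons (p : ℝ) {n : ℕ} (b : Bool) (path : Fin n → Bool) :
    walkWeight p (Fin.cons b path : Fin (n + 1) → Bool)
      = (if b = true then p else 1 - p) * walkWeight p path := by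
  simp [walkWeight, Fin.prod_univ_succ]

lemma numUp_zero {n : ℕ} (path : Fin n → Bool) : numUp path 0 = 0 := by simp [numUp]

lemma numUp_cons {n : ℕ} (b : Bool) (path : Fin n → Bool) (i : ℕ) :
    numUp (Fin.cons b path : Fin (n + 1) → Bool) (i + 1)
      = (if b = true then 1 else 0) + numUp path i := by
  unfold numUp
  simp only [Finset.card_filter]
  rw [Fin.sum_univ_succ]
  simp

lemma sum_path_succ {n : ℕ} (F : (Fin (n + 1) → Bool) → ℝ) :
    ∑ path, F path = ∑ path : Fin n → Bool, F (Fin.cons true path)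
      + ∑ path : Fin n → Bool, F (Fin.cons false path) := by
  rw [← (Fin.consEquiv fun _ => Bool).sum_comp, Fintype.sum_prod_type, Fintype.sum_bool]
  rfl

lemma sum_walkWeight_numUp (p : ℝ) (n : ℕ) (f : ℕ → ℝ) :
    ∑ path : Fin n → Bool, walkWeight p path * f (numUp path n) = binomExp n p f := by
  induction n generalizing f with
  | zero => simp [walkWeight, numUp_zero, binomExp_zero]
  | succ n ih =>
    rw [sum_path_succ, binomExp_succ, ← ih, ← ih]
    simp only [walkWeight_cons, numUp_cons, Finset.mul_sum, if_true, Bool.false_eq_true, if_false,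
      zero_add, add_comm 1, mul_assoc]

/-- The probability that a random walk with up probability `p`, started at `k`, stays positive
for `n` steps. -/
def walkStay (p : ℝ) (n : ℕ) (k : ℤ) : ℝ :=
  ∑ path : Fin n → Bool, walkWeight p path *
    if ∀ i ≤ n, 0 < k + (2 * (numUp path i : ℤ) - i) then 1 else 0

lemma walkStay_of_nonpos (p : ℝ) (n : ℕ) {k : ℤ} (hk : k ≤ 0) : walkStay p n k = 0 := by
  refine Finset.sum_eq_zero fun path _ => ?_
  rw [if_neg, mul_zero]
  intro h
  have := h 0 (Nat.zero_le _)
  simp only [numUp_zero] at this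
  simp at this
  omega

lemma walkStay_succ (p : ℝ) (n : ℕ) {k : ℤ} (hk : 0 < k) :
    walkStay p (n + 1) k = p * walkStay p n (k + 1) + (1 - p) * walkStay p n (k - 1) := by
  have key : ∀ (b : Bool) (path : Fin n → Bool),
      (∀ i ≤ n + 1, 0 < k + (2 * (numUp (Fin.cons b path : Fin (n + 1) → Bool) i : ℤ) - i)) ↔
      ∀ i ≤ n, 0 < (k + if b = true then 1 else -1) + (2 * (numUp path i : ℤ) - i) := by
    intro b path
    constructor
    · intro h i hi
      have := h (i + 1) (by omega)
      rw [numUp_cons] at this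
      cases b <;> simp at this ⊢ <;> omega
    · intro h i hi
      rcases i with _ | i
      · simp [numUp_zero, hk]
      · have := h i (by omega)
        rw [numUp_cons]
        cases b <;> simp at this ⊢ <;> omega
  unfold walkStay
  rw [sum_path_succ, sub_eq_add_neg k 1]
  simp only [walkWeight_cons, key, Finset.mul_sum, if_true, Bool.false_eq_true, if_false,
    mul_assoc]

/-- Exchanging up and down moves replaces `p` by `1 - p`. This is the boundary condition at the
origin in the discrete reflection principle. -/
lemma binomExp_pos_eq_neg (p : ℝ) (n : ℕ) :
    binomExp n p (fun j => if 0 < 0 + (2 * (j : ℤ) - n) then 1 else 0)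
      = binomExp n (1 - p) (fun j => if 0 + (2 * (j : ℤ) - n) < 0 then 1 else 0) := by
  rw [binomExp_reflect]
  refine binomExp_congr p fun j hj => if_congr ?_ rfl rfl
  push_cast [Nat.cast_sub hj]
  constructor <;> intro h <;> linarith

/-- Reflection principle for random walks. -/
theorem walkStay_eq {p : ℝ} (hp : 0 < p) (hp1 : p < 1) (n : ℕ) {k : ℤ} (hk : 0 ≤ k) :
    walkStay p n k = binomExp n p (fun j => if 0 < k + (2 * (j : ℤ) - n) then 1 else 0)
      - ((1 - p) / p) ^ k
        * binomExp n (1 - p) (fun j => if k + (2 * (j : ℤ) - n) < 0 then 1 else 0) := by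
  have hq : 0 < 1 - p := by linarith
  induction n generalizing k with
  | zero =>
    rcases hk.eq_or_lt with rfl | hk0
    · rw [walkStay_of_nonpos p 0 le_rfl, zpow_zero, one_mul, binomExp_pos_eq_neg, sub_self]
    · have h1 : ¬ k < 0 := by omega
      simp [walkStay, numUp_zero, walkWeight, binomExp_zero, hk0, h1]
  | succ n ih =>
    rcases hk.eq_or_lt with rfl | hk0
    · rw [walkStay_of_nonpos p _ le_rfl, zpow_zero, one_mul, binomExp_pos_eq_neg, sub_self]
    -- Both sides obey the first-step recursion. In the mirror term the factors `((1-p)/p)^(k±1)`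
    -- exchange the weights `p` and `1 - p`, which is exactly the recursion for the binomial law
    -- with parameter `1 - p`.
    rw [walkStay_succ p n hk0, ih (by omega), ih (by omega), binomExp_succ, binomExp_succ]
    have e1 : ∀ j : ℕ, k + (2 * ((j + 1 : ℕ) : ℤ) - ((n + 1 : ℕ) : ℤ)) = k + 1 + (2 * j - n) := by
      intro j; push_cast; ring
    have e2 : ∀ j : ℕ, k + (2 * (j : ℤ) - ((n + 1 : ℕ) : ℤ)) = k - 1 + (2 * j - n) := by
      intro j; push_cast; ring
    simp only [e1, e2]
    rw [zpow_add₀ (by positivity), zpow_sub₀ (by positivity), zpow_one, sub_sub_cancel]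
    field_simp
    ring

lemma binomExp_gt (n k : ℕ) (p : ℝ) :
    binomExp n p (fun j => if k < j then 1 else 0) = 1 - binomCdf n k p := by
  have h := binomExp_sub n p (fun _ => 1) (fun j => if j ≤ k then 1 else 0)
  rw [binomExp_one] at h
  rw [binomCdf, ← h]
  refine binomExp_congr p fun j _ => ?_
  by_cases h : j ≤ k
  · simp [h]
  · simp [h, not_le.1 h]

/-! ### The prices on the tree -/

variable (M : BarrierModel)

lemma lt_treeMin_iff {n : ℕ} (path : Fin n → Bool) (c : ℝ) :
    c < M.treeMin path ↔ ∀ i ≤ n, c < M.treePrice path i := by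
  obtain ⟨i₀, hi₀⟩ := Finite.exists_min fun i : Fin (n + 1) => M.treePrice path (i : ℕ)
  have hbdd : BddBelow (Set.range fun i : Fin (n + 1) => M.treePrice path (i : ℕ)) :=
    (Set.finite_range _).bddBelow
  constructor
  · intro h i hi
    exact h.trans_le (ciInf_le hbdd ⟨i, Nat.lt_succ_of_le hi⟩)
  · intro h
    exact (h i₀ (Nat.lt_succ_iff.1 i₀.2)).trans_le (le_ciInf hi₀)

lemma mesh_pos (hσ : 0 < M.σ) (hT : 0 < M.T) {n : ℕ} (hn : 0 < n) : 0 < M.σ * √(M.dt n) := by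
  have : 0 < M.dt n := div_pos hT (by exact_mod_cast hn)
  positivity

lemma two_mul_lL (n : ℕ) :
    2 * M.lL n = log (M.L / M.s0) / (M.σ * √(M.dt n)) + n := by
  unfold lL
  rw [mul_add, mul_assoc 2, ← div_div, mul_div_assoc']
  ring

/-- In units of the logarithmic mesh the price is an integer walk, so the barrier may be lowered to
the integer `⌊2 l_L⌋ - n`; relative to it the walk starts at `n - ⌊2 l_L⌋`. -/
lemma lt_node_iff (hσ : 0 < M.σ) (hT : 0 < M.T) (hs : 0 < M.s0) (hL : 0 < M.L) {n : ℕ}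
    (hn : 0 < n) (i j : ℕ) :
    M.L < M.node n i j ↔ 0 < -(⌊2 * M.lL n⌋ - n) + (2 * (j : ℤ) - i) := by
  have hm := M.mesh_pos hσ hT hn
  have h1 : M.L < M.node n i j ↔ 2 * M.lL n - n < ((2 * (j : ℤ) - i : ℤ) : ℝ) := by
    rw [two_mul_lL, add_sub_cancel_right, div_lt_iff₀ hm, log_div hL.ne' hs.ne', node,
      ← log_lt_log_iff hL (by positivity), log_mul hs.ne' (exp_pos _).ne', log_exp, sub_lt_iff_lt_add']
    push_cast
    rfl
  rw [h1, sub_lt_iff_lt_add]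
  have h2 : ((2 * (j : ℤ) - i : ℤ) : ℝ) + n = ((2 * (j : ℤ) - i + n : ℤ) : ℝ) := by push_cast; ring
  rw [h2, ← Int.floor_lt]
  omega

lemma le_node_iff (hσ : 0 < M.σ) (hT : 0 < M.T) (hs : 0 < M.s0) (hK : 0 < M.K) {n : ℕ}
    (hn : 0 < n) (j : ℕ) :
    M.K ≤ M.node n n j ↔ -⌊log (M.s0 / M.K) / (2 * M.σ * √(M.dt n)) - (n : ℝ) / 2⌋ ≤ (j : ℤ) := by
  have hm := M.mesh_pos hσ hT hn
  have hm' : 0 < 2 * M.σ * √(M.dt n) := by linarith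
  have h1 : M.K ≤ M.node n n j ↔
      ((-j : ℤ) : ℝ) ≤ log (M.s0 / M.K) / (2 * M.σ * √(M.dt n)) - (n : ℝ) / 2 := by
    rw [le_sub_iff_add_le, le_div_iff₀ hm', log_div hs.ne' hK.ne', node,
      ← log_le_log_iff hK (by positivity), log_mul hs.ne' (exp_pos _).ne', log_exp]
    push_cast
    constructor <;> intro h <;> linarith
  rw [h1, ← Int.le_floor, neg_le]

lemma sum_payoffOut (hK : 0 < M.K) (hKL : M.K < M.L) (hL : M.L < M.s0) (hσ : 0 < M.σ)
    (hT : 0 < M.T) {n : ℕ} (hn : 0 < n) :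
    ∑ path : Fin n → Bool, M.pathWeight path * M.payoffOut (M.treePrice path n) (M.treeMin path)
      = walkStay (M.prob n) n (-(⌊2 * M.lL n⌋ - n)) := by
  have hL0 : 0 < M.L := hK.trans hKL
  have hs : 0 < M.s0 := hL0.trans hL
  refine Finset.sum_congr rfl fun path _ => ?_
  have h : (M.K ≤ M.treePrice path n ∧ M.L < M.treeMin path) ↔
      ∀ i ≤ n, 0 < -(⌊2 * M.lL n⌋ - n) + (2 * (numUp path i : ℤ) - i) := by
    rw [lt_treeMin_iff]
    simp only [treePrice, ← M.lt_node_iff hσ hT hs hL0 hn]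
    exact ⟨fun h => h.2, fun h => ⟨(hKL.trans (h n le_rfl)).le, h⟩⟩
  unfold payoffOut
  rw [if_congr h rfl rfl]
  rfl

/-- The down-and-out price on the tree in terms of binomial distribution functions. -/
lemma priceCRROut_eq (hK : 0 < M.K) (hKL : M.K < M.L) (hL : M.L < M.s0) (hσ : 0 < M.σ)
    (hT : 0 < M.T) {n : ℕ} (hn : 0 < n) (hp : 0 < M.prob n) (hp1 : M.prob n < 1)
    (hbar : ⌊2 * M.lL n⌋ ≤ n) {k₁ k₂ : ℕ} (hk₁ : ∀ j : ℕ, 2 * (j : ℤ) ≤ ⌊2 * M.lL n⌋ ↔ j ≤ k₁)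
    (hk₂ : ∀ j : ℕ, 2 * (j : ℤ) < ⌊2 * M.lL n⌋ ↔ j ≤ k₂) :
    M.priceCRROut n = exp (-M.r * M.T) * (1 - binomCdf n k₁ (M.prob n)
      - (M.prob n / (1 - M.prob n)) ^ (⌊2 * M.lL n⌋ - n) * binomCdf n k₂ (1 - M.prob n)) := by
  rw [priceCRROut, M.sum_payoffOut hK hKL hL hσ hT hn, walkStay_eq hp hp1 n (by omega),
    zpow_neg, ← inv_zpow, inv_div, ← binomExp_gt, binomCdf]
  congr 2
  · refine binomExp_congr _ fun j _ => if_congr ?_ rfl rfl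
    rw [← not_le (a := j), ← hk₁]
    omega
  · congr 1
    refine binomExp_congr _ fun j _ => if_congr ?_ rfl rfl
    rw [← hk₂]
    omega

/-- Knock-in plus knock-out is the plain digital, whose tree value is the probability of more than
`k` up moves. -/
lemma priceCRRIn_eq (hσ : 0 < M.σ) (hT : 0 < M.T) (hs : 0 < M.s0) (hK : 0 < M.K) {n : ℕ}
    (hn : 0 < n) {k : ℕ}
    (hk : (k : ℤ) + 1 = -⌊log (M.s0 / M.K) / (2 * M.σ * √(M.dt n)) - (n : ℝ) / 2⌋) :
    M.priceCRRIn n = exp (-M.r * M.T) * (1 - binomCdf n k (M.prob n)) - M.priceCRROut n := by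
  rw [priceCRRIn, priceCRROut, ← mul_sub, ← binomExp_gt, ← sum_walkWeight_numUp,
    ← Finset.sum_sub_distrib]
  congr 1
  refine Finset.sum_congr rfl fun path _ => ?_
  rw [payoffIn_eq, mul_sub]
  congr 2
  refine if_congr ?_ rfl rfl
  rw [treePrice, M.le_node_iff hσ hT hs hK hn, ← hk]
  omega

end BarrierModel

namespace BarrierModel

/-! ### Pointwise expansion of the beta density -/

lemma abs_exp_sub_one_sub_le (s : ℝ) : |exp s - 1 - s| ≤ s ^ 2 * exp |s| := by
  have h0 : 0 ≤ exp s - 1 - s := by linarith [add_one_le_exp s]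
  have h1 : exp s - 1 ≤ s * exp s := by
    have h := mul_le_mul_of_nonneg_right (add_one_le_exp (-s)) (exp_pos s).le
    rw [← exp_add, neg_add_cancel, exp_zero] at h
    linarith
  rw [abs_of_nonneg h0]
  rcases le_total 0 s with hs | hs
  · rw [abs_of_nonneg hs]
    nlinarith
  · have h2 : s * (exp s - 1) ≤ s ^ 2 := by nlinarith [add_one_le_exp s]
    have h3 : 1 ≤ exp |s| := one_le_exp (abs_nonneg s)
    have h4 : s ^ 2 ≤ s ^ 2 * exp |s| := le_mul_of_one_le_right (sq_nonneg s) h3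
    linarith

lemma abs_log_add_log_le {u : ℝ} (hu : |u| ≤ 1 / 2) :
    |log (1 + u) + log (1 - u) - (-u ^ 2 - u ^ 4 / 2)| ≤ 2 * |u| ^ 6 := by
  have hu' := abs_le.1 hu
  have hsq : |u ^ 2| ≤ 1 / 4 := by
    rw [abs_pow]; nlinarith [abs_nonneg u]
  have h := abs_log_sub_add_sum_range_le (x := u ^ 2) (by linarith) 2
  rw [← log_mul (by linarith) (by linarith), show (1 + u) * (1 - u) = 1 - u ^ 2 by ring]
  have e : log (1 - u ^ 2) - (-u ^ 2 - u ^ 4 / 2)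
      = (∑ i ∈ Finset.range 2, (u ^ 2) ^ (i + 1) / ((i : ℝ) + 1)) + log (1 - u ^ 2) := by
    simp [Finset.sum_range_succ]; ring
  rw [e]
  refine h.trans ?_
  rw [div_le_iff₀ (by linarith), abs_pow]
  have : 0 ≤ |u| ^ 6 := by positivity
  rw [abs_pow] at hsq
  have h3 := mul_nonneg this (show 0 ≤ 1 - 2 * |u| ^ 2 by linarith)
  calc (|u| ^ 2) ^ (2 + 1) = 2 * |u| ^ 6 * (1 - |u| ^ 2) - |u| ^ 6 * (1 - 2 * |u| ^ 2) := by ring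
    _ ≤ _ := by linarith

lemma abs_log_sub_log_le {u : ℝ} (hu : |u| ≤ 1 / 2) :
    |log (1 + u) - log (1 - u) - (2 * u + 2 * u ^ 3 / 3)| ≤ 4 * |u| ^ 5 := by
  have h1 := abs_log_sub_add_sum_range_le (x := u) (by linarith) 4
  have h2 := abs_log_sub_add_sum_range_le (x := -u) (by rw [abs_neg]; linarith) 4
  rw [abs_neg, sub_neg_eq_add] at h2
  have e : log (1 + u) - log (1 - u) - (2 * u + 2 * u ^ 3 / 3)
      = ((∑ i ∈ Finset.range 4, (-u) ^ (i + 1) / ((i : ℝ) + 1)) + log (1 + u))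
        - ((∑ i ∈ Finset.range 4, u ^ (i + 1) / ((i : ℝ) + 1)) + log (1 - u)) := by
    simp [Finset.sum_range_succ]; ring
  have h3 : |u| ^ (4 + 1) / (1 - |u|) ≤ 2 * |u| ^ 5 := by
    rw [div_le_iff₀ (by linarith)]
    have := mul_nonneg (show 0 ≤ |u| ^ 5 by positivity) (show 0 ≤ 1 - 2 * |u| by linarith)
    calc |u| ^ (4 + 1) = 2 * |u| ^ 5 * (1 - |u|) - |u| ^ 5 * (1 - 2 * |u|) := by ring
      _ ≤ _ := by linarith
  rw [e]
  refine (abs_sub _ _).trans ?_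
  linarith

/-- The coefficient of `1 / n` in the expansion of the beta density. -/
def betaCorr (δ x : ℝ) : ℝ := x ^ 2 / 2 - x ^ 4 / 4 + δ * x ^ 3 / 3

lemma abs_betaCorr_le {A δ : ℝ} (hδ : |δ| ≤ A) (x : ℝ) :
    |betaCorr δ x| ≤ (1 + A) * (1 + |x|) ^ 4 := by
  have hA : 0 ≤ A := (abs_nonneg _).trans hδ
  set X := 1 + |x| with hX
  have hX1 : 1 ≤ X := by simp [hX]
  have hxX : |x| ≤ X := by simp [hX]
  have p2 : |x| ^ 2 ≤ X ^ 4 := (pow_le_pow_left₀ (abs_nonneg _) hxX 2).trans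
    (pow_le_pow_right₀ hX1 (by norm_num))
  have p3 : |x| ^ 3 ≤ X ^ 4 := (pow_le_pow_left₀ (abs_nonneg _) hxX 3).trans
    (pow_le_pow_right₀ hX1 (by norm_num))
  have p4 : |x| ^ 4 ≤ X ^ 4 := pow_le_pow_left₀ (abs_nonneg _) hxX 4
  have h1 : |betaCorr δ x| ≤ |x| ^ 2 / 2 + |x| ^ 4 / 4 + |δ| * |x| ^ 3 / 3 := by
    unfold betaCorr
    refine (abs_add_le _ _).trans (add_le_add ((abs_sub _ _).trans ?_) ?_)
    · rw [abs_div, abs_div, abs_pow, abs_pow]; norm_num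
    · rw [abs_div, abs_mul, abs_pow]; norm_num
  have h2 : |δ| * |x| ^ 3 ≤ A * X ^ 4 := mul_le_mul hδ p3 (by positivity) hA
  have h3 : 0 ≤ A * X ^ 4 := by positivity
  have h4 : 0 ≤ X ^ 4 := by positivity
  nlinarith

/-- The factors `(q² - 1 ± δq)/2` are the exponents `a` and `b` when `a + b + 1 = q²` and `a - b =
δq`. Their sum multiplies the even series of the logarithms and their difference the odd one; after
the terms up to `1/q²`, the exact leftover is `x⁴/(4q⁴)` plus the two series remainders. -/
lemma abs_log_betaDensity_le {A δ q x : ℝ} (hδ : |δ| ≤ A) (hq : 1 ≤ q) (hx : |x / q| ≤ 1 / 2) :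
    |(q ^ 2 - 1 + δ * q) / 2 * log (1 + x / q) + (q ^ 2 - 1 - δ * q) / 2 * log (1 - x / q)
      - (-x ^ 2 / 2 + δ * x + betaCorr δ x / q ^ 2)| ≤ (2 + 2 * A) * (1 + |x|) ^ 6 / q ^ 4 := by
  have hA : 0 ≤ A := (abs_nonneg _).trans hδ
  have hq0 : 0 < q := by linarith
  set u := x / q with hu
  have hxu : x = u * q := by rw [hu]; field_simp
  have h1 := abs_log_add_log_le hx
  have h2 := abs_log_sub_log_le hx
  set e₁ := log (1 + u) + log (1 - u) - (-u ^ 2 - u ^ 4 / 2)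
  set e₂ := log (1 + u) - log (1 - u) - (2 * u + 2 * u ^ 3 / 3)
  have e : (q ^ 2 - 1 + δ * q) / 2 * log (1 + u) + (q ^ 2 - 1 - δ * q) / 2 * log (1 - u)
      - (-x ^ 2 / 2 + δ * x + betaCorr δ x / q ^ 2)
      = x ^ 4 / (4 * q ^ 4) + ((q ^ 2 - 1) / 2 * e₁ + δ * q / 2 * e₂) := by
    simp only [e₁, e₂, betaCorr, hxu]
    field_simp
    ring
  rw [e]
  have hux : |u| = |x| / q := by rw [hu, abs_div, abs_of_pos hq0]
  have b1 : |x ^ 4 / (4 * q ^ 4)| ≤ (1 + |x|) ^ 6 / q ^ 4 := by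
    rw [abs_of_nonneg (by positivity), div_le_div_iff₀ (by positivity) (by positivity)]
    have : x ^ 4 ≤ (1 + |x|) ^ 6 := by
      rw [← Even.pow_abs (by decide : Even 4)]
      exact (pow_le_pow_left₀ (abs_nonneg _) (by linarith) 4).trans
          (pow_le_pow_right₀ (by linarith [abs_nonneg x]) (by norm_num))
    have h4 : 0 < q ^ 4 := by positivity
    have h6 : 0 ≤ (1 + |x|) ^ 6 := by positivity
    nlinarith
  have b2 : |(q ^ 2 - 1) / 2 * e₁| ≤ (1 + |x|) ^ 6 / q ^ 4 := by
    rw [abs_mul, abs_of_nonneg (by nlinarith)]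
    calc (q ^ 2 - 1) / 2 * |e₁| ≤ q ^ 2 / 2 * (2 * |u| ^ 6) := by gcongr; linarith
      _ = |x| ^ 6 / q ^ 4 := by rw [hux]; field_simp
      _ ≤ _ := by gcongr; linarith
  have b3 : |δ * q / 2 * e₂| ≤ 2 * A * (1 + |x|) ^ 6 / q ^ 4 := by
    rw [abs_mul, abs_div, abs_mul, abs_of_pos hq0, abs_two]
    calc |δ| * q / 2 * |e₂| ≤ A * q / 2 * (4 * |u| ^ 5) := by gcongr
      _ = 2 * A * |x| ^ 5 / q ^ 4 := by rw [hux]; field_simp; ring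
      _ ≤ 2 * A * (1 + |x|) ^ 6 / q ^ 4 := by
        gcongr
        exact (pow_le_pow_left₀ (abs_nonneg _) (by linarith) 5).trans
          (pow_le_pow_right₀ (by linarith [abs_nonneg x]) (by norm_num))
  calc _ ≤ |x ^ 4 / (4 * q ^ 4)| + (|(q ^ 2 - 1) / 2 * e₁| + |δ * q / 2 * e₂|) :=
        (abs_add_le _ _).trans (add_le_add_right (abs_add_le _ _) _)
    _ ≤ (1 + |x|) ^ 6 / q ^ 4 + ((1 + |x|) ^ 6 / q ^ 4 + 2 * A * (1 + |x|) ^ 6 / q ^ 4) := by gcongr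
    _ = _ := by ring

/-- The kernel of a beta density, in centred and rescaled coordinates. -/
def betaKernel (q : ℝ) (a b : ℕ) (x : ℝ) : ℝ :=
  (Set.Ioo (-q) q).indicator (fun x => (1 + x / q) ^ a * (1 - x / q) ^ b) x

lemma betaKernel_nonneg {q : ℝ} (hq : 0 < q) (a b : ℕ) (x : ℝ) : 0 ≤ betaKernel q a b x := by
  refine Set.indicator_nonneg (fun x hx => ?_) x
  have h1 : -1 ≤ x / q := by rw [le_div_iff₀ hq]; linarith [hx.1]
  have h2 : x / q ≤ 1 := by rw [div_le_iff₀ hq]; linarith [hx.2]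
  exact mul_nonneg (pow_nonneg (by linarith) _) (pow_nonneg (by linarith) _)

/-- Pairing the common powers into `(1 - u²)^b` and leaving `(1 + u)^d`, both factors are bounded by
`1 + t ≤ exp t`. -/
lemma one_add_pow_mul_le {u : ℝ} (hu : |u| ≤ 1) (b d : ℕ) :
    (1 + u) ^ (b + d) * (1 - u) ^ b ≤ exp (-(b * u ^ 2) + d * u) := by
  have hu' := abs_le.1 hu
  have h1 : (1 - u ^ 2) ^ b ≤ exp (-u ^ 2) ^ b :=
    pow_le_pow_left₀ (by nlinarith) (by linarith [add_one_le_exp (-u ^ 2)]) b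
  have h2 : (1 + u) ^ d ≤ exp u ^ d :=
    pow_le_pow_left₀ (by linarith) (by linarith [add_one_le_exp u]) d
  calc (1 + u) ^ (b + d) * (1 - u) ^ b = (1 - u ^ 2) ^ b * (1 + u) ^ d := by
        rw [show 1 - u ^ 2 = (1 + u) * (1 - u) by ring, mul_pow, pow_add]; ring
    _ ≤ exp (-u ^ 2) ^ b * exp u ^ d := by
        refine mul_le_mul h1 h2 (pow_nonneg (by linarith) _) (by positivity)
    _ = _ := by rw [← exp_nat_mul, ← exp_nat_mul, ← exp_add]; congr 1; ring

/-- Gaussian upper bound for the kernel of a beta density. -/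
lemma betaKernel_le {A δ q : ℝ} {a b : ℕ} (hδ : |δ| ≤ A) (hq : 2 * A + 2 ≤ q)
    (hab : (a : ℝ) + b + 1 = q ^ 2) (hd : (a : ℝ) - b = δ * q) (x : ℝ) :
    betaKernel q a b x ≤ exp (-x ^ 2 / 4 + A * |x|) := by
  have hA : 0 ≤ A := (abs_nonneg _).trans hδ
  have hq0 : 0 < q := by linarith
  have hδq : |δ * q| ≤ A * q := by
    rw [abs_mul, abs_of_pos hq0]; exact mul_le_mul_of_nonneg_right hδ hq0.le
  have hδq' := abs_le.1 hδq
  -- The condition `2A + 2 ≤ q` makes both exponents at least a quarter of `q²`, whence the decay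
  -- `exp (-x²/4)`.
  have hmin : q ^ 2 / 4 ≤ a ∧ q ^ 2 / 4 ≤ b := by constructor <;> nlinarith
  by_cases hx : x ∈ Set.Ioo (-q) q
  · rw [betaKernel, Set.indicator_of_mem hx]
    have hu : |x / q| ≤ 1 := by
      rw [abs_div, abs_of_pos hq0, div_le_one hq0]
      exact (abs_lt.2 hx).le
    have hδx : δ * x ≤ A * |x| := (le_abs_self _).trans
      (by rw [abs_mul]; exact mul_le_mul_of_nonneg_right hδ (abs_nonneg _))
    have key : ∀ c : ℝ, q ^ 2 / 4 ≤ c → x ^ 2 / 4 ≤ c * (x / q) ^ 2 := by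
      intro c hc
      calc x ^ 2 / 4 = q ^ 2 / 4 * (x / q) ^ 2 := by field_simp
        _ ≤ _ := mul_le_mul_of_nonneg_right hc (sq_nonneg _)
    rcases le_total b a with h | h
    · obtain ⟨d, rfl⟩ := Nat.exists_eq_add_of_le h
      refine (one_add_pow_mul_le hu b d).trans (exp_le_exp.2 ?_)
      have h1 : (d : ℝ) * (x / q) = δ * x := by
        push_cast at hd
        rw [show (d : ℝ) = δ * q by linarith]; field_simp
      rw [h1]
      linarith [key b hmin.2]
    · obtain ⟨d, rfl⟩ := Nat.exists_eq_add_of_le h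
      have h0 := one_add_pow_mul_le (u := -(x / q)) (by rwa [abs_neg]) a d
      rw [sub_neg_eq_add, ← sub_eq_add_neg, mul_comm] at h0
      refine h0.trans (exp_le_exp.2 ?_)
      have h1 : (d : ℝ) * -(x / q) = δ * x := by
        push_cast at hd
        rw [show (d : ℝ) = -(δ * q) by linarith]; field_simp
      rw [h1, neg_sq]
      linarith [key a hmin.1]
  · rw [betaKernel, Set.indicator_of_notMem hx]
    positivity

end BarrierModel

namespace BarrierModel

lemma betaKernel_eq_exp {q x : ℝ} {a b : ℕ} (hq : 0 < q) (hx : |x / q| ≤ 1 / 2) :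
    betaKernel q a b x = exp (a * log (1 + x / q) + b * log (1 - x / q)) := by
  have hx' := abs_le.1 hx
  have hmem : x ∈ Set.Ioo (-q) q := by
    have h1 := (le_div_iff₀ hq).1 hx'.1
    have h2 := (div_le_iff₀ hq).1 hx'.2
    constructor <;> linarith
  rw [betaKernel, Set.indicator_of_mem hmem, exp_add, exp_nat_mul, exp_nat_mul,
    exp_log (by linarith), exp_log (by linarith)]

lemma gaussian_le {A δ : ℝ} (hδ : |δ| ≤ A) (x : ℝ) :
    exp (-x ^ 2 / 2 + δ * x) ≤ exp (-x ^ 2 / 4 + A * |x|) := by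
  have hδx : δ * x ≤ A * |x| := (le_abs_self _).trans
    (by rw [abs_mul]; exact mul_le_mul_of_nonneg_right hδ (abs_nonneg _))
  exact exp_le_exp.2 (by nlinarith [sq_nonneg x])

/-- For `|x| ≤ √q` the correction `θ = betaCorr δ x / q²` and the logarithmic remainder `E` are both
bounded, so `exp (θ + E)` may be replaced by `1 + θ`; the cost is governed by `θ²` and `E`, each of
order `(1 + |x|)^8 / q⁴`. -/
lemma abs_betaKernel_sub_le_of_small {A δ q x : ℝ} {a b : ℕ} (hδ : |δ| ≤ A) (hq : 4 ≤ q)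
    (hab : (a : ℝ) + b + 1 = q ^ 2) (hd : (a : ℝ) - b = δ * q) (hx : x ^ 4 ≤ q ^ 2) :
    |betaKernel q a b x - exp (-x ^ 2 / 2 + δ * x) * (1 + betaCorr δ x / q ^ 2)|
      ≤ (2 * (1 + A) + 2050 * (1 + A) ^ 2 * exp (528 * (1 + A)))
        * (1 + |x|) ^ 8 * exp (-x ^ 2 / 4 + A * |x|) / q ^ 4 := by
  have hA : 0 ≤ A := (abs_nonneg _).trans hδ
  have hq0 : 0 < q := by linarith
  have hx2 : x ^ 2 ≤ q := by
    refine le_of_sq_le_sq ?_ hq0.le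
    calc (x ^ 2) ^ 2 = x ^ 4 := by ring
      _ ≤ q ^ 2 := hx
  have hu : |x / q| ≤ 1 / 2 := by
    refine le_of_sq_le_sq ?_ (by norm_num)
    rw [sq_abs, div_pow, div_le_iff₀ (by positivity)]
    nlinarith
  set X := 1 + |x| with hX
  have hX1 : 1 ≤ X := by simp [hX]
  have hX4 : X ^ 4 ≤ 16 * q ^ 2 := by
    have h1 : X ^ 4 ≤ (2 * max 1 |x|) ^ 4 := by
      refine pow_le_pow_left₀ (by linarith) ?_ 4
      linarith [le_max_left 1 |x|, le_max_right 1 |x|]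
    have h2 : max 1 |x| ^ 4 ≤ q ^ 2 := by
      rcases le_total 1 |x| with h | h
      · rw [max_eq_right h, Even.pow_abs (by decide : Even 4)]; exact hx
      · rw [max_eq_left h]; nlinarith
    calc X ^ 4 ≤ (2 * max 1 |x|) ^ 4 := h1
      _ = 16 * max 1 |x| ^ 4 := by ring
      _ ≤ _ := by linarith
  have hX8 : X ^ 8 ≤ 256 * q ^ 4 := by
    calc X ^ 8 = (X ^ 4) ^ 2 := by ring
      _ ≤ (16 * q ^ 2) ^ 2 := pow_le_pow_left₀ (by positivity) hX4 2
      _ = _ := by ring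
  set θ := betaCorr δ x / q ^ 2 with hθ
  set E := (q ^ 2 - 1 + δ * q) / 2 * log (1 + x / q) + (q ^ 2 - 1 - δ * q) / 2 * log (1 - x / q)
      - (-x ^ 2 / 2 + δ * x + θ) with hE
  set D := 1 + A with hD
  have hD1 : 1 ≤ D := by linarith
  have hEb : |E| ≤ 2 * D * X ^ 8 / q ^ 4 := by
    refine (abs_log_betaDensity_le hδ (by linarith) hu).trans ?_
    rw [show 2 + 2 * A = 2 * D by rw [hD]; ring]
    gcongr
    norm_num
  have hEb' : |E| ≤ 512 * D := by
    refine hEb.trans ?_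
    rw [div_le_iff₀ (by positivity)]
    nlinarith
  have hθa : |θ| ≤ D * X ^ 4 / q ^ 2 := by
    rw [hθ, abs_div, abs_of_pos (by positivity : 0 < q ^ 2)]
    gcongr
    exact abs_betaCorr_le hδ x
  have hθb : |θ| ≤ 16 * D := by
    refine hθa.trans ?_
    rw [div_le_iff₀ (by positivity)]
    nlinarith
  have hθ2 : θ ^ 2 ≤ D ^ 2 * X ^ 8 / q ^ 4 := by
    rw [← sq_abs]
    calc |θ| ^ 2 ≤ (D * X ^ 4 / q ^ 2) ^ 2 := pow_le_pow_left₀ (abs_nonneg _) hθa 2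
      _ = _ := by rw [div_pow]; ring
  have hE2 : E ^ 2 ≤ 1024 * D ^ 2 * X ^ 8 / q ^ 4 := by
    rw [← sq_abs, sq]
    calc |E| * |E| ≤ 512 * D * (2 * D * X ^ 8 / q ^ 4) := by gcongr
      _ = _ := by ring
  -- Here `528 = 16 + 512` adds the bounds on `|θ|` and `|E|`, and `2050 = 2 * (1 + 1024)` comes
  -- from `(θ + E)² ≤ 2θ² + 2E²`.
  have hs : |exp (θ + E) - 1 - θ| ≤ (2 * D + 2050 * D ^ 2 * exp (528 * D)) * X ^ 8 / q ^ 4 := by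
    have h1 := abs_exp_sub_one_sub_le (θ + E)
    have h2 : (θ + E) ^ 2 ≤ 2050 * D ^ 2 * X ^ 8 / q ^ 4 := by
      calc (θ + E) ^ 2 ≤ 2 * θ ^ 2 + 2 * E ^ 2 := by nlinarith [sq_nonneg (θ - E)]
        _ ≤ 2 * (D ^ 2 * X ^ 8 / q ^ 4) + 2 * (1024 * D ^ 2 * X ^ 8 / q ^ 4) := by gcongr
        _ = _ := by ring
    have h3 : exp |θ + E| ≤ exp (528 * D) := by
      refine exp_le_exp.2 ((abs_add_le _ _).trans ?_)
      linarith
    calc |exp (θ + E) - 1 - θ| = |(exp (θ + E) - 1 - (θ + E)) + E| := by congr 1; ring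
      _ ≤ |exp (θ + E) - 1 - (θ + E)| + |E| := abs_add_le _ _
      _ ≤ 2050 * D ^ 2 * X ^ 8 / q ^ 4 * exp (528 * D) + 2 * D * X ^ 8 / q ^ 4 := by
          refine add_le_add (h1.trans (mul_le_mul h2 h3 (by positivity) (by positivity))) hEb
      _ = _ := by ring
  have hw : betaKernel q a b x = exp (-x ^ 2 / 2 + δ * x) * exp (θ + E) := by
    rw [betaKernel_eq_exp hq0 hu, ← exp_add]
    congr 1
    rw [show (a : ℝ) = (q ^ 2 - 1 + δ * q) / 2 by linarith,
      show (b : ℝ) = (q ^ 2 - 1 - δ * q) / 2 by linarith, hE]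
    ring
  rw [hw, show exp (-x ^ 2 / 2 + δ * x) * exp (θ + E) - exp (-x ^ 2 / 2 + δ * x) * (1 + θ)
    = exp (-x ^ 2 / 2 + δ * x) * (exp (θ + E) - 1 - θ) by ring, abs_mul, abs_exp]
  calc _ ≤ exp (-x ^ 2 / 4 + A * |x|)
        * ((2 * D + 2050 * D ^ 2 * exp (528 * D)) * X ^ 8 / q ^ 4) :=
        mul_le_mul (gaussian_le hδ x) hs (abs_nonneg _) (exp_pos _).le
    _ = _ := by ring

/-- Beyond `|x| = √q` no cancellation is needed: both terms have Gaussian bounds, and `(1 + |x|)^8 /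
q⁴ ≥ 1` supplies the missing power of `q`. -/
lemma abs_betaKernel_sub_le_of_large {A δ q x : ℝ} {a b : ℕ} (hδ : |δ| ≤ A) (hq : 2 * A + 2 ≤ q)
    (hab : (a : ℝ) + b + 1 = q ^ 2) (hd : (a : ℝ) - b = δ * q) (hx : q ^ 2 ≤ x ^ 4) :
    |betaKernel q a b x - exp (-x ^ 2 / 2 + δ * x) * (1 + betaCorr δ x / q ^ 2)|
      ≤ (3 + A) * (1 + |x|) ^ 12 * exp (-x ^ 2 / 4 + A * |x|) / q ^ 4 := by
  have hA : 0 ≤ A := (abs_nonneg _).trans hδ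
  have hq1 : 1 ≤ q := by linarith
  have hq0 : 0 < q := by linarith
  set X := 1 + |x| with hX
  have hX1 : 1 ≤ X := by simp [hX]
  have hX4 : 1 ≤ X ^ 4 := one_le_pow₀ hX1
  have hone : 1 ≤ X ^ 8 / q ^ 4 := by
    rw [one_le_div (by positivity)]
    calc q ^ 4 = (q ^ 2) ^ 2 := by ring
      _ ≤ (x ^ 4) ^ 2 := pow_le_pow_left₀ (by positivity) hx 2
      _ = |x| ^ 8 := by rw [Even.pow_abs (by decide : Even 8)]; ring
      _ ≤ X ^ 8 := pow_le_pow_left₀ (abs_nonneg _) (by simp [hX]) 8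
  set G := exp (-x ^ 2 / 4 + A * |x|) with hG
  have hGpos : 0 < G := exp_pos _
  have h1 : |betaKernel q a b x| ≤ G := by
    rw [abs_of_nonneg (betaKernel_nonneg hq0 a b x)]
    exact betaKernel_le hδ hq hab hd x
  have h2 : |1 + betaCorr δ x / q ^ 2| ≤ (2 + A) * X ^ 4 := by
    have h3 : |betaCorr δ x / q ^ 2| ≤ (1 + A) * X ^ 4 := by
      rw [abs_div, abs_of_pos (by positivity : 0 < q ^ 2), div_le_iff₀ (by positivity)]
      refine (abs_betaCorr_le hδ x).trans ?_
      exact le_mul_of_one_le_right (by positivity) (one_le_pow₀ hq1)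
    calc |1 + betaCorr δ x / q ^ 2| ≤ |1| + |betaCorr δ x / q ^ 2| := abs_add_le _ _
      _ ≤ X ^ 4 + (1 + A) * X ^ 4 := add_le_add (by rw [abs_one]; exact hX4) h3
      _ = _ := by ring
  have h4 : |exp (-x ^ 2 / 2 + δ * x) * (1 + betaCorr δ x / q ^ 2)| ≤ G * ((2 + A) * X ^ 4) := by
    rw [abs_mul, abs_exp]
    exact mul_le_mul (gaussian_le hδ x) h2 (abs_nonneg _) hGpos.le
  calc _ ≤ G + G * ((2 + A) * X ^ 4) := (abs_sub _ _).trans (add_le_add h1 h4)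
    _ ≤ G * X ^ 4 + G * ((2 + A) * X ^ 4) := by
        gcongr; exact le_mul_of_one_le_right hGpos.le hX4
    _ = (3 + A) * X ^ 4 * G * 1 := by ring
    _ ≤ (3 + A) * X ^ 4 * G * (X ^ 8 / q ^ 4) := by gcongr
    _ = _ := by ring

/-- Half of the quadratic exponent absorbs everything else: the polynomial is at most a factorial
times `exp (1 + |x|)`, and the resulting linear exponent is removed by completing the square in `|x|
- 4(A + 1)`. -/
lemma exists_gaussian_bound (A : ℝ) (k : ℕ) :
    ∃ C, 0 ≤ C ∧ ∀ x : ℝ, (1 + |x|) ^ k * exp (-x ^ 2 / 4 + A * |x|)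
      ≤ C * exp (-(1 / 8) * x ^ 2) := by
  refine ⟨(k.factorial : ℝ) * exp (1 + 2 * (A + 1) ^ 2), by positivity, fun x => ?_⟩
  have h1 : (1 + |x|) ^ k ≤ k.factorial * exp (1 + |x|) := by
    have := pow_div_factorial_le_exp (x := 1 + |x|) (by positivity) k
    rw [div_le_iff₀ (by positivity)] at this
    linarith
  calc (1 + |x|) ^ k * exp (-x ^ 2 / 4 + A * |x|)
      ≤ k.factorial * exp (1 + |x|) * exp (-x ^ 2 / 4 + A * |x|) := by gcongr
    _ = k.factorial * exp (1 + |x| + (-x ^ 2 / 4 + A * |x|)) := by rw [mul_assoc, ← exp_add]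
    _ ≤ k.factorial * exp (1 + 2 * (A + 1) ^ 2 + -(1 / 8) * x ^ 2) := by
        refine mul_le_mul_of_nonneg_left (exp_le_exp.2 ?_) (by positivity)
        rw [← sq_abs x]
        nlinarith [sq_nonneg (|x| - 4 * (A + 1))]
    _ = _ := by rw [exp_add, mul_assoc]

/-- Uniform expansion of the kernel of a beta density. -/
theorem exists_betaKernel_bound (A : ℝ) :
    ∃ C, 0 ≤ C ∧ ∀ q : ℝ, 4 ≤ q → 2 * A + 2 ≤ q → ∀ (a b : ℕ) (δ : ℝ), |δ| ≤ A →
      (a : ℝ) + b + 1 = q ^ 2 → (a : ℝ) - b = δ * q → ∀ x,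
      |betaKernel q a b x - exp (-x ^ 2 / 2 + δ * x) * (1 + betaCorr δ x / q ^ 2)|
        ≤ C / q ^ 4 * exp (-(1 / 8) * x ^ 2) := by
  obtain ⟨C₀, hC₀, hC⟩ := exists_gaussian_bound A 12
  obtain ⟨K, hK0, hK1, hK2⟩ : ∃ K : ℝ, 0 ≤ K ∧
      2 * (1 + A) + 2050 * (1 + A) ^ 2 * exp (528 * (1 + A)) ≤ K ∧ 3 + A ≤ K :=
    ⟨max 0 (max _ _), le_max_left _ _, (le_max_left _ _).trans (le_max_right _ _),
      (le_max_right _ _).trans (le_max_right _ _)⟩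
  refine ⟨K * C₀, by positivity, fun q hq4 hqA a b δ hδ hab hd x => ?_⟩
  have hA : 0 ≤ A := (abs_nonneg _).trans hδ
  have hX1 : 1 ≤ 1 + |x| := by simp
  have hq0 : 0 < q := by linarith
  suffices h : |betaKernel q a b x - exp (-x ^ 2 / 2 + δ * x) * (1 + betaCorr δ x / q ^ 2)|
      ≤ K * (1 + |x|) ^ 12 * exp (-x ^ 2 / 4 + A * |x|) / q ^ 4 by
    refine h.trans ?_
    calc _ = K / q ^ 4 * ((1 + |x|) ^ 12 * exp (-x ^ 2 / 4 + A * |x|)) := by ring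
      _ ≤ K / q ^ 4 * (C₀ * exp (-(1 / 8) * x ^ 2)) :=
          mul_le_mul_of_nonneg_left (hC x) (by positivity)
      _ = _ := by ring
  rcases le_total (x ^ 4) (q ^ 2) with hx | hx
  · refine (abs_betaKernel_sub_le_of_small hδ hq4 hab hd hx).trans ?_
    have h8 : (1 + |x|) ^ 8 ≤ (1 + |x|) ^ 12 := pow_le_pow_right₀ hX1 (by norm_num)
    have h9 := mul_le_mul hK1 h8 (by positivity) hK0
    gcongr
  · refine (abs_betaKernel_sub_le_of_large hδ hqA hab hd hx).trans ?_
    gcongr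

end BarrierModel

namespace BarrierModel

/-! ### Integrated expansion -/

/-- The polynomial `Q` with `(φ(x - δ) Q)' = φ(x - δ) (betaCorr δ x - betaMean δ)`. -/
def betaPoly (δ x : ℝ) : ℝ :=
  x ^ 3 / 4 - δ * x ^ 2 / 12 + (1 / 4 - δ ^ 2 / 12) * x + (δ / 12 - δ ^ 3 / 12)

/-- The mean of `betaCorr δ` under the normal distribution centred at `δ`. -/
def betaMean (δ : ℝ) : ℝ := δ ^ 4 / 12 - 1 / 4

/-- The antiderivative of the expanded density. -/
def betaAnti (δ q x : ℝ) : ℝ :=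
  (1 + betaMean δ / q ^ 2) * Φ (x - δ) + φ (x - δ) * betaPoly δ x / q ^ 2

lemma hasDerivAt_betaAnti (δ q x : ℝ) :
    HasDerivAt (betaAnti δ q) (φ (x - δ) * (1 + betaCorr δ x / q ^ 2)) x := by
  have hid : HasDerivAt (fun x : ℝ => x - δ) 1 x := (hasDerivAt_id x).sub_const δ
  have h1 : HasDerivAt (fun x => Φ (x - δ)) (φ (x - δ) * 1) x := (hasDerivAt_Φ _).comp x hid
  have h2 : HasDerivAt (fun x => φ (x - δ)) (-(x - δ) * φ (x - δ) * 1) x :=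
    (hasDerivAt_φ _).comp x hid
  have h3 : HasDerivAt (betaPoly δ)
      (3 * x ^ 2 / 4 - δ * (2 * x) / 12 + (1 / 4 - δ ^ 2 / 12)) x := by
    have a3 := (hasDerivAt_pow 3 x).div_const 4
    have a2 := ((hasDerivAt_pow 2 x).const_mul δ).div_const 12
    have a1 := (hasDerivAt_id x).const_mul (1 / 4 - δ ^ 2 / 12)
    have := ((a3.sub a2).add a1).add_const (δ / 12 - δ ^ 3 / 12)
    refine this.congr_deriv ?_
    norm_num
  have := (h1.const_mul (1 + betaMean δ / q ^ 2)).add ((h2.mul h3).div_const (q ^ 2))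
  refine this.congr_deriv ?_
  unfold betaPoly betaMean betaCorr
  ring

/-- Multiplication by `φ δ` turns the unnormalised Gaussian limit of the kernel into the normal
density centred at `δ`. -/
lemma φ_sub_eq (δ x : ℝ) :
    φ (x - δ) = exp (-δ ^ 2 / 2) / √(2 * π) * exp (-x ^ 2 / 2 + δ * x) := by
  unfold φ
  rw [div_mul_eq_mul_div, ← exp_add]
  congr 2
  ring

lemma φ_sub_le {A δ : ℝ} (hδ : |δ| ≤ A) (x : ℝ) : φ (x - δ) ≤ exp (-x ^ 2 / 4 + A * |x|) := by
  have h1 : exp (-δ ^ 2 / 2) / √(2 * π) ≤ 1 := φ_le_one δ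
  rw [φ_sub_eq]
  calc _ ≤ 1 * exp (-x ^ 2 / 2 + δ * x) := by gcongr
    _ ≤ _ := by rw [one_mul]; exact gaussian_le hδ x

lemma abs_betaPoly_le (δ x : ℝ) :
    |betaPoly δ x| ≤ (1 + |δ| + δ ^ 2 + |δ| ^ 3) * (1 + |x|) ^ 3 := by
  have h0 : |betaPoly δ x| ≤ |x| ^ 3 + |δ| * |x| ^ 2 + (1 + δ ^ 2) * |x| + (|δ| + |δ| ^ 3) := by
    unfold betaPoly
    refine (abs_add_le _ _).trans (add_le_add ((abs_add_le _ _).trans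
      (add_le_add ((abs_sub _ _).trans (add_le_add ?_ ?_)) ?_)) ?_)
    · rw [abs_div, abs_pow, abs_of_pos (by norm_num : (0 : ℝ) < 4)]
      linarith [pow_nonneg (abs_nonneg x) 3]
    · rw [abs_div, abs_mul, abs_pow, abs_of_pos (by norm_num : (0 : ℝ) < 12)]
      linarith [mul_nonneg (abs_nonneg δ) (pow_nonneg (abs_nonneg x) 2)]
    · rw [abs_mul]
      refine mul_le_mul_of_nonneg_right (abs_le.2 ⟨?_, ?_⟩) (abs_nonneg _) <;>
        linarith [sq_nonneg δ]
    · refine (abs_sub _ _).trans (add_le_add ?_ ?_)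
      · rw [abs_div, abs_of_pos (by norm_num : (0 : ℝ) < 12)]; linarith [abs_nonneg δ]
      · rw [abs_div, abs_pow, abs_of_pos (by norm_num : (0 : ℝ) < 12)]
        linarith [pow_nonneg (abs_nonneg δ) 3]
  set X := 1 + |x| with hX
  have hX1 : 1 ≤ X := by simp [hX]
  have hxX : |x| ≤ X := by simp [hX]
  have p3 : |x| ^ 3 ≤ X ^ 3 := pow_le_pow_left₀ (abs_nonneg _) hxX 3
  have p2 : |x| ^ 2 ≤ X ^ 3 := (pow_le_pow_left₀ (abs_nonneg _) hxX 2).trans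
    (pow_le_pow_right₀ hX1 (by norm_num))
  have q1 : 1 + |x| ≤ X ^ 3 := le_self_pow₀ hX1 (by norm_num)
  have p0 : 1 ≤ X ^ 3 := one_le_pow₀ hX1
  have t2 := mul_le_mul_of_nonneg_left p2 (abs_nonneg δ)
  have t1 := mul_le_mul_of_nonneg_left (by linarith : |x| ≤ X ^ 3) (sq_nonneg δ)
  have t0 := mul_le_mul_of_nonneg_left p0 (pow_nonneg (abs_nonneg δ) 3)
  have q3 : |x| ^ 3 + |x| ≤ X ^ 3 := by
    have : X ^ 3 = 1 + 3 * |x| + 3 * |x| ^ 2 + |x| ^ 3 := by rw [hX]; ring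
    rw [this]
    linarith [sq_nonneg |x|, abs_nonneg x]
  have q2 : |δ| * |x| ^ 2 + |δ| ≤ |δ| * X ^ 3 := by
    have : |x| ^ 2 + 1 ≤ X ^ 3 := by
      have : X ^ 3 = 1 + 3 * |x| + 3 * |x| ^ 2 + |x| ^ 3 := by rw [hX]; ring
      rw [this]
      linarith [sq_nonneg |x|, abs_nonneg x, pow_nonneg (abs_nonneg x) 3]
    have := mul_le_mul_of_nonneg_left this (abs_nonneg δ)
    linarith
  linarith

lemma tendsto_φ_mul_betaPoly (δ : ℝ) {l : Filter ℝ} (hl : Tendsto (fun x : ℝ => |x|) l atTop) :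
    Tendsto (fun x => φ (x - δ) * betaPoly δ x) l (𝓝 0) := by
  obtain ⟨C, hC0, hC⟩ := exists_gaussian_bound |δ| 3
  have hexp : Tendsto (fun x : ℝ => exp (-(1 / 8) * x ^ 2)) l (𝓝 0) := by
    refine tendsto_exp_atBot.comp ?_
    have h2 : Tendsto (fun x : ℝ => x ^ 2) l atTop :=
      ((tendsto_pow_atTop two_ne_zero).comp hl).congr fun x => sq_abs x
    exact h2.const_mul_atTop_of_neg (by norm_num)
  have hlim := hexp.const_mul ((1 + |δ| + δ ^ 2 + |δ| ^ 3) * C)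
  rw [mul_zero] at hlim
  refine squeeze_zero_norm (fun x => ?_) hlim
  rw [norm_mul, Real.norm_eq_abs, Real.norm_eq_abs, abs_of_pos (φ_pos _)]
  calc φ (x - δ) * |betaPoly δ x|
      ≤ exp (-x ^ 2 / 4 + |δ| * |x|) * ((1 + |δ| + δ ^ 2 + |δ| ^ 3) * (1 + |x|) ^ 3) :=
        mul_le_mul (φ_sub_le le_rfl x) (abs_betaPoly_le δ x) (abs_nonneg _) (exp_pos _).le
    _ = (1 + |δ| + δ ^ 2 + |δ| ^ 3) * ((1 + |x|) ^ 3 * exp (-x ^ 2 / 4 + |δ| * |x|)) := by ring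
    _ ≤ (1 + |δ| + δ ^ 2 + |δ| ^ 3) * (C * exp (-(1 / 8) * x ^ 2)) :=
        mul_le_mul_of_nonneg_left (hC x) (by positivity)
    _ = _ := by ring

lemma integrable_betaDensity (δ : ℝ) {q : ℝ} (hq : 1 ≤ q) :
    Integrable fun x => φ (x - δ) * (1 + betaCorr δ x / q ^ 2) := by
  obtain ⟨C, hC0, hC⟩ := exists_gaussian_bound |δ| 4
  have hint := (integrable_exp_neg_mul_sq (b := 1 / 8) (by norm_num)).const_mul ((2 + |δ|) * C)
  refine hint.mono' ?_ (ae_of_all _ fun x => ?_)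
  · have := continuous_φ
    unfold betaCorr
    exact Continuous.aestronglyMeasurable (by fun_prop)
  · rw [norm_mul, Real.norm_eq_abs, Real.norm_eq_abs, abs_of_pos (φ_pos _)]
    have h2 : |1 + betaCorr δ x / q ^ 2| ≤ (2 + |δ|) * (1 + |x|) ^ 4 := by
      have h3 : |betaCorr δ x / q ^ 2| ≤ (1 + |δ|) * (1 + |x|) ^ 4 := by
        rw [abs_div, abs_of_pos (by positivity : 0 < q ^ 2), div_le_iff₀ (by positivity)]
        refine (abs_betaCorr_le le_rfl x).trans ?_
        exact le_mul_of_one_le_right (by positivity) (one_le_pow₀ hq)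
      have h4 : 1 ≤ (1 + |x|) ^ 4 := one_le_pow₀ (by simp)
      calc |1 + betaCorr δ x / q ^ 2| ≤ |1| + |betaCorr δ x / q ^ 2| := abs_add_le _ _
        _ ≤ (1 + |x|) ^ 4 + (1 + |δ|) * (1 + |x|) ^ 4 := add_le_add (by rw [abs_one]; exact h4) h3
        _ = _ := by ring
    calc φ (x - δ) * |1 + betaCorr δ x / q ^ 2|
        ≤ exp (-x ^ 2 / 4 + |δ| * |x|) * ((2 + |δ|) * (1 + |x|) ^ 4) :=
          mul_le_mul (φ_sub_le le_rfl x) h2 (abs_nonneg _) (exp_pos _).le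
      _ = (2 + |δ|) * ((1 + |x|) ^ 4 * exp (-x ^ 2 / 4 + |δ| * |x|)) := by ring
      _ ≤ (2 + |δ|) * (C * exp (-(1 / 8) * x ^ 2)) :=
          mul_le_mul_of_nonneg_left (hC x) (by positivity)
      _ = _ := by ring

lemma tendsto_betaAnti_atBot (δ q : ℝ) : Tendsto (betaAnti δ q) atBot (𝓝 0) := by
  have h1 : Tendsto (fun x => Φ (x - δ)) atBot (𝓝 0) :=
    tendsto_Φ_atBot.comp (tendsto_atBot_add_const_right _ (-δ) tendsto_id)
  have := (h1.const_mul (1 + betaMean δ / q ^ 2)).add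
    ((tendsto_φ_mul_betaPoly δ tendsto_abs_atBot_atTop).div_const (q ^ 2))
  simp only [mul_zero, zero_div, add_zero] at this
  exact this

lemma tendsto_betaAnti_atTop (δ q : ℝ) :
    Tendsto (betaAnti δ q) atTop (𝓝 (1 + betaMean δ / q ^ 2)) := by
  have h1 : Tendsto (fun x => Φ (x - δ)) atTop (𝓝 1) :=
    tendsto_Φ_atTop.comp (tendsto_atTop_add_const_right _ (-δ) tendsto_id)
  have := (h1.const_mul (1 + betaMean δ / q ^ 2)).add
    ((tendsto_φ_mul_betaPoly δ tendsto_abs_atTop_atTop).div_const (q ^ 2))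
  simp only [mul_one, zero_div, add_zero] at this
  exact this

/-! ### The binomial distribution function as an incomplete beta integral -/

lemma binomCdf_eq_sum {n k : ℕ} (hk : k ≤ n) (p : ℝ) :
    binomCdf n k p = ∑ j ∈ Finset.range (k + 1), (n.choose j : ℝ) * p ^ j * (1 - p) ^ (n - j) := by
  unfold binomCdf binomExp
  simp only [mul_ite, mul_one, mul_zero]
  rw [← Finset.sum_filter]
  refine Finset.sum_congr ?_ fun _ _ => rfl
  ext j
  simp only [Finset.mem_filter, Finset.mem_range]
  omega

/-- The derivatives of consecutive terms telescope through `(k+1) C(n,k+1) = (n-k) C(n,k)`, leaving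
only the last one: a beta density. -/
lemma hasDerivAt_binomCdf {n k : ℕ} (hk : k < n) (p : ℝ) :
    HasDerivAt (binomCdf n k)
      (-(((n - k : ℕ) : ℝ) * n.choose k * p ^ k * (1 - p) ^ (n - 1 - k))) p := by
  have hfun : binomCdf n k = fun p => ∑ j ∈ Finset.range (k + 1),
      (n.choose j : ℝ) * p ^ j * (1 - p) ^ (n - j) := funext (binomCdf_eq_sum hk.le)
  rw [hfun]
  have hone : HasDerivAt (fun p : ℝ => 1 - p) (-1) p := by
    simpa using (hasDerivAt_id p).const_sub 1
  clear hfun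
  induction k with
  | zero =>
    simp only [zero_add, Finset.range_one, Finset.sum_singleton, Nat.choose_zero_right,
      Nat.cast_one, pow_zero, mul_one, one_mul, Nat.sub_zero]
    refine (hone.pow n).congr_deriv ?_
    ring
  | succ k ih =>
    simp only [Finset.sum_range_succ _ (k + 1)]
    have h1 := ((hasDerivAt_pow (k + 1) p).const_mul (n.choose (k + 1) : ℝ)).mul
      (hone.pow (n - (k + 1)))
    refine ((ih (by omega)).add h1).congr_deriv ?_
    have hch : (n.choose (k + 1) : ℝ) * (k + 1) = n.choose k * ((n - k : ℕ) : ℝ) := by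
      exact_mod_cast Nat.choose_succ_right_eq n k
    have e1 : n - 1 - k = n - (k + 1) := by omega
    have e2 : n - 1 - (k + 1) = n - (k + 1) - 1 := by omega
    simp only [e1, e2, Nat.add_sub_cancel, Pi.pow_apply]
    push_cast
    linear_combination p ^ k * (1 - p) ^ (n - (k + 1)) * hch

lemma binomCdf_one {n k : ℕ} (hk : k < n) : binomCdf n k 1 = 0 := by
  rw [binomCdf_eq_sum hk.le]
  refine Finset.sum_eq_zero fun j hj => ?_
  have := Finset.mem_range.1 hj
  rw [sub_self, zero_pow (by omega), mul_zero]

lemma binomCdf_zero (n k : ℕ) : binomCdf n k 0 = 1 := by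
  unfold binomCdf binomExp
  rw [Finset.sum_eq_single 0]
  · simp
  · intro j _ hj
    rw [zero_pow hj]
    simp
  · simp

/-- In rescaled coordinates, the binomial distribution function is proportional to the integral
of the kernel of a beta density. -/
lemma binomCdf_eq_mul_integral {n k : ℕ} (hk : k < n) {q : ℝ} (hq : 0 < q) :
    ∃ c : ℝ, (∀ y ∈ Set.Ico (-q) q, binomCdf n k ((1 - y / q) / 2)
        = c * ∫ x in Set.Iic y, betaKernel q (n - 1 - k) k x) ∧
      1 = c * ∫ x, betaKernel q (n - 1 - k) k x := by
  -- The last factors come from the substitution `p = (1 - x/q)/2`. Later uses need only that `c`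
  -- times the total mass is `1`.
  set c : ℝ := ((n - k : ℕ) : ℝ) * n.choose k * (1 / 2) ^ k * (1 / 2) ^ (n - 1 - k) * (1 / (2 * q))
    with hc
  have hderiv : ∀ x, HasDerivAt (fun x => binomCdf n k ((1 - x / q) / 2))
      (c * ((1 + x / q) ^ (n - 1 - k) * (1 - x / q) ^ k)) x := by
    intro x
    have hin : HasDerivAt (fun x : ℝ => (1 - x / q) / 2) (-(1 / q) / 2) x :=
      (((hasDerivAt_id x).div_const q).const_sub 1).div_const 2
    have := (hasDerivAt_binomCdf hk ((1 - x / q) / 2)).comp x hin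
    refine this.congr_deriv ?_
    have e1 : 1 - (1 - x / q) / 2 = (1 + x / q) * (1 / 2) := by ring
    have e2 : (1 - x / q) / 2 = (1 - x / q) * (1 / 2) := by ring
    rw [e1, e2, mul_pow, mul_pow, hc]
    field_simp
  have hcont : Continuous fun x : ℝ => (1 + x / q) ^ (n - 1 - k) * (1 - x / q) ^ k := by fun_prop
  have hint : ∀ y, -q ≤ y → c * ∫ x in Set.Ioc (-q) y, (1 + x / q) ^ (n - 1 - k) * (1 - x / q) ^ k
      = binomCdf n k ((1 - y / q) / 2) := by
    intro y hy
    rw [← integral_const_mul, ← intervalIntegral.integral_of_le hy,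
      intervalIntegral.integral_eq_sub_of_hasDerivAt (fun x _ => hderiv x)
        ((hcont.const_mul c).intervalIntegrable _ _)]
    have : (1 - -q / q) / 2 = 1 := by field_simp; norm_num
    rw [this, binomCdf_one hk, sub_zero]
  refine ⟨c, fun y hy => ?_, ?_⟩
  · rw [← hint y hy.1]
    congr 1
    unfold betaKernel
    rw [setIntegral_indicator measurableSet_Ioo]
    congr 2
    ext x
    simp only [Set.mem_inter_iff, Set.mem_Iic, Set.mem_Ioo, Set.mem_Ioc]
    exact ⟨fun h => ⟨h.2, h.1, h.2.trans_lt hy.2⟩, fun h => ⟨h.2.1, h.1⟩⟩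
  · have h := hint q (by linarith)
    rw [div_self hq.ne', sub_self, zero_div, binomCdf_zero] at h
    rw [← h]
    unfold betaKernel
    rw [integral_indicator measurableSet_Ioo, integral_Ioc_eq_integral_Ioo]

lemma integrable_betaKernel (q : ℝ) (a b : ℕ) : Integrable (betaKernel q a b) := by
  have hcont : Continuous fun x : ℝ => (1 + x / q) ^ a * (1 - x / q) ^ b := by fun_prop
  unfold betaKernel
  refine IntegrableOn.integrable_indicator ?_ measurableSet_Ioo
  exact (hcont.integrableOn_Icc (a := -q) (b := q)).mono_set Set.Ioo_subset_Icc_self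

end BarrierModel

/-! ### Uniform expansion of the binomial distribution function -/

namespace BarrierModel

/-- Integrated form of `exists_betaKernel_bound`. -/
lemma exists_integral_betaKernel_bound (A : ℝ) :
    ∃ C, 0 ≤ C ∧ ∀ q : ℝ, 4 ≤ q → 2 * A + 2 ≤ q → ∀ (a b : ℕ) (δ : ℝ), |δ| ≤ A →
      (a : ℝ) + b + 1 = q ^ 2 → (a : ℝ) - b = δ * q →
      (∀ y, |φ δ * (∫ x in Set.Iic y, betaKernel q a b x) - betaAnti δ q y| ≤ C / q ^ 4) ∧
      |φ δ * (∫ x, betaKernel q a b x) - (1 + betaMean δ / q ^ 2)| ≤ C / q ^ 4 := by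
  obtain ⟨C, hC0, hC⟩ := exists_betaKernel_bound A
  have hgi := integrable_exp_neg_mul_sq (b := 1 / 8) (by norm_num)
  have hI0 : 0 ≤ ∫ x : ℝ, exp (-(1 / 8) * x ^ 2) := integral_nonneg fun x => (exp_pos _).le
  refine ⟨C * ∫ x : ℝ, exp (-(1 / 8) * x ^ 2), by positivity, ?_⟩
  intro q hq4 hqA a b δ hδ hab hd
  have hq0 : 0 < q := by linarith
  have hk := (integrable_betaKernel q a b).const_mul (φ δ)
  have hdens := integrable_betaDensity δ (q := q) (by linarith)
  have hpt : ∀ x, ‖φ δ * betaKernel q a b x - φ (x - δ) * (1 + betaCorr δ x / q ^ 2)‖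
      ≤ C / q ^ 4 * exp (-(1 / 8) * x ^ 2) := by
    intro x
    have h1 : φ δ * betaKernel q a b x - φ (x - δ) * (1 + betaCorr δ x / q ^ 2)
        = φ δ * (betaKernel q a b x
          - exp (-x ^ 2 / 2 + δ * x) * (1 + betaCorr δ x / q ^ 2)) := by
      rw [φ_sub_eq]; unfold φ; ring
    rw [h1, norm_mul, Real.norm_eq_abs, Real.norm_eq_abs, abs_of_pos (φ_pos _)]
    calc _ ≤ 1 * |betaKernel q a b x
            - exp (-x ^ 2 / 2 + δ * x) * (1 + betaCorr δ x / q ^ 2)| :=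
          mul_le_mul_of_nonneg_right (φ_le_one _) (abs_nonneg _)
      _ ≤ _ := by rw [one_mul]; exact hC q hq4 hqA a b δ hδ hab hd x
  have hset : ∀ s : Set ℝ, |(∫ x in s, φ δ * betaKernel q a b x)
      - ∫ x in s, φ (x - δ) * (1 + betaCorr δ x / q ^ 2)|
      ≤ C * (∫ x : ℝ, exp (-(1 / 8) * x ^ 2)) / q ^ 4 := by
    intro s
    rw [← integral_sub hk.integrableOn hdens.integrableOn, ← Real.norm_eq_abs]
    calc _ ≤ ∫ x in s, C / q ^ 4 * exp (-(1 / 8) * x ^ 2) :=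
          norm_integral_le_of_norm_le (hgi.const_mul _).integrableOn (ae_of_all _ hpt)
      _ ≤ ∫ x, C / q ^ 4 * exp (-(1 / 8) * x ^ 2) :=
          setIntegral_le_integral (hgi.const_mul _) (ae_of_all _ fun x => by positivity)
      _ = _ := by rw [integral_const_mul]; ring
  constructor
  · intro y
    have h := hset (Set.Iic y)
    rw [integral_const_mul, integral_Iic_of_hasDerivAt_of_tendsto'
      (fun x _ => hasDerivAt_betaAnti δ q x) hdens.integrableOn (tendsto_betaAnti_atBot δ q),
      sub_zero] at h
    exact h
  · have h := hset Set.univ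
    rw [setIntegral_univ, setIntegral_univ, integral_const_mul, integral_of_hasDerivAt_of_tendsto
      (hasDerivAt_betaAnti δ q) hdens (tendsto_betaAnti_atBot δ q) (tendsto_betaAnti_atTop δ q),
      sub_zero] at h
    exact h

/-- Expansion of the binomial distribution function in the central region, with an error that is
uniform in the position. -/
theorem exists_binomCdf_bound (A : ℝ) :
    ∃ C, ∃ q₀ : ℝ, ∀ n k : ℕ, q₀ ≤ √(n : ℝ) → k < n → ∀ y δ : ℝ, |y| ≤ A → |δ| ≤ A →
      δ * √(n : ℝ) = n - 1 - 2 * k →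
      |binomCdf n k ((1 - y / √(n : ℝ)) / 2) - (Φ (y - δ) + φ (y - δ) * betaPoly δ y / n)|
        ≤ C / (n : ℝ) ^ 2 := by
  obtain ⟨C, hC0, hC⟩ := exists_integral_betaKernel_bound A
  obtain ⟨D, hD1, hDm, hDp⟩ : ∃ D : ℝ, 1 ≤ D ∧ (∀ δ, |δ| ≤ A → |betaMean δ| ≤ D) ∧
      ∀ y δ, |y| ≤ A → |δ| ≤ A → |betaPoly δ y| ≤ D := by
    have hK : IsCompact (Set.Icc (-A) A ×ˢ Set.Icc (-A) A) := isCompact_Icc.prod isCompact_Icc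
    obtain ⟨D₁, hD₁⟩ := (isCompact_Icc (a := -A) (b := A)).exists_bound_of_continuousOn
      (f := betaMean) (by unfold betaMean; fun_prop)
    obtain ⟨D₂, hD₂⟩ := hK.exists_bound_of_continuousOn
      (f := fun x : ℝ × ℝ => betaPoly x.1 x.2) (by unfold betaPoly; fun_prop)
    refine ⟨max 1 (max D₁ D₂), le_max_left _ _, fun δ hδ => ?_, fun y δ hy hδ => ?_⟩
    · exact (hD₁ δ (abs_le.1 hδ)).trans ((le_max_left _ _).trans (le_max_right _ _))
    · exact (hD₂ (δ, y) ⟨abs_le.1 hδ, abs_le.1 hy⟩).trans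
        ((le_max_right _ _).trans (le_max_right _ _))
  -- The threshold `4(D + C)` keeps the scaled total mass `φ δ * J` above `1/2`; dividing by it
  -- accounts for the leading factor `2`.
  refine ⟨2 * (C + C * (1 + D) + D * D), max 4 (max (2 * A + 2) (4 * (D + C))), ?_⟩
  intro n k hn hk y δ hy hδ hkδ
  set q := √(n : ℝ) with hq
  have hq4 : 4 ≤ q := (le_max_left _ _).trans hn
  have hqA : 2 * A + 2 ≤ q := (le_max_left _ _).trans ((le_max_right _ _).trans hn)
  have hqD : 4 * (D + C) ≤ q := (le_max_right _ _).trans ((le_max_right _ _).trans hn)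
  have hq0 : 0 < q := by linarith
  have hA : 0 ≤ A := (abs_nonneg _).trans hy
  have hq2 : q ^ 2 = n := sq_sqrt n.cast_nonneg
  have hn4 : (n : ℝ) ^ 2 = q ^ 4 := by rw [← hq2]; ring
  have ha : ((n - 1 - k : ℕ) : ℝ) = n - 1 - k := by
    rw [Nat.cast_sub (by omega), Nat.cast_sub (by omega)]; simp
  obtain ⟨h1, h2⟩ := hC q hq4 hqA (n - 1 - k) k δ hδ (by rw [ha, hq2]; ring)
    (by rw [ha, hkδ]; ring)
  obtain ⟨c, hc1, hc2⟩ := binomCdf_eq_mul_integral hk hq0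
  have hy' := abs_le.1 hy
  have h3 := hc1 y ⟨by linarith, by linarith⟩
  have h1 := h1 y
  rw [h3, hn4, ← hq2]
  set I := ∫ x in Set.Iic y, betaKernel q (n - 1 - k) k x
  set J := ∫ x, betaKernel q (n - 1 - k) k x
  set e₁ := φ δ * I - betaAnti δ q y with he₁
  set e₂ := φ δ * J - (1 + betaMean δ / q ^ 2) with he₂
  set W := Φ (y - δ) + φ (y - δ) * betaPoly δ y / q ^ 2 with hW
  have hq1 : 1 ≤ q ^ 2 := one_le_pow₀ (by linarith)
  have hmean : |betaMean δ / q ^ 2| ≤ 1 / 4 := by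
    rw [abs_div, abs_of_pos (by positivity : 0 < q ^ 2), div_le_iff₀ (by positivity)]
    have := hDm δ hδ
    nlinarith
  have he₂' : |e₂| ≤ 1 / 4 := by
    refine h2.trans ?_
    rw [div_le_iff₀ (by positivity)]
    have : q ≤ q ^ 4 := le_self_pow₀ (by linarith) (by norm_num)
    linarith
  have hZ : 1 / 2 ≤ φ δ * J := by
    have := (abs_le.1 hmean).1
    have := (abs_le.1 he₂').1
    rw [show φ δ * J = e₂ + (1 + betaMean δ / q ^ 2) by rw [he₂]; ring]
    linarith
  have hpoly : |φ (y - δ) * betaPoly δ y| ≤ D := by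
    rw [abs_mul, abs_of_pos (φ_pos _)]
    calc _ ≤ 1 * D := mul_le_mul (φ_le_one _) (hDp y δ hy hδ) (abs_nonneg _) zero_le_one
      _ = D := one_mul D
  have hW1 : |W| ≤ 1 + D := by
    refine (abs_add_le _ _).trans (add_le_add ?_ ?_)
    · rw [abs_of_nonneg (Φ_nonneg _)]; exact Φ_le_one _
    · rw [abs_div, abs_of_pos (by positivity : 0 < q ^ 2), div_le_iff₀ (by positivity)]
      exact hpoly.trans (le_mul_of_one_le_right (by linarith) hq1)
  -- Since `c * J = 1`, the distribution function is `I / J`. Multiplied out, the `betaMean` term in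
  -- the numerator is cancelled by the normalisation up to order `q⁻⁴`.
  have hnum : (c * I - W) * (φ δ * J)
      = e₁ - e₂ * W - betaMean δ * (φ (y - δ) * betaPoly δ y) / q ^ 4 := by
    have hcI : c * I * (φ δ * J) = φ δ * I := by
      calc c * I * (φ δ * J) = (c * J) * (φ δ * I) := by ring
        _ = _ := by rw [← hc2, one_mul]
    rw [sub_mul, hcI, show φ δ * J = e₂ + (1 + betaMean δ / q ^ 2) by rw [he₂]; ring,
      show φ δ * I = e₁ + betaAnti δ q y by rw [he₁]; ring, betaAnti, hW]
    field_simp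
    ring
  have hnumb : |(c * I - W) * (φ δ * J)| ≤ (C + C * (1 + D) + D * D) / q ^ 4 := by
    rw [hnum]
    have t1 : |e₂ * W| ≤ C / q ^ 4 * (1 + D) := by
      rw [abs_mul]; exact mul_le_mul h2 hW1 (abs_nonneg _) (by positivity)
    have t2 : |betaMean δ * (φ (y - δ) * betaPoly δ y) / q ^ 4| ≤ D * D / q ^ 4 := by
      rw [abs_div, abs_of_pos (by positivity : 0 < q ^ 4), abs_mul]
      exact div_le_div_of_nonneg_right
        (mul_le_mul (hDm δ hδ) hpoly (abs_nonneg _) (by linarith)) (by positivity)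
    calc _ ≤ |e₁| + |e₂ * W| + |betaMean δ * (φ (y - δ) * betaPoly δ y) / q ^ 4| :=
          (abs_sub _ _).trans (add_le_add_left (abs_sub _ _) _)
      _ ≤ C / q ^ 4 + C / q ^ 4 * (1 + D) + D * D / q ^ 4 := add_le_add (add_le_add h1 t1) t2
      _ = _ := by ring
  rw [abs_mul, abs_of_pos (by linarith : 0 < φ δ * J)] at hnumb
  have h5 := mul_le_mul_of_nonneg_left hZ (abs_nonneg (c * I - W))
  rw [mul_div_assoc]
  linarith

end BarrierModel

namespace BarrierModel

/-! ### Asymptotic expansions in powers of `1 / √n` with bounded coefficients -/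

/-- The scale `1 / √n`. -/
def invSqrt (n : ℕ) : ℝ := (√(n : ℝ))⁻¹

lemma tendsto_invSqrt : Tendsto invSqrt atTop (𝓝 0) :=
  tendsto_inv_atTop_zero.comp (tendsto_sqrt_atTop.comp tendsto_natCast_atTop_atTop)

lemma invSqrt_isBigO_one : invSqrt =O[atTop] fun _ => (1 : ℝ) := tendsto_invSqrt.isBigO_one ℝ

lemma invSqrt_pow_isBigO {j k : ℕ} (h : j ≤ k) :
    (fun n => invSqrt n ^ k) =O[atTop] fun n => invSqrt n ^ j := by
  obtain ⟨i, rfl⟩ := Nat.exists_eq_add_of_le h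
  have := (isBigO_refl (fun n => invSqrt n ^ j) atTop).mul (invSqrt_isBigO_one.pow i)
  simpa only [one_pow, mul_one, pow_add] using this

lemma invSqrt_pow_three (n : ℕ) : invSqrt n ^ 3 = (n : ℝ) ^ (-(3 / 2 : ℝ)) := by
  rw [invSqrt, rpow_neg n.cast_nonneg, inv_pow, sqrt_eq_rpow, ← rpow_natCast,
    ← rpow_mul n.cast_nonneg]
  norm_num

lemma invSqrt_sq (n : ℕ) : invSqrt n ^ 2 = 1 / (n : ℝ) := by
  rw [invSqrt, inv_pow, sq_sqrt n.cast_nonneg, one_div]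

lemma sqrt_mul_invSqrt {n : ℕ} (hn : 0 < n) : √(n : ℝ) * invSqrt n = 1 := by
  have : 0 < √(n : ℝ) := sqrt_pos.2 (by exact_mod_cast hn)
  rw [invSqrt, mul_inv_cancel₀ this.ne']

/-- `f n = a + b n / √n + c n / n + O(n ^ (-3 / 2))`, the sequences `b` and `c` being bounded. -/
structure HasExpansion (f : ℕ → ℝ) (a : ℝ) (b c : ℕ → ℝ) : Prop where
  bdd₁ : b =O[atTop] fun _ => (1 : ℝ)
  bdd₂ : c =O[atTop] fun _ => (1 : ℝ)
  err : (fun n => f n - (a + b n * invSqrt n + c n * invSqrt n ^ 2))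
    =O[atTop] fun n => invSqrt n ^ 3

namespace HasExpansion

variable {f g : ℕ → ℝ} {a a' : ℝ} {b c b' c' : ℕ → ℝ}

lemma of_eventually (hb : b =O[atTop] fun _ => (1 : ℝ)) (hc : c =O[atTop] fun _ => (1 : ℝ))
    (h : ∀ᶠ n in atTop, f n = a + b n * invSqrt n + c n * invSqrt n ^ 2) :
    HasExpansion f a b c := by
  refine ⟨hb, hc, (isBigO_zero _ _).congr' ?_ EventuallyEq.rfl⟩
  filter_upwards [h] with n hn
  rw [hn, sub_self]

lemma congr' (h : HasExpansion f a b c) (hfg : ∀ᶠ n in atTop, f n = g n) :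
    HasExpansion g a b c := by
  refine ⟨h.bdd₁, h.bdd₂, h.err.congr' ?_ EventuallyEq.rfl⟩
  filter_upwards [hfg] with n hn
  rw [hn]

lemma const (a : ℝ) : HasExpansion (fun _ => a) a (fun _ => 0) (fun _ => 0) :=
  of_eventually (isBigO_zero _ _) (isBigO_zero _ _) (by simp)

lemma add (hf : HasExpansion f a b c) (hg : HasExpansion g a' b' c') :
    HasExpansion (fun n => f n + g n) (a + a') (fun n => b n + b' n) (fun n => c n + c' n) :=
  ⟨hf.bdd₁.add hg.bdd₁, hf.bdd₂.add hg.bdd₂, (hf.err.add hg.err).congr_left fun n => by ring⟩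

lemma neg (hf : HasExpansion f a b c) :
    HasExpansion (fun n => -f n) (-a) (fun n => -b n) (fun n => -c n) :=
  ⟨hf.bdd₁.neg_left, hf.bdd₂.neg_left, hf.err.neg_left.congr_left fun n => by ring⟩

lemma sub (hf : HasExpansion f a b c) (hg : HasExpansion g a' b' c') :
    HasExpansion (fun n => f n - g n) (a - a') (fun n => b n - b' n) (fun n => c n - c' n) :=
  ⟨hf.bdd₁.sub hg.bdd₁, hf.bdd₂.sub hg.bdd₂, (hf.err.sub hg.err).congr_left fun n => by ring⟩

lemma sub_linear_isBigO (hf : HasExpansion f a b c) :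
    (fun n => f n - (a + b n * invSqrt n)) =O[atTop] fun n => invSqrt n ^ 2 := by
  have h1 : (fun n => c n * invSqrt n ^ 2) =O[atTop] fun n => invSqrt n ^ 2 := by
    simpa only [one_mul] using hf.bdd₂.mul (isBigO_refl (fun n => invSqrt n ^ 2) atTop)
  exact ((hf.err.trans (invSqrt_pow_isBigO (by norm_num))).add h1).congr_left fun n => by ring

lemma sub_const_isBigO (hf : HasExpansion f a b c) :
    (fun n => f n - a) =O[atTop] invSqrt := by
  have h1 : (fun n => b n * invSqrt n) =O[atTop] invSqrt := by
    simpa only [one_mul] using hf.bdd₁.mul (isBigO_refl invSqrt atTop)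
  have h2 : (fun n => invSqrt n ^ 2) =O[atTop] invSqrt := by
    simpa only [pow_one] using invSqrt_pow_isBigO (j := 1) (k := 2) (by norm_num)
  exact ((hf.sub_linear_isBigO.trans h2).add h1).congr_left fun n => by ring

lemma tendsto (hf : HasExpansion f a b c) : Tendsto f atTop (𝓝 a) := by
  have := (hf.sub_const_isBigO.trans_tendsto tendsto_invSqrt).add_const a
  simpa only [sub_add_cancel, zero_add] using this

lemma isBigO_one (hf : HasExpansion f a b c) : f =O[atTop] fun _ => (1 : ℝ) :=
  hf.tendsto.isBigO_one ℝ

lemma mul (hf : HasExpansion f a b c) (hg : HasExpansion g a' b' c') :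
    HasExpansion (fun n => f n * g n) (a * a') (fun n => a * b' n + b n * a')
      (fun n => a * c' n + b n * b' n + c n * a') := by
  have m1 := hf.bdd₁.mul hg.bdd₁
  have m2 := hf.bdd₁.mul hg.bdd₂
  have m3 := hf.bdd₂.mul hg.bdd₁
  have m4 := hf.bdd₂.mul hg.bdd₂
  simp only [mul_one] at m1 m2 m3 m4
  refine ⟨(hg.bdd₁.const_mul_left a).add ((hf.bdd₁.const_mul_left a').congr_left
    fun n => mul_comm _ _), ((hg.bdd₂.const_mul_left a).add m1).add
    ((hf.bdd₂.const_mul_left a').congr_left fun n => mul_comm _ _), ?_⟩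
  have e1 : (fun n => (f n - (a + b n * invSqrt n + c n * invSqrt n ^ 2)) * g n)
      =O[atTop] fun n => invSqrt n ^ 3 := by
    simpa only [mul_one] using hf.err.mul hg.isBigO_one
  have hp : (fun n => a + b n * invSqrt n + c n * invSqrt n ^ 2) =O[atTop] fun _ => (1 : ℝ) := by
    refine ((isBigO_const_const a one_ne_zero _).add ?_).add ?_
    · simpa only [mul_one] using hf.bdd₁.mul invSqrt_isBigO_one
    · simpa only [mul_one, one_pow] using hf.bdd₂.mul (invSqrt_isBigO_one.pow 2)
  have e2 : (fun n => (a + b n * invSqrt n + c n * invSqrt n ^ 2)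
      * (g n - (a' + b' n * invSqrt n + c' n * invSqrt n ^ 2)))
      =O[atTop] fun n => invSqrt n ^ 3 := by
    simpa only [one_mul] using hp.mul hg.err
  have e3 : (fun n => (b n * c' n + c n * b' n) * invSqrt n ^ 3)
      =O[atTop] fun n => invSqrt n ^ 3 := by
    simpa only [one_mul] using (m2.add m3).mul (isBigO_refl (fun n => invSqrt n ^ 3) atTop)
  have e4 : (fun n => (c n * c' n) * invSqrt n ^ 4) =O[atTop] fun n => invSqrt n ^ 3 := by
    simpa only [one_mul] using m4.mul (invSqrt_pow_isBigO (j := 3) (k := 4) (by norm_num))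
  exact (((e1.add e2).add e3).add e4).congr_left fun n => by ring

/-- Composition with a function that has a Taylor expansion of order two. -/
lemma comp (hf : HasExpansion f a b c) {G : ℝ → ℝ} {g₀ g₁ g₂ : ℝ}
    (hG : (fun t => G t - (g₀ + g₁ * (t - a) + g₂ * (t - a) ^ 2))
      =O[𝓝 a] fun t => (t - a) ^ 3) :
    HasExpansion (fun n => G (f n)) g₀ (fun n => g₁ * b n)
      (fun n => g₁ * c n + g₂ * b n ^ 2) := by
  have hb2 : (fun n => b n ^ 2) =O[atTop] fun _ => (1 : ℝ) := by
    simpa only [one_pow] using hf.bdd₁.pow 2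
  refine ⟨hf.bdd₁.const_mul_left _, (hf.bdd₂.const_mul_left _).add (hb2.const_mul_left _), ?_⟩
  have e1 := (hG.comp_tendsto hf.tendsto).trans (hf.sub_const_isBigO.pow 3)
  have e2 := hf.err.const_mul_left g₁
  have hbh : (fun n => b n * invSqrt n) =O[atTop] invSqrt := by
    simpa only [one_mul] using hf.bdd₁.mul (isBigO_refl invSqrt atTop)
  -- Difference of squares: `(f - a)² - (b/√n)²` has one factor of order `1/n` and one of order
  -- `1/√n`.
  have e3 : (fun n => g₂ * ((f n - (a + b n * invSqrt n)) * (f n - a + b n * invSqrt n)))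
      =O[atTop] fun n => invSqrt n ^ 3 := by
    refine ((hf.sub_linear_isBigO.mul (hf.sub_const_isBigO.add hbh)).const_mul_left g₂).congr_right
      fun n => by ring
  refine ((e1.add e2).add e3).congr_left fun n => ?_
  simp only [Function.comp_apply]
  ring

end HasExpansion

/-- A bound on the derivative near a point gives a bound on the increment. -/
lemma isBigO_of_hasDerivAt {G G' : ℝ → ℝ} {a : ℝ} {k : ℕ} (hG : ∀ t, HasDerivAt G (G' t) t)
    (ha : G a = 0) (h : G' =O[𝓝 a] fun t => (t - a) ^ k) :
    G =O[𝓝 a] fun t => (t - a) ^ (k + 1) := by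
  obtain ⟨C, hC0, hC⟩ := h.exists_nonneg
  obtain ⟨ε, hε, hball⟩ := Metric.eventually_nhds_iff_ball.1 hC.bound
  refine IsBigO.of_bound C ?_
  filter_upwards [Metric.ball_mem_nhds a hε] with t ht
  have hsub : ∀ x ∈ Set.uIcc a t, ‖G' x‖ ≤ C * ‖t - a‖ ^ k := by
    intro x hx
    have hxt : |x - a| ≤ |t - a| := Set.abs_sub_left_of_mem_uIcc hx
    have hxb : x ∈ Metric.ball a ε := by
      rw [Metric.mem_ball, Real.dist_eq] at ht ⊢
      exact hxt.trans_lt ht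
    refine (hball x hxb).trans ?_
    rw [norm_pow]
    gcongr
    exact hxt
  have := (convex_uIcc a t).norm_image_sub_le_of_norm_hasDerivWithin_le
    (fun x _ => (hG x).hasDerivWithinAt) hsub Set.left_mem_uIcc Set.right_mem_uIcc
  rw [ha, sub_zero] at this
  rw [norm_pow, pow_succ, ← mul_assoc]
  exact this

/-- Differentiating the remainder gives the first-order Taylor remainder of `φ`, and differentiating
again gives an increment of `φ'`; two applications of `isBigO_of_hasDerivAt` raise the order from
one to three. -/
lemma taylor_Φ (a : ℝ) :
    (fun t => Φ t - (Φ a + φ a * (t - a) + (-a * φ a / 2) * (t - a) ^ 2))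
      =O[𝓝 a] fun t => (t - a) ^ 3 := by
  have hd : ∀ t, HasDerivAt (fun t => φ t - φ a - (-a * φ a) * (t - a))
      (-t * φ t - (-a * φ a)) t := by
    intro t
    have h1 : HasDerivAt (fun t : ℝ => (-a * φ a) * (t - a)) (-a * φ a * 1) t :=
      ((hasDerivAt_id t).sub_const a).const_mul _
    refine (((hasDerivAt_φ t).sub_const (φ a)).sub h1).congr_deriv (by ring)
  have h1 : (fun t => -t * φ t - (-a * φ a)) =O[𝓝 a] fun t => (t - a) ^ 1 := by
    have : DifferentiableAt ℝ (fun t => -t * φ t) a :=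
      differentiableAt_id.neg.mul (hasDerivAt_φ a).differentiableAt
    simpa only [pow_one] using this.isBigO_sub
  have h2 := isBigO_of_hasDerivAt hd (by simp) h1
  refine isBigO_of_hasDerivAt (k := 2) (fun t => ?_) (by simp) h2
  have hid : HasDerivAt (fun t : ℝ => t - a) 1 t := (hasDerivAt_id t).sub_const a
  have h3 := ((hid.const_mul (φ a)).const_add (Φ a)).add ((hid.pow 2).const_mul (-a * φ a / 2))
  refine ((hasDerivAt_Φ t).sub h3).congr_deriv ?_
  norm_num
  ring

lemma taylor_exp (a : ℝ) :
    (fun t => exp t - (exp a + exp a * (t - a) + (exp a / 2) * (t - a) ^ 2))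
      =O[𝓝 a] fun t => (t - a) ^ 3 := by
  have h1 := Real.exp_sub_sum_range_isBigO_pow 3
  have htend : Tendsto (fun t : ℝ => t - a) (𝓝 a) (𝓝 0) := by
    have : Continuous fun t : ℝ => t - a := by fun_prop
    simpa using this.tendsto a
  have h2 := ((h1.comp_tendsto htend).const_mul_left (exp a))
  refine h2.congr_left fun t => ?_
  simp only [Function.comp_apply, Finset.sum_range_succ, Finset.sum_range_zero]
  rw [mul_sub, ← exp_add, add_sub_cancel]
  norm_num
  ring

end BarrierModel

/-! ### Expansions along the tree: distribution function, probability, likelihood ratio -/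

namespace BarrierModel

lemma HasExpansion.add_isBigO {f e : ℕ → ℝ} {a : ℝ} {b c : ℕ → ℝ} (hf : HasExpansion f a b c)
    (he : e =O[atTop] fun n => invSqrt n ^ 3) : HasExpansion (fun n => f n + e n) a b c :=
  ⟨hf.bdd₁, hf.bdd₂, (hf.err.add he).congr_left fun n => by ring⟩

lemma HasExpansion.congr_coeff {f : ℕ → ℝ} {a a' : ℝ} {b c b' c' : ℕ → ℝ}
    (hf : HasExpansion f a b c) (ha : a = a') (hb : ∀ n, b n = b' n) (hc : ∀ n, c n = c' n) :
    HasExpansion f a' b' c' := by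
  rw [← ha, ← funext hb, ← funext hc]
  exact hf

/-- Expansion of the binomial distribution function along a sequence of positions. -/
theorem HasExpansion.binomCdf {y s : ℕ → ℝ} {y₀ y₂ δ₀ : ℝ}
    (hy : HasExpansion y y₀ (fun _ => 0) (fun _ => y₂)) (hs : s =O[atTop] fun _ => (1 : ℝ))
    {k : ℕ → ℕ} (hk : ∀ᶠ n in atTop, k n < n)
    (hkδ : ∀ᶠ n : ℕ in atTop, (δ₀ + s n * invSqrt n) * √(n : ℝ) = n - 1 - 2 * k n) :
    HasExpansion (fun n => binomCdf n (k n) ((1 - y n / √(n : ℝ)) / 2)) (Φ (y₀ - δ₀))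
      (fun n => -(φ (y₀ - δ₀) * s n))
      (fun n => φ (y₀ - δ₀) * y₂ - (y₀ - δ₀) * φ (y₀ - δ₀) / 2 * s n ^ 2
        + φ (y₀ - δ₀) * betaPoly δ₀ y₀) := by
  set δ : ℕ → ℝ := fun n => δ₀ + s n * invSqrt n with hδdef
  have hδ : HasExpansion δ δ₀ s (fun _ => 0) :=
    HasExpansion.of_eventually hs (isBigO_zero _ _) (Eventually.of_forall fun n => by simp [δ])
  have hΦ := (hy.sub hδ).comp (taylor_Φ (y₀ - δ₀))
  -- This term already carries `1/n`, so freezing its arguments at their limits costs only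
  -- `O(n^(-3/2))`; differentiability at the limit point suffices.
  have hW : HasExpansion (fun n => φ (y n - δ n) * betaPoly (δ n) (y n) / n) 0 (fun _ => 0)
      (fun _ => φ (y₀ - δ₀) * betaPoly δ₀ y₀) := by
    refine ⟨isBigO_zero _ _, isBigO_const_const _ one_ne_zero _, ?_⟩
    have hdiff : DifferentiableAt ℝ
        (fun x : ℝ × ℝ => φ (x.1 - x.2) * betaPoly x.2 x.1) (y₀, δ₀) := by
      have h1 : Differentiable ℝ φ := fun x => (hasDerivAt_φ x).differentiableAt
      have h2 : Differentiable ℝ fun x : ℝ × ℝ => φ (x.1 - x.2) := by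
        exact h1.comp (by fun_prop)
      refine h2.differentiableAt.mul ?_
      unfold betaPoly
      fun_prop
    have h1 := hdiff.isBigO_sub.comp_tendsto (hy.tendsto.prodMk_nhds hδ.tendsto)
    have h2 : ((fun x : ℝ × ℝ => x - (y₀, δ₀)) ∘ fun n => (y n, δ n)) =O[atTop] invSqrt :=
      (hy.sub_const_isBigO.prod_left hδ.sub_const_isBigO)
    have h3 := (h1.trans h2).mul (isBigO_refl (fun n => invSqrt n ^ 2) atTop)
    refine (h3.congr_right fun n => by ring).congr_left fun n => ?_
    simp only [Function.comp_apply, invSqrt_sq]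
    ring
  obtain ⟨A, hA⟩ : ∃ A : ℝ, ∀ᶠ n in atTop, |y n| ≤ A ∧ |δ n| ≤ A := by
    obtain ⟨A₁, h1⟩ := hy.isBigO_one.bound
    obtain ⟨A₂, h2⟩ := hδ.isBigO_one.bound
    refine ⟨max A₁ A₂, ?_⟩
    filter_upwards [h1, h2] with n h1 h2
    simp only [norm_one, mul_one, Real.norm_eq_abs] at h1 h2
    exact ⟨h1.trans (le_max_left _ _), h2.trans (le_max_right _ _)⟩
  obtain ⟨C, q₀, hC⟩ := exists_binomCdf_bound A
  have herr : (fun n => BarrierModel.binomCdf n (k n) ((1 - y n / √(n : ℝ)) / 2)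
      - (Φ (y n - δ n) + φ (y n - δ n) * betaPoly (δ n) (y n) / n))
      =O[atTop] fun n => invSqrt n ^ 3 := by
    refine IsBigO.trans (IsBigO.of_bound C ?_) (invSqrt_pow_isBigO (by norm_num : 3 ≤ 4))
    have hq : ∀ᶠ n : ℕ in atTop, q₀ ≤ √(n : ℝ) :=
      (tendsto_sqrt_atTop.comp tendsto_natCast_atTop_atTop).eventually_ge_atTop q₀
    filter_upwards [hq, hA, hk, hkδ] with n h1 h2 h3 h4
    refine (hC n (k n) h1 h3 (y n) (δ n) h2.1 h2.2 h4).trans (le_of_eq ?_)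
    have : invSqrt n ^ 4 = 1 / (n : ℝ) ^ 2 := by
      rw [show invSqrt n ^ 4 = (invSqrt n ^ 2) ^ 2 by ring, invSqrt_sq, div_pow, one_pow]
    rw [this, Real.norm_of_nonneg (by positivity)]
    ring
  refine (((hΦ.add hW).add_isBigO herr).congr' (Eventually.of_forall fun n => by ring)).congr_coeff
    (by ring) (fun n => by ring) (fun n => by ring)

/-! ### The risk-neutral probability -/

variable (M : BarrierModel)

/-- The rescaled position of the risk-neutral probability. -/
def probPos (n : ℕ) : ℝ := (1 - 2 * M.prob n) * √(n : ℝ)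

lemma prob_eq {n : ℕ} (hn : 0 < n) : M.prob n = (1 - M.probPos n / √(n : ℝ)) / 2 := by
  have : 0 < √(n : ℝ) := sqrt_pos.2 (by exact_mod_cast hn)
  unfold probPos
  rw [mul_div_cancel_right₀ _ this.ne']
  ring

lemma sqrt_dt (hT : 0 < M.T) (n : ℕ) : √(M.dt n) = √M.T * invSqrt n := by
  rw [dt, sqrt_div hT.le, invSqrt, div_eq_mul_inv]

/-- The relation between the tree parameters that defines the first two coefficients of the
risk-neutral probability. -/
lemma prob_defect_isBigO (hσ : 0 < M.σ) :
    (fun x : ℝ => exp (M.σ * x) + exp (-(M.σ * x)) - 2 * exp (M.r * x ^ 2)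
      + (2 * M.α * x + 2 * M.β * x ^ 3) * (exp (M.σ * x) - exp (-(M.σ * x))))
      =O[𝓝 0] fun x => x ^ 5 := by
  have hlin : ∀ c : ℝ, Tendsto (fun x : ℝ => c * x) (𝓝 0) (𝓝 0) := by
    intro c
    have : Continuous fun x : ℝ => c * x := by fun_prop
    simpa using this.tendsto 0
  have hsq : Tendsto (fun x : ℝ => M.r * x ^ 2) (𝓝 0) (𝓝 0) := by
    have : Continuous fun x : ℝ => M.r * x ^ 2 := by fun_prop
    simpa using this.tendsto 0
  have hexp : ∀ c : ℝ, (fun x : ℝ => exp (c * x)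
      - (1 + c * x + (c * x) ^ 2 / 2 + (c * x) ^ 3 / 6 + (c * x) ^ 4 / 24))
      =O[𝓝 0] fun x => x ^ 5 := by
    intro c
    have h := (Real.exp_sub_sum_range_isBigO_pow 5).comp_tendsto (hlin c)
    have h' : ((fun x : ℝ => x ^ 5) ∘ fun x => c * x) =O[𝓝 0] fun x : ℝ => x ^ 5 :=
      ((isBigO_refl (fun x : ℝ => x ^ 5) (𝓝 0)).const_mul_left (c ^ 5)).congr_left
        fun x => by simp only [Function.comp_apply]; ring
    refine (h.trans h').congr_left fun x => ?_
    simp only [Function.comp_apply, Finset.sum_range_succ, Finset.sum_range_zero, Nat.factorial]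
    norm_num
  have hp : (fun x : ℝ => x ^ 6) =O[𝓝 0] fun x => x ^ 5 :=
    (isLittleO_pow_pow (by norm_num : 5 < 6)).isBigO
  have hr : (fun x : ℝ => exp (M.r * x ^ 2) - (1 + M.r * x ^ 2 + (M.r * x ^ 2) ^ 2 / 2))
      =O[𝓝 0] fun x => x ^ 5 := by
    have h := (Real.exp_sub_sum_range_isBigO_pow 3).comp_tendsto hsq
    have h' : ((fun x : ℝ => x ^ 3) ∘ fun x => M.r * x ^ 2) =O[𝓝 0] fun x : ℝ => x ^ 5 :=
      (hp.const_mul_left (M.r ^ 3)).congr_left fun x => by simp only [Function.comp_apply]; ring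
    refine (h.trans h').congr_left fun x => ?_
    simp only [Function.comp_apply, Finset.sum_range_succ, Finset.sum_range_zero, Nat.factorial]
    norm_num
  have hbd : (fun x : ℝ => 2 * M.α * x + 2 * M.β * x ^ 3) =O[𝓝 0] fun _ => (1 : ℝ) := by
    have : Continuous fun x : ℝ => 2 * M.α * x + 2 * M.β * x ^ 3 := by fun_prop
    exact (this.tendsto 0).isBigO_one ℝ
  have h1 := hexp M.σ
  have h2 := hexp (-M.σ)
  have h3 := hbd.mul (h1.sub h2)
  simp only [one_mul] at h3
  have h4 := hp.const_mul_left (2 * M.β * M.σ ^ 3 / 3)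
  refine (((h1.add h2).sub (hr.const_mul_left 2)).add (h3.add h4)).congr_left fun x => ?_
  rw [neg_mul]
  -- These two identities make the coefficients of `x²` and `x⁴` vanish; they are what determines
  -- `α` and `β`.
  have hα : 4 * M.α * M.σ = 2 * M.r - M.σ ^ 2 := by unfold α; field_simp; ring
  have hβ : 4 * M.β * M.σ = (M.σ ^ 4 - 4 * M.σ ^ 2 * M.r + 12 * M.r ^ 2) / 12 := by
    unfold β; field_simp; ring
  linear_combination (-x ^ 2 - M.σ ^ 2 * x ^ 4 / 6) * hα - x ^ 4 * hβ

theorem hasExpansion_probPos (hσ : 0 < M.σ) (hT : 0 < M.T) :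
    HasExpansion M.probPos (-2 * M.α * √M.T) (fun _ => 0) (fun _ => -2 * M.β * √M.T ^ 3) := by
  refine ⟨isBigO_zero _ _, isBigO_const_const _ (one_ne_zero) _, ?_⟩
  have hq : 0 < √M.T := sqrt_pos.2 hT
  have hx : Tendsto (fun n => √M.T * invSqrt n) atTop (𝓝 0) := by
    simpa only [mul_zero] using tendsto_invSqrt.const_mul √M.T
  obtain ⟨C, hC0, hC⟩ := ((M.prob_defect_isBigO hσ).comp_tendsto hx).exists_nonneg
  refine IsBigO.of_bound (C * √M.T ^ 4 / (2 * M.σ)) ?_ |>.trans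
    (isBigO_refl (fun n => invSqrt n ^ 3) atTop)
  filter_upwards [hC.bound, eventually_gt_atTop 0] with n hn hn0
  have hs := sqrt_mul_invSqrt hn0
  have hh : 0 < invSqrt n := inv_pos.2 (sqrt_pos.2 (by exact_mod_cast hn0))
  simp only [Function.comp_apply] at hn
  set h := invSqrt n with hhdef
  set x := √M.T * h with hxdef
  have hx0 : 0 < x := by positivity
  have hdt : M.dt n = x ^ 2 := by
    rw [hxdef, mul_pow, sq_sqrt hT.le, hhdef, invSqrt_sq, dt]; ring
  have hD : 2 * M.σ * x ≤ exp (M.σ * x) - exp (-(M.σ * x)) := by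
    have := Real.self_le_sinh_iff.2 (by positivity : 0 ≤ M.σ * x)
    rw [sinh_eq] at this
    linarith
  have hD0 : 0 < exp (M.σ * x) - exp (-(M.σ * x)) := lt_of_lt_of_le (by positivity) hD
  have hprob : M.prob n = (exp (M.r * x ^ 2) - exp (-(M.σ * x)))
      / (exp (M.σ * x) - exp (-(M.σ * x))) := by
    rw [prob, down, up, hdt, sqrt_sq hx0.le, exp_neg]
  have hsq : √(n : ℝ) = 1 / h := by rw [eq_div_iff hh.ne']; exact hs
  -- Here `1 - 2p = (exp (σx) + exp (-σx) - 2 exp (rx²)) / (exp (σx) - exp (-σx))` with `x = √Δτ`,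
  -- so the remainder is the defect over its denominator: order five, minus one from the `sinh`,
  -- minus one from `√n`.
  have key : M.probPos n - (-2 * M.α * √M.T + 0 * h + -2 * M.β * √M.T ^ 3 * h ^ 2)
      = (exp (M.σ * x) + exp (-(M.σ * x)) - 2 * exp (M.r * x ^ 2)
        + (2 * M.α * x + 2 * M.β * x ^ 3) * (exp (M.σ * x) - exp (-(M.σ * x))))
        / ((exp (M.σ * x) - exp (-(M.σ * x))) * h) := by
    rw [probPos, hprob, hsq]
    generalize exp (M.σ * x) = e₁ at *
    generalize exp (-(M.σ * x)) = e₂ at *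
    have hne : e₁ - e₂ ≠ 0 := hD0.ne'
    rw [hxdef]
    field_simp
    ring
  rw [key, norm_div, Real.norm_of_nonneg (by positivity :
    0 ≤ (exp (M.σ * x) - exp (-(M.σ * x))) * h), div_le_iff₀ (by positivity)]
  refine hn.trans ?_
  rw [Real.norm_of_nonneg (by positivity), Real.norm_of_nonneg (by positivity)]
  calc C * x ^ 5 = C * √M.T ^ 4 / (2 * M.σ) * h ^ 3 * (2 * M.σ * x * h) := by
        rw [hxdef]; field_simp
    _ ≤ _ := by gcongr

/-- Expansion of the likelihood ratio at the barrier. -/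
lemma hasExpansion_ratio (hσ : 0 < M.σ) (hT : 0 < M.T) (lam : ℝ) {D : ℕ → ℝ}
    (hD : D =O[atTop] fun _ => (1 : ℝ)) {m : ℕ → ℤ}
    (hm : ∀ᶠ n : ℕ in atTop, (m n : ℝ) = lam * √(n : ℝ) - D n) :
    HasExpansion (fun n => (M.prob n / (1 - M.prob n)) ^ m n) (exp (4 * M.α * lam * √M.T))
      (fun n => exp (4 * M.α * lam * √M.T) * (-4 * M.α * √M.T * D n))
      (fun n => exp (4 * M.α * lam * √M.T) * (lam * (4 * M.β + 16 / 3 * M.α ^ 3) * √M.T ^ 3)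
        + exp (4 * M.α * lam * √M.T) / 2 * (-4 * M.α * √M.T * D n) ^ 2) := by
  have hy := M.hasExpansion_probPos hσ hT
  set y := M.probPos with hydef
  set q := √M.T
  have hyh : Tendsto (fun n => y n * invSqrt n) atTop (𝓝 0) := by
    simpa only [mul_zero] using hy.tendsto.mul tendsto_invSqrt
  have hsmall : ∀ᶠ n in atTop, |y n * invSqrt n| ≤ 1 / 2 := by
    have := hyh.abs
    rw [abs_zero] at this
    filter_upwards [this.eventually (ge_mem_nhds (by norm_num : (0 : ℝ) < 1 / 2))] with n hn
    exact hn
  have hlin : HasExpansion (fun n => lam - D n * invSqrt n) lam (fun n => -D n) (fun _ => 0) :=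
    HasExpansion.of_eventually hD.neg_left (isBigO_zero _ _)
      (Eventually.of_forall fun n => by ring)
  have hh2 : HasExpansion (fun n => invSqrt n ^ 2) 0 (fun _ => 0) (fun _ => 1) :=
    HasExpansion.of_eventually (isBigO_zero _ _) (isBigO_refl _ _)
      (Eventually.of_forall fun n => by ring)
  have hcube := (((hy.mul hy).mul hy).mul hh2)
  -- Apart from the sign, the log-likelihood ratio times `√n` is `2y + (2/3) y³/n`; the next term of
  -- the odd logarithmic series is beyond the required order.
  have hmain := ((HasExpansion.const 2).mul hy).add ((HasExpansion.const (2 / 3)).mul hcube)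
  have herr : (fun n => (log (1 + y n * invSqrt n) - log (1 - y n * invSqrt n)
      - (2 * (y n * invSqrt n) + 2 * (y n * invSqrt n) ^ 3 / 3)) * √(n : ℝ))
      =O[atTop] fun n => invSqrt n ^ 3 := by
    have h5 : (fun n => y n ^ 5 * invSqrt n ^ 4) =O[atTop] fun n => invSqrt n ^ 3 := by
      have := (hy.isBigO_one.pow 5).mul (invSqrt_pow_isBigO (by norm_num : 3 ≤ 4))
      simpa only [one_pow, one_mul] using this
    refine IsBigO.trans (IsBigO.of_bound 4 ?_) h5
    filter_upwards [hsmall, eventually_gt_atTop 0] with n hn hn0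
    have hs := sqrt_mul_invSqrt hn0
    rw [norm_mul, Real.norm_eq_abs, Real.norm_of_nonneg (sqrt_nonneg _)]
    calc _ ≤ 4 * |y n * invSqrt n| ^ 5 * √(n : ℝ) :=
          mul_le_mul_of_nonneg_right (abs_log_sub_log_le hn) (sqrt_nonneg _)
      _ = 4 * ‖y n ^ 5 * invSqrt n ^ 4‖ * (√(n : ℝ) * |invSqrt n|) := by
          rw [norm_mul, norm_pow, norm_pow, Real.norm_eq_abs, Real.norm_eq_abs, abs_mul]; ring
      _ = _ := by
          have hh : 0 ≤ invSqrt n := inv_nonneg.2 (sqrt_nonneg _)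
          rw [abs_of_nonneg hh, hs, mul_one]
  have hprod := (hlin.mul (hmain.add_isBigO herr)).neg.congr_coeff
    (a' := 4 * M.α * lam * q) (b' := fun n => -4 * M.α * q * D n)
    (c' := fun n => lam * (4 * M.β + 16 / 3 * M.α ^ 3) * q ^ 3)
    (by ring) (fun n => by ring) (fun n => by ring)
  have hexp := hprod.comp (taylor_exp _)
  refine hexp.congr' ?_
  filter_upwards [hm, hsmall, eventually_gt_atTop 0] with n hmn hn hn0
  have hs := sqrt_mul_invSqrt hn0
  have hn' := abs_le.1 hn
  have hp : M.prob n = (1 - y n * invSqrt n) / 2 := by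
    rw [M.prob_eq hn0, hydef, invSqrt, div_eq_mul_inv (M.probPos n)]
  have hpos : 0 < M.prob n / (1 - M.prob n) := by
    rw [hp]; exact div_pos (by linarith) (by linarith)
  have hlog : log (M.prob n / (1 - M.prob n))
      = log (1 - y n * invSqrt n) - log (1 + y n * invSqrt n) := by
    rw [← log_div (by linarith) (by linarith), hp]
    congr 1
    have : 1 + y n * invSqrt n ≠ 0 := by linarith
    have h2 : 1 - (1 - y n * invSqrt n) / 2 ≠ 0 := by linarith
    rw [div_eq_div_iff h2 this]
    ring
  rw [← rpow_intCast, rpow_def_of_pos hpos, hlog, hmn]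
  congr 1
  linear_combination (2 * lam * y n + 2 / 3 * lam * invSqrt n ^ 2 * y n ^ 3
    + D n * (log (1 + y n * invSqrt n) - log (1 - y n * invSqrt n))
    - 2 * D n * invSqrt n * y n - 2 / 3 * D n * invSqrt n ^ 3 * y n ^ 3) * hs

end BarrierModel

/-! ### Position of the barrier on the lattice -/

namespace BarrierModel

variable (M : BarrierModel)

/-- The logarithmic distance from the initial price to the barrier, in units of `σ √T`. -/
def barrierPos : ℝ := log (M.L / M.s0) / (M.σ * √M.T)

/-- The logarithmic distance from the strike to the initial price, in units of `σ √T`. -/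
def strikePos : ℝ := log (M.s0 / M.K) / (M.σ * √M.T)

lemma div_sqrt_dt (hT : 0 < M.T) (n : ℕ) (x : ℝ) :
    x / (M.σ * √(M.dt n)) = x / (M.σ * √M.T) * √(n : ℝ) := by
  rw [M.sqrt_dt hT, invSqrt, ← mul_assoc, ← div_div, div_inv_eq_mul]

lemma floor_two_mul_lL (hT : 0 < M.T) (n : ℕ) :
    (⌊2 * M.lL n⌋ : ℝ) = M.barrierPos * √(n : ℝ) + n - M.ΔL n := by
  rw [ΔL, Int.fract, two_mul_lL, M.div_sqrt_dt hT, barrierPos]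
  ring

lemma barrierPos_neg (hL0 : 0 < M.L) (hL : M.L < M.s0) (hσ : 0 < M.σ) (hT : 0 < M.T) :
    M.barrierPos < 0 :=
  div_neg_of_neg_of_pos (log_neg (div_pos hL0 (hL0.trans hL)) ((div_lt_one (hL0.trans hL)).2 hL))
    (mul_pos hσ (sqrt_pos.2 hT))

lemma tendsto_mul_sqrt_add (a : ℝ) :
    Tendsto (fun n : ℕ => a * √(n : ℝ) + n) atTop atTop := by
  have h : Tendsto (fun n : ℕ => √(n : ℝ)) atTop atTop :=
    tendsto_sqrt_atTop.comp tendsto_natCast_atTop_atTop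
  refine (h.atTop_mul_atTop₀ (tendsto_atTop_add_const_left _ a h)).congr fun n => ?_
  linear_combination mul_self_sqrt (Nat.cast_nonneg (α := ℝ) n)

/-- The lower bound `1` makes the `toNat` in both barrier indices exact; the upper bound says that
the walk starts at or above the effective barrier. -/
lemma eventually_floor_two_mul_lL (hL0 : 0 < M.L) (hL : M.L < M.s0) (hσ : 0 < M.σ)
    (hT : 0 < M.T) :
    ∀ᶠ n : ℕ in atTop, 1 ≤ ⌊2 * M.lL n⌋ ∧ ⌊2 * M.lL n⌋ ≤ n := by
  filter_upwards [(tendsto_mul_sqrt_add M.barrierPos).eventually_ge_atTop 1] with n hn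
  have h : 2 * M.lL n = M.barrierPos * √(n : ℝ) + n := by
    rw [two_mul_lL, M.div_sqrt_dt hT, barrierPos]
  refine ⟨Int.le_floor.2 (by rw [h]; exact_mod_cast hn), ?_⟩
  have : M.barrierPos * √(n : ℝ) ≤ 0 :=
    mul_nonpos_of_nonpos_of_nonneg (M.barrierPos_neg hL0 hL hσ hT).le (sqrt_nonneg _)
  have h2 : (⌊2 * M.lL n⌋ : ℝ) ≤ n := (Int.floor_le _).trans (by rw [h]; linarith)
  exact_mod_cast h2

-- Terminal nodes are the lattice points of one parity, so the effective barrier is a node exactly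
-- when `⌊2 l_L⌋` is even.
open Classical in
lemma ε_eq_ite_even (hs : 0 < M.s0) (hσ : 0 < M.σ) (hT : 0 < M.T) {n : ℕ} (hn : 0 < n)
    (h0 : 0 ≤ ⌊2 * M.lL n⌋) (h1 : ⌊2 * M.lL n⌋ ≤ n) :
    M.ε n = if Even ⌊2 * M.lL n⌋ then 1 else 0 := by
  rw [ε]
  refine if_congr ?_ rfl rfl
  have key : ∀ j : ℕ, M.node n n j = M.effectiveBarrier n ↔ 2 * (j : ℤ) = ⌊2 * M.lL n⌋ := by
    intro j
    rw [node, effectiveBarrier, mul_right_inj' hs.ne', exp_eq_exp,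
      mul_left_inj' (M.mesh_pos hσ hT hn).ne', sub_left_inj]
    exact_mod_cast Iff.rfl
  simp only [key]
  constructor
  · rintro ⟨j, -, hj⟩
    exact ⟨j, by omega⟩
  · rintro ⟨m, hm⟩
    exact ⟨m.toNat, by omega, by omega⟩

/-- The largest number of up moves that ends at or below the effective barrier. -/
def belowBarrier (n : ℕ) : ℕ := (⌊2 * M.lL n⌋ / 2).toNat

/-- The largest number of up moves that ends strictly below the effective barrier. -/
def strictlyBelowBarrier (n : ℕ) : ℕ := ((⌊2 * M.lL n⌋ - 1) / 2).toNat

/-- The parity of the barrier enters only through `± ε`; with `ε` in the formula, both parities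
share one expansion. -/
lemma two_mul_belowBarrier (hs : 0 < M.s0) (hσ : 0 < M.σ) (hT : 0 < M.T) {n : ℕ} (hn : 0 < n)
    (h0 : 1 ≤ ⌊2 * M.lL n⌋) (h1 : ⌊2 * M.lL n⌋ ≤ n) :
    2 * (M.belowBarrier n : ℝ) = ⌊2 * M.lL n⌋ - 1 + M.ε n ∧
      2 * (M.strictlyBelowBarrier n : ℝ) = ⌊2 * M.lL n⌋ - 1 - M.ε n := by
  classical
  rw [M.ε_eq_ite_even hs hσ hT hn (by omega) h1, belowBarrier, strictlyBelowBarrier]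
  generalize ⌊2 * M.lL n⌋ = m at *
  split_ifs with hm
  · obtain ⟨a, rfl⟩ := hm
    have e1 : 2 * (((a + a) / 2).toNat : ℤ) = a + a - 1 + 1 := by omega
    have e2 : 2 * (((a + a - 1) / 2).toNat : ℤ) = a + a - 1 - 1 := by omega
    exact ⟨by exact_mod_cast e1, by exact_mod_cast e2⟩
  · obtain ⟨a, rfl⟩ := Int.not_even_iff_odd.1 hm
    have e1 : 2 * (((2 * a + 1) / 2).toNat : ℤ) = 2 * a + 1 - 1 + 0 := by omega
    have e2 : 2 * (((2 * a + 1 - 1) / 2).toNat : ℤ) = 2 * a + 1 - 1 - 0 := by omega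
    exact ⟨by exact_mod_cast e1, by exact_mod_cast e2⟩

lemma isBigO_one_of_abs_le {f : ℕ → ℝ} {C : ℝ} (h : ∀ n, |f n| ≤ C) :
    f =O[atTop] fun _ => (1 : ℝ) :=
  IsBigO.of_bound C (Eventually.of_forall fun n => by simpa using h n)

lemma ΔL_isBigO_one : M.ΔL =O[atTop] fun _ => (1 : ℝ) :=
  isBigO_one_of_abs_le (C := 1) fun n => by
    rw [ΔL, abs_of_nonneg (Int.fract_nonneg _)]; exact (Int.fract_lt_one _).le

lemma ΔK_isBigO_one : M.ΔK =O[atTop] fun _ => (1 : ℝ) :=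
  isBigO_one_of_abs_le (C := 1) fun n => by
    rw [ΔK, abs_le]
    constructor
    · linarith [Int.fract_lt_one (log (M.s0 / M.K) / (2 * M.σ * √(M.dt n)) - (n : ℝ) / 2)]
    · linarith [Int.fract_nonneg (log (M.s0 / M.K) / (2 * M.σ * √(M.dt n)) - (n : ℝ) / 2)]

lemma ε_isBigO_one : M.ε =O[atTop] fun _ => (1 : ℝ) :=
  isBigO_one_of_abs_le (C := 1) fun n => by
    rw [ε]; split_ifs <;> simp

lemma eventually_prob_mem_Ioo (hσ : 0 < M.σ) (hT : 0 < M.T) :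
    ∀ᶠ n in atTop, 0 < M.prob n ∧ M.prob n < 1 := by
  have h : Tendsto (fun n => M.probPos n * invSqrt n) atTop (𝓝 0) := by
    simpa only [mul_zero] using (M.hasExpansion_probPos hσ hT).tendsto.mul tendsto_invSqrt
  filter_upwards [h.eventually (Ioo_mem_nhds (by norm_num : (-1 : ℝ) < 0) one_pos),
    eventually_gt_atTop 0] with n hn hn0
  rw [M.prob_eq hn0, div_eq_mul_inv (M.probPos n)]
  simp only [invSqrt] at hn
  constructor <;> linarith [hn.1, hn.2]

end BarrierModel

/-! ### Matching the coefficients and assembling the prices -/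

namespace BarrierModel

variable (M : BarrierModel)

section Coefficients

variable {M}

lemma two_mul_α_mul_sqrt (hσ : 0 < M.σ) (hT : 0 < M.T) :
    2 * M.α * √M.T = (M.r + M.σ ^ 2 / 2) * M.T / (M.σ * √M.T) - M.σ * √M.T := by
  have hq : 0 < √M.T := sqrt_pos.2 hT
  have hT2 : M.T = √M.T ^ 2 := (sq_sqrt hT.le).symm
  generalize √M.T = q at *
  rw [hT2, α]
  field_simp
  ring

lemma log_div_eq_neg :
    log (M.s0 / M.L) = -log (M.L / M.s0) := by
  rw [← log_inv, inv_div]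

/-- Here and in the next two identities the `d`'s appear, up to sign, as the limits `y₀ - δ₀` at
which the binomial expansions are centred. -/
lemma d32_eq (hσ : 0 < M.σ) (hT : 0 < M.T) :
    M.d32 = 2 * M.α * √M.T - M.barrierPos := by
  rw [two_mul_α_mul_sqrt hσ hT, d32, d31, barrierPos, log_div_eq_neg]
  ring

lemma d42_eq (hσ : 0 < M.σ) (hT : 0 < M.T) :
    M.d42 = 2 * M.α * √M.T + M.barrierPos := by
  rw [two_mul_α_mul_sqrt hσ hT, d42, d41, barrierPos]
  ring

lemma d12_eq (hσ : 0 < M.σ) (hT : 0 < M.T) :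
    M.d12 = 2 * M.α * √M.T + M.strikePos := by
  rw [two_mul_α_mul_sqrt hσ hT, d12, d11, strikePos]
  ring

lemma exp_barrierPos (hs : 0 < M.s0) (hL : 0 < M.L) (hσ : 0 < M.σ) (hT : 0 < M.T) :
    exp (4 * M.α * M.barrierPos * √M.T) = M.R := by
  have hq : 0 < √M.T := sqrt_pos.2 hT
  rw [M.R_eq hσ hs hL, log_div_eq_neg, barrierPos]
  congr 1
  field_simp
  ring

lemma I_eq (hσ : 0 < M.σ) (hT : 0 < M.T) :
    M.I = -(M.barrierPos * (4 * M.β + 16 / 3 * M.α ^ 3) * √M.T ^ 3) := by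
  have hq : 0 < √M.T := sqrt_pos.2 hT
  have hT2 : M.T = √M.T ^ 2 := (sq_sqrt hT.le).symm
  rw [I, log_div_eq_neg, barrierPos]
  generalize √M.T = q at *
  rw [hT2]
  field_simp

/-- With `x = -2α√T` and `δ = d - 2α√T`, the `1/n` coefficient of the binomial distribution
function is `-g d` times the normal density. -/
lemma betaPoly_add_eq_g (hT : 0 < M.T) {d δ : ℝ} (hδ : δ = d - 2 * M.α * √M.T) :
    -2 * M.β * √M.T ^ 3 + betaPoly δ (-2 * M.α * √M.T) = -M.g d := by
  have hT2 : M.T = √M.T ^ 2 := (sq_sqrt hT.le).symm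
  rw [g, betaPoly, hδ]
  generalize √M.T = q at *
  rw [hT2]
  ring

/-- The left side is that of `betaPoly_add_eq_g` at `d = d12`, so `c̃` is `g` at `d12`, written out
in `d11`, `d12` and `r`. -/
lemma betaPoly_add_eq_cTilde (hσ : 0 < M.σ) (hT : 0 < M.T) {δ : ℝ}
    (hδ : δ = M.d12 - 2 * M.α * √M.T) :
    -2 * M.β * √M.T ^ 3 + betaPoly δ (-2 * M.α * √M.T) = -M.cTilde := by
  have hT2 : M.T = √M.T ^ 2 := (sq_sqrt hT.le).symm
  have hd : M.d11 = M.d12 + M.σ * √M.T := by rw [d12]; ring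
  rw [cTilde, betaPoly, hδ, hd]
  generalize √M.T = q at *
  rw [hT2, α, β]
  field_simp
  ring

end Coefficients

/-- For `k = belowBarrier n`, `n - 1 - 2k = n - ⌊2 l_L⌋ - ε`, so `δ` is `-barrierPos` with
fluctuation `ΔL - ε`. -/
theorem hasExpansion_binomCdf_belowBarrier (hL0 : 0 < M.L) (hL : M.L < M.s0) (hσ : 0 < M.σ)
    (hT : 0 < M.T) :
    HasExpansion (fun n => binomCdf n (M.belowBarrier n) (M.prob n)) (1 - Φ M.d32)
      (fun n => -(φ M.d32 * (M.ΔL n - M.ε n)))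
      (fun n => φ M.d32 * (M.d32 / 2 * (M.ΔL n - M.ε n) ^ 2 - M.g M.d32)) := by
  have hs := hL0.trans hL
  have h := (M.hasExpansion_probPos hσ hT).binomCdf (M.ΔL_isBigO_one.sub M.ε_isBigO_one)
    (k := M.belowBarrier) (δ₀ := -M.barrierPos) ?_ ?_
  · have hz : -2 * M.α * √M.T - -M.barrierPos = -M.d32 := by rw [d32_eq hσ hT]; ring
    rw [hz, Φ_neg, φ_neg] at h
    refine (h.congr' ?_).congr_coeff rfl (fun n => rfl) (fun n => ?_)
    · filter_upwards [eventually_gt_atTop 0] with n hn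
      rw [← M.prob_eq hn]
    · linear_combination φ M.d32 * betaPoly_add_eq_g hT (d := M.d32) (δ := -M.barrierPos)
        (by rw [d32_eq hσ hT]; ring)
  · filter_upwards [M.eventually_floor_two_mul_lL hL0 hL hσ hT] with n hn
    rw [belowBarrier]
    omega
  · filter_upwards [M.eventually_floor_two_mul_lL hL0 hL hσ hT, eventually_gt_atTop 0] with n hn hn0
    rw [(M.two_mul_belowBarrier hs hσ hT hn0 hn.1 hn.2).1, M.floor_two_mul_lL hT]
    linear_combination (M.ΔL n - M.ε n) * sqrt_mul_invSqrt hn0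

/-- The mirror term uses probability `1 - p`, which reverses the sign of `y`, and a strict
inequality, which changes the fluctuation to `ΔL + ε`. -/
theorem hasExpansion_binomCdf_strictlyBelowBarrier (hL0 : 0 < M.L) (hL : M.L < M.s0)
    (hσ : 0 < M.σ) (hT : 0 < M.T) :
    HasExpansion (fun n => binomCdf n (M.strictlyBelowBarrier n) (1 - M.prob n)) (Φ M.d42)
      (fun n => -(φ M.d42 * (M.ΔL n + M.ε n)))
      (fun n => φ M.d42 * (M.g M.d42 - M.d42 / 2 * (M.ΔL n + M.ε n) ^ 2)) := by
  have hs := hL0.trans hL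
  have hy := (M.hasExpansion_probPos hσ hT).neg.congr_coeff (b' := fun _ => 0)
    (c' := fun _ => 2 * M.β * √M.T ^ 3) rfl (fun n => neg_zero) (fun n => by ring)
  have h := hy.binomCdf (M.ΔL_isBigO_one.add M.ε_isBigO_one)
    (k := M.strictlyBelowBarrier) (δ₀ := -M.barrierPos) ?_ ?_
  · have hz : -(-2 * M.α * √M.T) - -M.barrierPos = M.d42 := by rw [d42_eq hσ hT]; ring
    rw [hz] at h
    refine (h.congr' ?_).congr_coeff rfl (fun n => rfl) (fun n => ?_)
    · filter_upwards [eventually_gt_atTop 0] with n hn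
      congr 1
      rw [M.prob_eq hn]
      ring
    · have hg := betaPoly_add_eq_g hT (d := M.d42) (δ := M.barrierPos)
        (by rw [d42_eq hσ hT]; ring)
      -- Exchanging up and down moves reverses both arguments, and `betaPoly` is odd under this,
      -- which accounts for the opposite signs of `g` at `d32` and `d42`.
      have hodd : betaPoly (-M.barrierPos) (-(-2 * M.α * √M.T))
          = -betaPoly M.barrierPos (-2 * M.α * √M.T) := by unfold betaPoly; ring
      rw [hodd]
      linear_combination -φ M.d42 * hg
  · filter_upwards [M.eventually_floor_two_mul_lL hL0 hL hσ hT] with n hn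
    rw [strictlyBelowBarrier]
    omega
  · filter_upwards [M.eventually_floor_two_mul_lL hL0 hL hσ hT, eventually_gt_atTop 0] with n hn hn0
    rw [(M.two_mul_belowBarrier hs hσ hT hn0 hn.1 hn.2).2, M.floor_two_mul_lL hT]
    linear_combination (M.ΔL n + M.ε n) * sqrt_mul_invSqrt hn0

/-- The three expansions multiply out to the stated coefficients. In the mirror term the likelihood
ratio tends to `R`; its `1/√n` and `1/n` corrections produce the terms with `α` outside `g`, and
`I`. -/
theorem hasExpansion_priceCRROut (hK : 0 < M.K) (hKL : M.K < M.L) (hL : M.L < M.s0)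
    (hσ : 0 < M.σ) (hT : 0 < M.T) :
    HasExpansion (fun n => exp (M.r * M.T) * M.priceCRROut n) (Φ M.d32 - M.R * Φ M.d42)
      (fun n => M.E1 n + M.E2 * M.ΔL n)
      (fun n => M.F1 n + M.F2 n * M.ΔL n + M.F3 * M.ΔL n ^ 2) := by
  have hL0 : 0 < M.L := hK.trans hKL
  have hs := hL0.trans hL
  have h1 := M.hasExpansion_binomCdf_belowBarrier hL0 hL hσ hT
  have h2 := M.hasExpansion_binomCdf_strictlyBelowBarrier hL0 hL hσ hT
  have h3 := M.hasExpansion_ratio hσ hT M.barrierPos M.ΔL_isBigO_one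
    (m := fun n => ⌊2 * M.lL n⌋ - n)
    (Eventually.of_forall fun n => by push_cast; rw [M.floor_two_mul_lL hT]; ring)
  rw [exp_barrierPos hs hL0 hσ hT] at h3
  refine ((((HasExpansion.const 1).sub h1).sub (h3.mul h2)).congr' ?_).congr_coeff
    (by ring) (fun n => ?_) (fun n => ?_)
  · filter_upwards [M.eventually_floor_two_mul_lL hL0 hL hσ hT, eventually_gt_atTop 0,
      M.eventually_prob_mem_Ioo hσ hT] with n hn hn0 hp
    rw [M.priceCRROut_eq hK hKL hL hσ hT hn0 hp.1 hp.2 hn.2 (k₁ := M.belowBarrier n)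
      (k₂ := M.strictlyBelowBarrier n) (fun j => by rw [belowBarrier]; omega)
      (fun j => by rw [strictlyBelowBarrier]; omega), ← mul_assoc, ← exp_add,
      neg_mul, add_neg_cancel, exp_zero, one_mul]
  · unfold E1 E2
    ring
  · have hT2 : M.T = √M.T ^ 2 := (sq_sqrt hT.le).symm
    rw [F1, F2, F3, I_eq hσ hT]
    linear_combination (8 * M.R * Φ M.d42 * M.α ^ 2 * M.ΔL n ^ 2) * hT2

/-- The largest number of up moves that ends strictly below the strike. -/
def belowStrike (n : ℕ) : ℕ :=
  (-⌊log (M.s0 / M.K) / (2 * M.σ * √(M.dt n)) - (n : ℝ) / 2⌋ - 1).toNat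

lemma eventually_belowStrike (hT : 0 < M.T) :
    ∀ᶠ n in atTop, M.belowStrike n < n ∧ (M.belowStrike n : ℤ) + 1
      = -⌊log (M.s0 / M.K) / (2 * M.σ * √(M.dt n)) - (n : ℝ) / 2⌋ := by
  filter_upwards [(tendsto_mul_sqrt_add M.strikePos).eventually_ge_atTop 0,
    (tendsto_mul_sqrt_add (-M.strikePos)).eventually_gt_atTop 0,
    eventually_gt_atTop 0] with n h1 h2 hn
  have hx : log (M.s0 / M.K) / (2 * M.σ * √(M.dt n)) = M.strikePos * √(n : ℝ) / 2 := by
    rw [mul_assoc, ← div_div, div_right_comm, M.div_sqrt_dt hT, strikePos]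
  rw [belowStrike, hx]
  have hlo : -(n : ℤ) ≤ ⌊M.strikePos * √(n : ℝ) / 2 - (n : ℝ) / 2⌋ :=
    Int.le_floor.2 (by push_cast; linarith)
  have hhi : ⌊M.strikePos * √(n : ℝ) / 2 - (n : ℝ) / 2⌋ < 0 :=
    Int.floor_lt.2 (by push_cast; linarith)
  omega

/-- For `k = belowStrike n`, `n - 1 - 2k` equals `strikePos * √n + ΔK`, so the fluctuation of `δ` is
`ΔK` itself. -/
theorem hasExpansion_binomCdf_belowStrike (hσ : 0 < M.σ) (hT : 0 < M.T) :
    HasExpansion (fun n => binomCdf n (M.belowStrike n) (M.prob n)) (1 - Φ M.d12)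
      (fun n => -(M.c1 * M.ΔK n)) (fun n => -(M.c3 + M.c2 * M.ΔK n ^ 2)) := by
  have h := (M.hasExpansion_probPos hσ hT).binomCdf M.ΔK_isBigO_one
    (k := M.belowStrike) (δ₀ := M.strikePos) ?_ ?_
  · have hz : -2 * M.α * √M.T - M.strikePos = -M.d12 := by rw [d12_eq hσ hT]; ring
    rw [hz, Φ_neg, φ_neg] at h
    refine (h.congr' ?_).congr_coeff rfl (fun n => rfl) (fun n => ?_)
    · filter_upwards [eventually_gt_atTop 0] with n hn
      rw [← M.prob_eq hn]
    · rw [c2, c3]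
      linear_combination φ M.d12 * betaPoly_add_eq_cTilde hσ hT (δ := M.strikePos)
        (by rw [d12_eq hσ hT]; ring)
  · filter_upwards [M.eventually_belowStrike hT] with n hn using hn.1
  · filter_upwards [M.eventually_belowStrike hT, eventually_gt_atTop 0] with n hn hn0
    have hx : log (M.s0 / M.K) / (2 * M.σ * √(M.dt n)) = M.strikePos * √(n : ℝ) / 2 := by
      rw [mul_assoc, ← div_div, div_right_comm, M.div_sqrt_dt hT, strikePos]
    have hk : (M.belowStrike n : ℝ) + 1
        = -⌊log (M.s0 / M.K) / (2 * M.σ * √(M.dt n)) - (n : ℝ) / 2⌋ := by exact_mod_cast hn.2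
    rw [ΔK, Int.fract]
    rw [hx] at hk ⊢
    linear_combination 2 * hk + (1 - 2 * (M.strikePos * √(n : ℝ) / 2 - (n : ℝ) / 2
      - ⌊M.strikePos * √(n : ℝ) / 2 - (n : ℝ) / 2⌋)) * sqrt_mul_invSqrt hn0

theorem hasExpansion_priceCRRIn (hK : 0 < M.K) (hKL : M.K < M.L) (hL : M.L < M.s0)
    (hσ : 0 < M.σ) (hT : 0 < M.T) :
    HasExpansion (fun n => exp (M.r * M.T) * M.priceCRRIn n)
      (Φ M.d12 - (Φ M.d32 - M.R * Φ M.d42))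
      (fun n => M.G1 n + M.G2 * M.ΔK n + M.G3 * M.ΔL n)
      (fun n => M.H1 n + M.H2 * M.ΔK n ^ 2 + M.H3 n * M.ΔL n + M.H4 * M.ΔL n ^ 2) := by
  have hs : M.K < M.s0 := hKL.trans hL
  refine ((((HasExpansion.const 1).sub (M.hasExpansion_binomCdf_belowStrike hσ hT)).sub
    (M.hasExpansion_priceCRROut hK hKL hL hσ hT)).congr' ?_).congr_coeff
    (by ring) (fun n => ?_) (fun n => ?_)
  · filter_upwards [M.eventually_belowStrike hT, eventually_gt_atTop 0] with n hn hn0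
    rw [M.priceCRRIn_eq hσ hT (hK.trans hs) hK hn0 hn.2, mul_sub (exp _), ← mul_assoc, ← exp_add,
      neg_mul, add_neg_cancel, exp_zero, one_mul]
  · unfold G1 G2 G3
    ring
  · unfold H1 H2 H3 H4
    ring

/-- The expansion of an undiscounted price, as an expansion of the discounted price. -/
lemma HasExpansion.discount {f : ℕ → ℝ} {a v : ℝ} {b c : ℕ → ℝ}
    (h : HasExpansion (fun n => exp (M.r * M.T) * f n) a b c) (hv : v = exp (-M.r * M.T) * a) :
    (fun n : ℕ => (f n - v) - exp (-M.r * M.T) * (b n / √(n : ℝ) + c n / (n : ℝ)))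
      =O[atTop] fun n : ℕ => (n : ℝ) ^ (-(3 / 2 : ℝ)) := by
  refine (h.err.const_mul_left (exp (-M.r * M.T))).congr (fun n => ?_) fun n => invSqrt_pow_three n
  have he : exp (-M.r * M.T) * exp (M.r * M.T) = 1 := by
    rw [← exp_add, neg_mul, neg_add_cancel, exp_zero]
  rw [hv, invSqrt_sq, invSqrt]
  linear_combination f n * he

end BarrierModel

end

theorem theorem2 (M : BarrierModel) (hK : 0 < M.K) (hKL : M.K < M.L) (hL : M.L < M.s0)
    (hr : 0 ≤ M.r) (hσ : 0 < M.σ) (hT : 0 < M.T)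
    {Ω : Type*} [MeasurableSpace Ω] (P : Measure Ω) [IsProbabilityMeasure P]
    (B : ℝ≥0 → Ω → ℝ) (hB : IsBrownianReal B P) :
    ((fun n : ℕ => (M.priceCRROut n - M.priceBSOut P B)
        - exp (-M.r * M.T) *
          ((M.E1 n + M.E2 * M.ΔL n) / √(n : ℝ)
            + (M.F1 n + M.F2 n * M.ΔL n + M.F3 * M.ΔL n ^ 2) / (n : ℝ)))
      =O[atTop] fun n : ℕ => (n : ℝ) ^ (-(3 / 2 : ℝ)))
    ∧ ((fun n : ℕ => (M.priceCRRIn n - M.priceBSIn P B)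
        - exp (-M.r * M.T) *
          ((M.G1 n + M.G2 * M.ΔK n + M.G3 * M.ΔL n) / √(n : ℝ)
            + (M.H1 n + M.H2 * M.ΔK n ^ 2 + M.H3 n * M.ΔL n + M.H4 * M.ΔL n ^ 2) / (n : ℝ)))
      =O[atTop] fun n : ℕ => (n : ℝ) ^ (-(3 / 2 : ℝ))) := by
  exact ⟨(M.hasExpansion_priceCRROut hK hKL hL hσ hT).discount M
      (M.priceBSOut_eq hB hK hKL hL hσ hT),
    (M.hasExpansion_priceCRRIn hK hKL hL hσ hT).discount M
      (M.priceBSIn_eq hB hK hKL hL hσ hT)⟩
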